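/- **Setting.** Let $\Omega\subset\mathbb R^3$ be bounded and open. Let $\lambda,\sigma>0$, and let $A_e$ (a scalar) and $\boldsymbol B$ (a vector field) be smooth on a neighbourhood of $\overline\Omega$, with $A_e>0$ in $\Omega$, $A_e=0$ on $\partial\Omega$ and $\boldsymbol B\neq 0$ on $\overline\Omega$; write $B=|\boldsymbol B|$. Let $C^\infty(\overline\Omega)$ be the space of functions on $\Omega$ that extend smoothly to a neighbourhood of $\overline\Omega$, and let $\mathfrak X$ be a linear space with $C_c^\infty(\Omega)\subseteq\mathfrak X\subseteq C^\infty(\overline\Omega)$. For $\chi\in\mathfrak X$ put $$\nabla_\perp\chi=-B^{-2}\boldsymbol B\times(\boldsymbol B\times\nabla\chi),\quad \boldsymbol v^\chi=\frac{\boldsymbol B\times\nabla\chi}{B^2},\quad \omega=\nabla\cdot\Big(A_e\frac{\nabla_\perp\chi}{B^2}\Big),\quad \eta=\mathcal D\chi=\lambda A_e\chi-\sigma\omega .$$ The generalized Hasegawa–Mima (GHM) equation is $$\partial_t\,\mathcal D\chi=\nabla\cdot\Big[A_e\Big(\sigma\frac{\boldsymbol B\cdot\nabla\times\boldsymbol v^\chi}{B^2}-1\Big)\boldsymbol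 v^\chi\Big]\quad\text{in }\Omega .$$ The phase space is $\mathcal D(\mathfrak X)$. A functional $F$ on it has functional derivative $F_\eta=\delta F/\delta\eta\in C^\infty(\overline\Omega)$ at $\eta$ if $\frac{d}{ds}F(\eta+s\,\delta\eta)|_{s=0}=\int_\Omega F_\eta\,\delta\eta\,d\boldsymbol x$ for all $\delta\eta\in\mathcal D(\mathfrak X)$. A family $\chi_s$, $s\in\mathbb R^k$, in $C^\infty(\overline\Omega)$ is called smooth if it is jointly smooth in $(s,\boldsymbol x)$ up to $\overline\Omega$. Let $\mathcal A$ be the set of functionals $F$ that have a functional derivative at every $\eta\in\mathcal D(\mathfrak X)$ and for which $F_\eta(\mathcal D\chi_s)$ is a smooth family for every smooth finite-dimensional family $\chi_s$ in $\mathfrak X$. Put, with $\chi=\mathcal D^{-1}\eta$, $$\{F,G\}=\int_\Omega A_e\Big(1-\sigma\frac{\boldsymbol B\cdot\nabla\times\boldsymbol v^\chi}{B^2}\Big)\nabla F_\eta\cdot\frac{\boldsymbol B}{B^2}\times\nabla G_\eta\,d\boldsymbol x,\qquad \{F,G\}'=\int_\Omega\eta\,\nabla F_\eta\cdot\frac{\boldsymbol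 B}{B^2}\times\nabla G_\eta\,d\boldsymbol x,$$ $$H_\Omega=\tfrac12\int_\Omega A_e\Big(\lambda\chi^2+\sigma\frac{|\nabla_\perp\chi|^2}{B^2}\Big)d\boldsymbol x,\quad M_\Omega=c\int_\Omega A_e(1+\lambda\chi)\,d\boldsymbol x,\quad W_\Omega=\int_\Omega A_e\,w\Big(\lambda\chi-\sigma\frac{\omega}{A_e}\Big)d\boldsymbol x,$$ with $c\in\mathbb R$ a constant and $w:\mathbb R\to\mathbb R$ an arbitrary smooth function. A bracket is called antisymmetric on $\mathcal A$ if $\mathcal A$ is closed under linear combinations and products and the bracket is bilinear, alternating, antisymmetric and satisfies the Leibniz rule on $\mathcal A$. It is a Poisson bracket on $\mathcal A$ if moreover it maps $\mathcal A\times\mathcal A$ to $\mathcal A$ and satisfies the Jacobi identity. A Casimir invariant is an element of $\mathcal A$ whose bracket with every element of $\mathcal A$ is zero. **Statement.** (a) $\mathcal D$ is injective on $\mathfrak X$, and functional derivatives are unique. The bracket $\{\cdot,\cdot\}$ is antisymmetric on $\mathcal A$, and $M_\Omega$ is a Casimir invariant of it. Moreover $H_\Omega\in\mathcal A$, with $\delta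 H_\Omega/\delta\eta=\chi$. (b) Suppose $\nabla\times\big(A_e\boldsymbol B/B^2\big)=\boldsymbol 0$ in $\Omega$. Then: 1. $\{\cdot,\cdot\}'$ is an antisymmetric bracket on $\mathcal A$. It is a Poisson bracket on $\mathcal A$ (in particular it satisfies the Jacobi identity) whenever $\mathcal D^{-1}$ is well defined on the functions $\nabla\cdot(\eta\,\frac{\boldsymbol B}{B^2}\times\nabla f)$ in the following sense: for all smooth families $\chi_s$ in $\mathfrak X$ and $f_s$ in $C^\infty(\overline\Omega)$, $s\in\mathbb R^k$, there is a smooth family $\chi'_s$ in $\mathfrak X$ with $\mathcal D\chi'_s=\nabla\cdot(\mathcal D\chi_s\,\frac{\boldsymbol B}{B^2}\times\nabla f_s)$ in $\Omega$. 2. The GHM equation is equivalent to $\partial_t\eta=\{\eta,H_\Omega\}'$: a field $\chi(t)\in\mathfrak X$, jointly smooth in $(t,\boldsymbol x)$ up to $\overline\Omega$ for $t$ in an open set of times, satisfies the GHM equation at time $t$ if and only if $\frac{d}{dt}\int_\Omega\varphi\,\eta\,d\boldsymbol x=\{\int_\Omega\varphi\,\eta\,d\boldsymbol x,H_\Omega\}'$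 at time $t$ for all $\varphi\in C_c^\infty(\Omega)$, and also if and only if $\frac{d}{dt}F(\eta(t))=\{F,H_\Omega\}'(\eta(t))$ at time $t$ for all $F\in\mathcal A$. 3. $W_\Omega$ and $M_\Omega$ are Casimir invariants of $\{\cdot,\cdot\}'$. -/

import Mathlib

open Set MeasureTheory
open scoped ContDiff

noncomputable section

namespace GHM

/-- Euclidean three-space. -/
abbrev E3 := EuclideanSpace ℝ (Fin 3)

/-- Real-valued functionals of a scalar field. -/
abbrev Functional := (E3 → ℝ) → ℝ

/-! ### Vector calculus -/

/-- The partial derivative `∂f/∂xᵢ`. -/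
def pd (i : Fin 3) (f : E3 → ℝ) (x : E3) : ℝ :=
  fderiv ℝ f x (EuclideanSpace.single i 1)

def grad (f : E3 → ℝ) (x : E3) : E3 := !₂[pd 0 f x, pd 1 f x, pd 2 f x]

def divergence (V : E3 → E3) (x : E3) : ℝ := ∑ i : Fin 3, pd i (fun y => V y i) x

def curl (V : E3 → E3) (x : E3) : E3 :=
  !₂[pd 1 (fun y => V y 2) x - pd 2 (fun y => V y 1) x,
     pd 2 (fun y => V y 0) x - pd 0 (fun y => V y 2) x,
     pd 0 (fun y => V y 1) x - pd 1 (fun y => V y 0) x]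

def cross (a b : E3) : E3 :=
  !₂[a 1 * b 2 - a 2 * b 1, a 2 * b 0 - a 0 * b 2, a 0 * b 1 - a 1 * b 0]

/-! ### Functions that are smooth up to the boundary

A function on `Ω` is represented by the function on the whole space that agrees with it on `Ω` and
is zero outside `Ω`, so that two functions on `Ω` are equal iff their representatives are. Since
`Ω` is open, derivatives at points of `Ω` do not see the extension by zero. -/

/-- `f` is smooth on an open neighbourhood of the closure of `Ω`. -/
def SmoothUpTo {V : Type*} [NormedAddCommGroup V] [NormedSpace ℝ V] (Ω : Set E3)
    (f : E3 → V) : Prop :=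
  ∃ U : Set E3, IsOpen U ∧ closure Ω ⊆ U ∧ ContDiffOn ℝ ∞ f U

/-- The space `C^∞(Ω̄)`. -/
def SmoothBar (Ω : Set E3) : Set (E3 → ℝ) :=
  {u | (∀ x, x ∉ Ω → u x = 0) ∧ ∃ f : E3 → ℝ, SmoothUpTo Ω f ∧ EqOn u f Ω}

/-- Families `p s ∈ C^∞(Ω̄)` that depend jointly smoothly on the parameter `s ∈ S` and on the
point of `Ω̄`. -/
def SmoothFamilyOn {P : Type*} [NormedAddCommGroup P] [NormedSpace ℝ P] (Ω : Set E3)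
    (S : Set P) (p : P → E3 → ℝ) : Prop :=
  (∀ s ∈ S, ∀ x, x ∉ Ω → p s x = 0) ∧
  ∃ (U : Set E3) (f : P × E3 → ℝ), IsOpen U ∧ closure Ω ⊆ U ∧
    ContDiffOn ℝ ∞ f (S ×ˢ U) ∧ ∀ s ∈ S, ∀ x ∈ Ω, p s x = f (s, x)

/-- Test functions: smooth with compact support contained in `Ω`. -/
def TestFunctions (Ω : Set E3) : Set (E3 → ℝ) :=
  {φ | ContDiff ℝ ∞ φ ∧ HasCompactSupport φ ∧ tsupport φ ⊆ Ω}

/-! ### The generalized Hasegawa-Mima equation -/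

/-- The data: region, electron density, magnetic field, the constants `λ`, `σ`, and the linear
space `𝔛` to which the field `χ` belongs. -/
structure Setting where
  Ω : Set E3
  A : E3 → ℝ
  B : E3 → E3
  lam : ℝ
  sig : ℝ
  X : Submodule ℝ (E3 → ℝ)

namespace Setting

variable (S : Setting)

/-- `B / B²`. -/
def b (x : E3) : E3 := (‖S.B x‖ ^ 2)⁻¹ • S.B x

/-- `∇_⊥ χ = - B⁻² B × (B × ∇χ)`. -/
def gradPerp (χ : E3 → ℝ) (x : E3) : E3 :=
  -((‖S.B x‖ ^ 2)⁻¹ • cross (S.B x) (cross (S.B x) (grad χ x)))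

/-- `v_E^χ = B × ∇χ / B²`. -/
def vE (χ : E3 → ℝ) (x : E3) : E3 := (‖S.B x‖ ^ 2)⁻¹ • cross (S.B x) (grad χ x)

/-- `ω = ∇ · (A_e ∇_⊥ χ / B²)`. -/
def omega (χ : E3 → ℝ) (x : E3) : ℝ :=
  divergence (fun y => (S.A y / ‖S.B y‖ ^ 2) • S.gradPerp χ y) x

/-- `𝒟χ = λ A_e χ - σ ω`, as a function on `Ω`. -/
def D (χ : E3 → ℝ) : E3 → ℝ :=
  S.Ω.indicator (fun x => S.lam * S.A x * χ x - S.sig * S.omega χ x)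

/-- The phase space of the variable `η = 𝒟χ`, `χ ∈ 𝔛`. -/
def Phase : Set (E3 → ℝ) := S.D '' (S.X : Set (E3 → ℝ))

/-- The inverse operator `𝒟⁻¹`, mapping `η` to `χ ∈ 𝔛`. -/
def Dinv (η : E3 → ℝ) : E3 → ℝ := Function.invFunOn S.D (S.X : Set (E3 → ℝ)) η

/-- `1 - σ B · ∇ × v_E^χ / B²`. -/
def zeta (χ : E3 → ℝ) (x : E3) : ℝ :=
  1 - S.sig * (inner ℝ (S.B x) (curl (S.vE χ) x) / ‖S.B x‖ ^ 2)

/-- The right-hand side `∇ · [A_e (σ B · ∇ × v_E^χ / B² - 1) v_E^χ]` of the equation. -/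
def rhs (χ : E3 → ℝ) (x : E3) : ℝ :=
  divergence (fun y =>
    (S.A y * (S.sig * (inner ℝ (S.B y) (curl (S.vE χ) y) / ‖S.B y‖ ^ 2) - 1)) • S.vE χ y) x

/-- The time-dependent field `χ` satisfies the equation at time `t`, everywhere in `Ω`. -/
def SolvesAt (χ : ℝ → E3 → ℝ) (t : ℝ) : Prop :=
  ∀ x ∈ S.Ω, HasDerivAt (fun s => S.D (χ s) x) (S.rhs (χ t) x) t

/-- The integrability condition `∇ × (A_e B / B²) = 0` in `Ω`. -/
def Integrability : Prop := ∀ x ∈ S.Ω, curl (fun y => S.A y • S.b y) x = 0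

/-! ### Functional derivatives and brackets -/

/-- `g = δF/δη` at `η`: the function `g ∈ C^∞(Ω̄)` represents the first variation of `F` along all
admissible variations `δη = 𝒟δχ`, `δχ ∈ 𝔛`. -/
def HasFunDeriv (F : Functional) (η g : E3 → ℝ) : Prop :=
  g ∈ SmoothBar S.Ω ∧
  ∀ δη ∈ S.Phase, HasDerivAt (fun s : ℝ => F (η + s • δη)) (∫ x in S.Ω, g x * δη x) 0

open Classical in
/-- The functional derivative `δF/δη` at `η`. -/
def funDeriv (F : Functional) (η : E3 → ℝ) : E3 → ℝ :=
  if h : ∃ g, S.HasFunDeriv F η g then h.choose else 0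

/-- Smooth functionals on the phase space: the functional derivative exists everywhere in
`C^∞(Ω̄)` and depends smoothly on the state, in the sense that it takes smooth finite-dimensional
families of states to smooth families. -/
def Observables : Set Functional :=
  {F | ∃ g : (E3 → ℝ) → (E3 → ℝ), (∀ η ∈ S.Phase, S.HasFunDeriv F η (g η)) ∧
    ∀ (k : ℕ) (p : (Fin k → ℝ) → E3 → ℝ), SmoothFamilyOn S.Ω univ p → (∀ s, p s ∈ S.X) →
      SmoothFamilyOn S.Ω univ (fun s => g (S.D (p s)))}

/-- The bracket `{F,G} = ∫ A_e (1 - σ B · ∇ × v_E^χ / B²) ∇F_η · (B/B²) × ∇G_η dx`. -/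
def bracket (F G : Functional) : Functional := fun η =>
  ∫ x in S.Ω, S.A x * S.zeta (S.Dinv η) x *
    inner ℝ (grad (S.funDeriv F η) x) (cross (S.b x) (grad (S.funDeriv G η) x))

/-- The bracket `{F,G}' = ∫ η ∇F_η · (B/B²) × ∇G_η dx`. -/
def bracket' (F G : Functional) : Functional := fun η =>
  ∫ x in S.Ω, η x *
    inner ℝ (grad (S.funDeriv F η) x) (cross (S.b x) (grad (S.funDeriv G η) x))

/-- The operator `𝒟⁻¹` is defined, and smooth in families, on the functions
`∇ · (η (B/B²) × ∇f)`, with `η = 𝒟χ`, `χ ∈ 𝔛` and `f ∈ C^∞(Ω̄)`. -/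
def InverseDefined : Prop :=
  ∀ (k : ℕ) (p q : (Fin k → ℝ) → E3 → ℝ),
    SmoothFamilyOn S.Ω univ p → (∀ s, p s ∈ S.X) → SmoothFamilyOn S.Ω univ q →
    ∃ r : (Fin k → ℝ) → E3 → ℝ, SmoothFamilyOn S.Ω univ r ∧ (∀ s, r s ∈ S.X) ∧
      ∀ s, ∀ x ∈ S.Ω, S.D (r s) x =
        divergence (fun y => S.D (p s) y • cross (S.b y) (grad (q s) y)) x

/-! ### The functionals -/

/-- The energy `H_Ω`, as a functional of `η`. -/
def energy : Functional := fun η =>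
  1 / 2 * ∫ x in S.Ω, S.A x *
    (S.lam * S.Dinv η x ^ 2 + S.sig * (‖S.gradPerp (S.Dinv η) x‖ ^ 2 / ‖S.B x‖ ^ 2))

/-- The mass `M_Ω` with prefactor `c` (`c = m/Z` for the ion mass). -/
def mass (c : ℝ) : Functional := fun η =>
  c * ∫ x in S.Ω, S.A x * (1 + S.lam * S.Dinv η x)

/-- The generalized enstrophy `W_Ω = ∫ A_e w(λχ - σω/A_e) dx`. -/
def enstrophy (w : ℝ → ℝ) : Functional := fun η =>
  ∫ x in S.Ω, S.A x *
    w (S.lam * S.Dinv η x - S.sig * (S.omega (S.Dinv η) x / S.A x))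

/-- The field `η` smeared with `φ`: the functional `η ↦ ∫ φ η dx`, with `δ/δη = φ`. -/
def smeared (φ : E3 → ℝ) : Functional := fun η => ∫ x in S.Ω, φ x * η x

end Setting

/-! ### Bracket axioms, on a class `𝒜` of functionals on a phase space `P` -/

/-- `𝒜` is an algebra of functionals on `P`, and `br` is bilinear, alternating, antisymmetric and
satisfies the Leibniz rule on it. -/
structure IsAntisymmetricBracket (P : Set (E3 → ℝ)) (𝒜 : Set Functional)
    (br : Functional → Functional → Functional) : Prop where
  linear_mem : ∀ F ∈ 𝒜, ∀ G ∈ 𝒜, ∀ a b : ℝ, a • F + b • G ∈ 𝒜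
  mul_mem : ∀ F ∈ 𝒜, ∀ G ∈ 𝒜, F * G ∈ 𝒜
  linear_left : ∀ F ∈ 𝒜, ∀ G ∈ 𝒜, ∀ H ∈ 𝒜, ∀ a b : ℝ, ∀ η ∈ P,
    br (a • F + b • G) H η = a * br F H η + b * br G H η
  linear_right : ∀ F ∈ 𝒜, ∀ G ∈ 𝒜, ∀ H ∈ 𝒜, ∀ a b : ℝ, ∀ η ∈ P,
    br H (a • F + b • G) η = a * br H F η + b * br H G η
  alternating : ∀ F ∈ 𝒜, ∀ η ∈ P, br F F η = 0
  antisymm : ∀ F ∈ 𝒜, ∀ G ∈ 𝒜, ∀ η ∈ P, br F G η = - br G F η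
  leibniz : ∀ F ∈ 𝒜, ∀ G ∈ 𝒜, ∀ H ∈ 𝒜, ∀ η ∈ P,
    br (F * G) H η = F η * br G H η + br F H η * G η

/-- An antisymmetric bracket that maps `𝒜 × 𝒜` to `𝒜` and satisfies the Jacobi identity. -/
structure IsPoissonBracket (P : Set (E3 → ℝ)) (𝒜 : Set Functional)
    (br : Functional → Functional → Functional) : Prop
    extends IsAntisymmetricBracket P 𝒜 br where
  bracket_mem : ∀ F ∈ 𝒜, ∀ G ∈ 𝒜, br F G ∈ 𝒜
  jacobi : ∀ F ∈ 𝒜, ∀ G ∈ 𝒜, ∀ H ∈ 𝒜, ∀ η ∈ P,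
    br F (br G H) η + br G (br H F) η + br H (br F G) η = 0

/-- `C ∈ 𝒜` has vanishing bracket with every element of `𝒜`. -/
def IsCasimir (P : Set (E3 → ℝ)) (𝒜 : Set Functional)
    (br : Functional → Functional → Functional) (C : Functional) : Prop :=
  C ∈ 𝒜 ∧ ∀ G ∈ 𝒜, ∀ η ∈ P, br C G η = 0

end GHM

end

noncomputable section

namespace GHM

open Filter Topology

/-! ### Cutoffs and extensions -/

/-! Write `β = B/B²` and `[f,g] = ∇f · (β × ∇g)`. All fields are first replaced by functions smooth
on the whole space, with `a` standing for `A_e`, so that calculus in `Ω` and at its boundary is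
unrestricted.

Nothing is assumed about the boundary beyond `a = 0` there. Replacing `a` by a truncation that
vanishes where `a` is small gives compactly supported integrands, and a limit shows that `∫_Ω div(a
V) = 0` for every smooth `V` (`setIntegral_pd_mul_eq_zero`). Hence `∫ χ 𝒟ξ = ∫ a (λ χ ξ + σ (β × ∇χ)
· (β × ∇ξ))`: the operator `𝒟` is symmetric and positive, which yields injectivity, uniqueness of
functional derivatives, and `δH/δη = χ` for the quadratic form `H = ½ ∫ χ 𝒟χ`. The mass is affine in
`η` with constant derivative, so its brackets vanish.

A functional in the class is only assumed differentiable along lines, with derivative smooth along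
families. Integrating that derivative over segments (`exists_integral_formula`) shows that it is
smooth along every smooth family, obeys the chain rule, and has symmetric second variations.

If `∇ × (a β) = 0`, then `div(a β × V) = -a β · ∇ × V`. Therefore `𝒟χ = a q` with a vorticity `q`
smooth up to the boundary, and `div(a m β × ∇g) = a [m,g]`. The right-hand side of the equation
becomes `-a [q,χ]`, so `{F,H}'` is `F_η` integrated against it: the evolution equation is recovered
by the chain rule in one direction and by test functions in the other. The enstrophy has derivative
`w'(q)`, and `q [w'(q),g] = [m(q),g]` for `m(k) = k w'(k) - w(k)`, whose integral against `a` is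
zero.

For the Jacobi identity, let `X_F` solve `𝒟 X_F = a [q,F_η]`. The derivative of `{F,G}'` is
`[F_η,G_η] + G''X_F - F''X_G`. In the cyclic sum the second variations cancel by symmetry, and what
remains is the Jacobi identity of `[·,·]`. This holds pointwise because its defect is `β · ∇ × β`
times the determinant of the three gradients, and `a β · ∇ × β = β · ∇ × (a β) = 0`. -/

theorem exists_contDiff_cutoff {V : Type*} [NormedAddCommGroup V] [NormedSpace ℝ V]
    [FiniteDimensional ℝ V] {K U : Set V} (hK : IsCompact K) (hU : IsOpen U) (hKU : K ⊆ U) :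
    ∃ ρ : V → ℝ, ContDiff ℝ ∞ ρ ∧ HasCompactSupport ρ ∧ tsupport ρ ⊆ U ∧ (∀ x ∈ K, ρ x = 1) ∧
      ∀ x, ρ x ∈ Icc (0 : ℝ) 1 := by
  obtain ⟨K₁, hK₁, hKK₁, hK₁U⟩ := exists_compact_between hK hU hKU
  obtain ⟨f, hf1, hf0, hf⟩ := exists_contMDiffMap_one_nhds_of_subset_interior
    (n := ⊤) (modelWithCornersSelf ℝ V) hK.isClosed hKK₁
  have hsupp : tsupport f ⊆ K₁ := by
    refine closure_minimal (fun x hx => ?_) hK₁.isClosed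
    by_contra h
    exact hx (hf0 x h)
  refine ⟨f, f.contMDiff.contDiff, hK₁.of_isClosed_subset (isClosed_tsupport _) hsupp,
    hsupp.trans hK₁U, fun x hx => ?_, hf⟩
  exact (eventually_nhdsSet_iff_forall.1 hf1 x hx).self_of_nhds

theorem contDiff_smul_of_tsupport_subset {Z V : Type*} [NormedAddCommGroup Z] [NormedSpace ℝ Z]
    [NormedAddCommGroup V] [NormedSpace ℝ V] {ρ : Z → ℝ} {f : Z → V} {O : Set Z} (hO : IsOpen O)
    (hρ : ContDiff ℝ ∞ ρ) (hf : ContDiffOn ℝ ∞ f O) (h : tsupport ρ ⊆ O) :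
    ContDiff ℝ ∞ (fun z => ρ z • f z) := by
  refine contDiff_iff_contDiffAt.2 fun z => ?_
  by_cases hz : z ∈ tsupport ρ
  · exact hρ.contDiffAt.smul (hf.contDiffAt (hO.mem_nhds (h hz)))
  · have : (fun z => ρ z • f z) =ᶠ[𝓝 z] fun _ => 0 := by
      filter_upwards [(isClosed_tsupport ρ).isOpen_compl.mem_nhds hz] with y hy
      rw [image_eq_zero_of_notMem_tsupport hy, zero_smul]
    exact contDiffAt_const.congr_of_eventuallyEq this

/-! ### Integrals depending on a parameter -/

section Param

variable {V : Type*} [NormedAddCommGroup V] [NormedSpace ℝ V] [FiniteDimensional ℝ V]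
  [MeasurableSpace V] [BorelSpace V] {μ : Measure V} [μ.IsAddHaarMeasure]

theorem integrableOn_of_continuous {h : V → ℝ} (hh : Continuous h) {W : Set V}
    (hb : Bornology.IsBounded W) : IntegrableOn h W μ :=
  (hh.continuousOn.integrableOn_compact hb.isCompact_closure).mono_set subset_closure

/-- The integral is the value at `0` of a convolution of the indicator of `W` with a compactly
supported function depending smoothly on the parameter, so smoothness of convolutions gives all
derivatives at once. The parameter space need not be finite-dimensional. -/
theorem contDiff_setIntegral {P : Type*} [NormedAddCommGroup P] [NormedSpace ℝ P]
    {h : P × V → ℝ} (hh : ContDiff ℝ ∞ h) {W : Set V} (hW : MeasurableSet W)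
    (hb : Bornology.IsBounded W) : ContDiff ℝ ∞ (fun s => ∫ x in W, h (s, x) ∂μ) := by
  obtain ⟨ρ, hρ, hρc, -, hρ1, -⟩ := exists_contDiff_cutoff hb.isCompact_closure isOpen_univ
    (subset_univ _)
  -- Convolution at `0` evaluates the second factor at `-x`, hence the reflections; the cutoff `ρ`
  -- is `1` on the closure of `W`, so it does not change the integral.
  have key := contDiffOn_convolution_right_with_param (n := ⊤) (μ := μ)
    (f := W.indicator fun _ => (1 : ℝ)) (ContinuousLinearMap.mul ℝ ℝ)
    (g := fun (s : P) x => ρ (-x) * h (s, -x)) (s := univ) (k := -tsupport ρ) isOpen_univ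
    hρc.isCompact.neg
    (fun p x _ hx => by
      have : -x ∉ tsupport ρ := fun h' => hx (by simpa using h')
      simp only [image_eq_zero_of_notMem_tsupport this, zero_mul])
    ((locallyIntegrable_const (1 : ℝ)).indicator hW)
    (by
      have : ContDiff ℝ ∞ (fun q : P × V => ρ (-q.2) * h (q.1, -q.2)) := by fun_prop
      exact this.contDiffOn)
  rw [univ_prod_univ, contDiffOn_univ] at key
  have h2 := key.comp (contDiff_id.prodMk (contDiff_const (c := (0 : V))))
  convert h2 using 1
  ext s
  simp only [Function.comp, convolution, id, ContinuousLinearMap.mul_apply', zero_sub, neg_neg]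
  rw [← integral_indicator hW]
  congr 1 with x
  by_cases hx : x ∈ W
  · simp [hx, hρ1 x (subset_closure hx)]
  · simp [hx]

theorem hasDerivAt_setIntegral {h : ℝ × V → ℝ} (hh : ContDiff ℝ ∞ h) {W : Set V}
    (hb : Bornology.IsBounded W) (t : ℝ) :
    HasDerivAt (fun s => ∫ x in W, h (s, x) ∂μ) (∫ x in W, deriv (fun s => h (s, x)) t ∂μ) t := by
  have hd : ∀ s x, HasDerivAt (fun s => h (s, x)) (fderiv ℝ h (s, x) (1, 0)) s := fun s x => by
    have h1 : HasFDerivAt h (fderiv ℝ h (s, x)) (s, x) :=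
      (hh.differentiable (by simp) (s, x)).hasFDerivAt
    have h2 : HasDerivAt (fun s : ℝ => (s, x)) ((1 : ℝ), (0 : V)) s :=
      (hasDerivAt_id s).prodMk (hasDerivAt_const s x)
    exact h1.comp_hasDerivAt s h2
  have hc : Continuous (fun q : ℝ × V => fderiv ℝ h q (1, 0)) :=
    (hh.continuous_fderiv (by simp)).clm_apply continuous_const
  -- A constant dominates the derivative, by compactness in time and space together.
  obtain ⟨C, hC⟩ := ((isCompact_closedBall t 1).prod hb.isCompact_closure).exists_bound_of_continuousOn
    hc.continuousOn
  have hmeas : ∀ u : V → ℝ, Continuous u → AEStronglyMeasurable u (μ.restrict W) := fun u hu =>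
    (integrableOn_of_continuous hu hb).aestronglyMeasurable
  have hfin : Integrable (fun _ : V => C) (μ.restrict W) :=
    integrableOn_of_continuous continuous_const hb
  have hin : ∀ᵐ x ∂(μ.restrict W), x ∈ closure W := by
    have h0 : ∀ᵐ x ∂(μ.restrict (closure W)), x ∈ closure W :=
      ae_restrict_mem isClosed_closure.measurableSet
    exact ae_restrict_of_ae_restrict_of_subset subset_closure h0
  have := (hasDerivAt_integral_of_dominated_loc_of_deriv_le (μ := μ.restrict W)
    (F := fun s x => h (s, x)) (F' := fun s x => fderiv ℝ h (s, x) (1, 0)) (x₀ := t)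
    (bound := fun _ => C)
    (Metric.closedBall_mem_nhds t one_pos)
    (Eventually.of_forall fun s => hmeas _ (by have := hh.continuous; fun_prop))
    (integrableOn_of_continuous (by have := hh.continuous; fun_prop) hb)
    (hmeas _ (hc.comp (by fun_prop)))
    (by filter_upwards [hin] with x hx s hs using hC (s, x) ⟨hs, hx⟩) hfin
    (Eventually.of_forall fun x s _ => hd s x)).2
  simpa only [(hd _ _).deriv] using this

end Param

/-! ### Integration by parts on `Ω` -/

theorem pd_eq_of_eqOn {Ω : Set E3} (hΩ : IsOpen Ω) {f g : E3 → ℝ} (h : EqOn f g Ω) {x : E3}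
    (hx : x ∈ Ω) (i : Fin 3) : pd i f x = pd i g x := by
  have : f =ᶠ[𝓝 x] g := h.eventuallyEq_of_mem (hΩ.mem_nhds hx)
  rw [pd, pd, this.fderiv_eq]

theorem contDiff_pd {Z : Type*} [NormedAddCommGroup Z] [NormedSpace ℝ Z] {f : Z → E3 → ℝ}
    {g : Z → E3} (hf : ContDiff ℝ ∞ (Function.uncurry f)) (hg : ContDiff ℝ ∞ g) (i : Fin 3) :
    ContDiff ℝ ∞ (fun z => pd i (f z) (g z)) :=
  (ContDiff.fderiv hf hg (by simp)).clm_apply contDiff_const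

theorem contDiff_pd_const {f : E3 → ℝ} (hf : ContDiff ℝ ∞ f) (i : Fin 3) :
    ContDiff ℝ ∞ (pd i f) :=
  contDiff_pd (f := fun _ : E3 => f) (g := fun z => z) (hf.comp contDiff_snd) contDiff_id i

theorem pd_mul {f g : E3 → ℝ} {x : E3} (hf : DifferentiableAt ℝ f x)
    (hg : DifferentiableAt ℝ g x) (i : Fin 3) :
    pd i (fun y => f y * g y) x = pd i f x * g x + f x * pd i g x := by
  simp only [pd, fderiv_fun_mul hf hg, add_apply,
    smul_apply, smul_eq_mul]
  ring

theorem pd_comp {m : ℝ → ℝ} {f : E3 → ℝ} {x : E3} (hm : DifferentiableAt ℝ m (f x))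
    (hf : DifferentiableAt ℝ f x) (i : Fin 3) :
    pd i (fun y => m (f y)) x = deriv m (f x) * pd i f x := by
  have := (hm.hasDerivAt.comp_hasFDerivAt x hf.hasFDerivAt).fderiv
  simp only [pd]
  erw [this]
  simp

theorem integral_pd_eq_zero {u : E3 → ℝ} (hu : ContDiff ℝ ∞ u) (hc : HasCompactSupport u)
    (i : Fin 3) : ∫ x, pd i u x = 0 := by
  have hpd := (contDiff_pd_const hu i).continuous
  have hpc : HasCompactSupport (pd i u) := by
    have := hc.fderiv (𝕜 := ℝ)
    exact this.comp_left (g := fun l : E3 →L[ℝ] ℝ => l (EuclideanSpace.single i 1)) rfl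
  have := integral_mul_fderiv_eq_neg_fderiv_mul_of_integrable (μ := (volume : Measure E3))
    (f := fun _ : E3 => (1 : ℝ)) (g := u) (v := EuclideanSpace.single i 1)
    (by simp) (by simp only [one_mul]; exact hpd.integrable_of_hasCompactSupport hpc)
    (by simpa using hu.continuous.integrable_of_hasCompactSupport hc)
    (fun _ _ => differentiableAt_const _)
    (fun x _ => hu.differentiable (by simp) x)
  simpa [pd] using this

/-- The rescalings `ψ(n s)/n` vanish for `s ≤ 1/n`, are bounded by `|s|`, have uniformly bounded
derivative, and coincide with `s` for `s > 2/n`. Composed with `a`, they approximate it by functions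
vanishing near the boundary. -/
theorem exists_smooth_truncation : ∃ ψ : ℝ → ℝ, ContDiff ℝ ∞ ψ ∧ (∀ s ≤ 1, ψ s = 0) ∧
    (∀ s, |ψ s| ≤ |s|) ∧ (∀ s, 2 < s → ψ s = s ∧ deriv ψ s = 1) ∧ ∃ C, ∀ s, |deriv ψ s| ≤ C := by
  have hsm : ContDiff ℝ ∞ (fun s : ℝ => s * Real.smoothTransition (s - 1)) :=
    contDiff_id.mul (Real.smoothTransition.contDiff.comp (contDiff_id.sub contDiff_const))
  have h1 : ∀ s : ℝ, 2 < s → deriv (fun s : ℝ => s * Real.smoothTransition (s - 1)) s = 1 := by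
    intro s hs
    have : (fun s : ℝ => s * Real.smoothTransition (s - 1)) =ᶠ[𝓝 s] id := by
      filter_upwards [lt_mem_nhds hs] with r hr
      rw [Real.smoothTransition.one_of_one_le (by linarith), mul_one, id]
    rw [this.deriv_eq, deriv_id]
  have h0 : ∀ s : ℝ, s < 1 → deriv (fun s : ℝ => s * Real.smoothTransition (s - 1)) s = 0 := by
    intro s hs
    have : (fun s : ℝ => s * Real.smoothTransition (s - 1)) =ᶠ[𝓝 s] fun _ => 0 := by
      filter_upwards [gt_mem_nhds hs] with r hr
      rw [Real.smoothTransition.zero_of_nonpos (by linarith), mul_zero]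
    rw [this.deriv_eq, deriv_const]
  obtain ⟨C, hC⟩ := (isCompact_Icc (a := (1 : ℝ)) (b := 2)).exists_bound_of_continuousOn
    (hsm.continuous_deriv (by simp)).continuousOn
  refine ⟨_, hsm, fun s hs => ?_, fun s => ?_, fun s hs => ⟨?_, h1 s hs⟩, max C 1, fun s => ?_⟩
  · rw [Real.smoothTransition.zero_of_nonpos (by linarith), mul_zero]
  · rw [abs_mul, abs_of_nonneg (Real.smoothTransition.nonneg _)]
    exact mul_le_of_le_one_right (abs_nonneg s) (Real.smoothTransition.le_one _)
  · rw [Real.smoothTransition.one_of_one_le (by linarith), mul_one]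
  · rcases lt_or_ge s 1 with h | h
    · rw [h0 s h, abs_zero]; exact le_max_of_le_right zero_le_one
    rcases lt_or_ge 2 s with h' | h'
    · rw [h1 s h', abs_one]; exact le_max_right _ _
    · exact (hC s ⟨h, h'⟩).trans (le_max_left _ _)

/-- The boundary may be arbitrarily rough: truncating the values of `a`, instead of cutting off by
distance to the boundary, keeps the gradients bounded. Each truncated integrand has compact support
in `Ω`, and dominated convergence removes the truncation. -/
theorem setIntegral_pd_mul_eq_zero {Ω : Set E3} (hΩ : IsOpen Ω) (hb : Bornology.IsBounded Ω)
    {a v : E3 → ℝ} (ha : ContDiff ℝ ∞ a) (hv : ContDiff ℝ ∞ v) (hpos : ∀ x ∈ Ω, 0 < a x)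
    (h0 : ∀ x ∈ frontier Ω, a x = 0) (i : Fin 3) :
    ∫ x in Ω, pd i (fun y => a y * v y) x = 0 := by
  obtain ⟨ψ, hψ, hψ0, hψle, hψ2, C, hC⟩ := exists_smooth_truncation
  let g : ℕ → E3 → ℝ := fun n y => ((n : ℝ) + 1)⁻¹ * ψ ((n + 1) * a y) * v y
  have hg : ∀ n, ContDiff ℝ ∞ (g n) := fun n => by fun_prop
  have hpd : ∀ n x, pd i (g n) x =
      deriv ψ ((n + 1) * a x) * pd i a x * v x
        + ((n : ℝ) + 1)⁻¹ * ψ ((n + 1) * a x) * pd i v x := by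
    intro n x
    have ha' : DifferentiableAt ℝ a x := ha.differentiable (by simp) x
    have hv' : DifferentiableAt ℝ v x := hv.differentiable (by simp) x
    have hψ' : Differentiable ℝ ψ := hψ.differentiable (by simp)
    have hn : (n : ℝ) + 1 ≠ 0 := by positivity
    have e1 : pd i (fun y => (n + 1 : ℝ) * a y) x = (n + 1) * pd i a x := by
      rw [pd_mul (differentiableAt_const _) ha']; simp [pd]
    have hd1 : DifferentiableAt ℝ (fun y => (n + 1 : ℝ) * a y) x := ha'.const_mul _
    have hd2 : DifferentiableAt ℝ (fun y => ψ ((n + 1 : ℝ) * a y)) x :=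
      (hψ' _).comp (f := fun y => (n + 1 : ℝ) * a y) x hd1
    have e2 := pd_comp (f := fun y => (n + 1 : ℝ) * a y) (hψ' _) hd1 i
    have e3 : pd i (fun y => ((n : ℝ) + 1)⁻¹ * ψ ((n + 1) * a y)) x
        = deriv ψ ((n + 1) * a x) * pd i a x := by
      rw [pd_mul (differentiableAt_const _) hd2, e2, e1]
      simp only [pd, fderiv_const_apply, zero_apply]
      field_simp
      ring
    rw [pd_mul (hd2.const_mul _) hv', e3]
  have hzero : ∀ n, ∫ x in Ω, pd i (g n) x = 0 := by
    intro n
    -- This set contains the support of the truncated function; it avoids the frontier, where `a =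
    -- 0`, and so is a compact subset of `Ω`.
    let K : Set E3 := closure Ω ∩ {x | 1 ≤ (n + 1) * a x}
    have hKc : IsCompact K := hb.isCompact_closure.inter_right
      (isClosed_le continuous_const (continuous_const.mul ha.continuous))
    have hKΩ : K ⊆ Ω := by
      rintro x ⟨hx, hx1⟩
      by_contra hxn
      have : x ∈ frontier Ω := by rw [hΩ.frontier_eq]; exact ⟨hx, hxn⟩
      have hx1' : 1 ≤ ((n : ℝ) + 1) * a x := hx1
      rw [h0 x this] at hx1'
      norm_num at hx1'
    have hKzero : ∀ x ∉ K, Ω.indicator (g n) x = 0 := by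
      intro x hx
      by_cases hxΩ : x ∈ Ω
      · have : ((n : ℝ) + 1) * a x ≤ 1 := by
          by_contra h'
          exact hx ⟨subset_closure hxΩ, (not_le.1 h').le⟩
        simp [hxΩ, g, hψ0 _ this]
      · simp [hxΩ]
    have hts : tsupport (Ω.indicator (g n)) ⊆ K :=
      closure_minimal (fun x hx => by by_contra h'; exact hx (hKzero x h')) hKc.isClosed
    have hsm : ContDiff ℝ ∞ (Ω.indicator (g n)) := by
      refine contDiff_iff_contDiffAt.2 fun x => ?_
      by_cases hx : x ∈ Ω
      · refine (hg n).contDiffAt.congr_of_eventuallyEq ?_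
        filter_upwards [hΩ.mem_nhds hx] with y hy using indicator_of_mem hy _
      · have : Ω.indicator (g n) =ᶠ[𝓝 x] fun _ => 0 := by
          filter_upwards [hKc.isClosed.isOpen_compl.mem_nhds fun h' => hx (hKΩ h')] with y hy
            using hKzero y hy
        exact contDiffAt_const.congr_of_eventuallyEq this
    have := integral_pd_eq_zero hsm (hKc.of_isClosed_subset (isClosed_tsupport _) hts) i
    rw [← this, ← integral_indicator hΩ.measurableSet]
    congr 1 with x
    by_cases hx : x ∈ Ω
    · rw [indicator_of_mem hx]
      exact pd_eq_of_eqOn hΩ (fun y hy => (indicator_of_mem hy (g n)).symm) hx i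
    · rw [indicator_of_notMem hx]
      have : Ω.indicator (g n) =ᶠ[𝓝 x] fun _ => 0 := by
        filter_upwards [hKc.isClosed.isOpen_compl.mem_nhds fun h' => hx (hKΩ h')] with y hy
          using hKzero y hy
      simp [pd, this.fderiv_eq]
  have hca := (contDiff_pd_const ha i).continuous
  have hcv := (contDiff_pd_const hv i).continuous
  have hlim : Tendsto (fun n => ∫ x in Ω, pd i (g n) x) atTop
      (𝓝 (∫ x in Ω, pd i (fun y => a y * v y) x)) := by
    -- The two terms of the bound come from `|ψ'| ≤ C` and from `|ψ s| ≤ |s|`. Pointwise in `Ω` the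
    -- sequence is eventually constant, since `a x > 0`.
    refine tendsto_integral_of_dominated_convergence
      (fun x => C * |pd i a x * v x| + |a x * pd i v x|)
      (fun n => (contDiff_pd_const (hg n) i).continuous.aestronglyMeasurable) ?_ ?_ ?_
    · have := hv.continuous
      have := ha.continuous
      exact integrableOn_of_continuous (by fun_prop) hb
    · intro n
      refine Eventually.of_forall fun x => ?_
      rw [hpd, Real.norm_eq_abs]
      refine (abs_add_le _ _).trans (add_le_add ?_ ?_)
      · rw [mul_assoc, abs_mul]
        exact mul_le_mul_of_nonneg_right (hC _) (abs_nonneg _)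
      · rw [abs_mul, abs_mul _ (pd i v x)]
        refine mul_le_mul_of_nonneg_right ?_ (abs_nonneg _)
        have hn : (0 : ℝ) < n + 1 := by positivity
        rw [abs_mul, abs_of_pos (inv_pos.2 hn), inv_mul_le_iff₀ hn]
        refine (hψle _).trans ?_
        rw [abs_mul, abs_of_pos hn]
    · refine (ae_restrict_iff' hΩ.measurableSet).2 (Eventually.of_forall fun x hx => ?_)
      refine tendsto_const_nhds.congr' ?_
      have hev : ∀ᶠ n : ℕ in atTop, 2 < ((n : ℝ) + 1) * a x := by
        have : Tendsto (fun n : ℕ => ((n : ℝ) + 1) * a x) atTop atTop :=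
          (tendsto_atTop_add_const_right _ _ tendsto_natCast_atTop_atTop).atTop_mul_const
            (hpos x hx)
        exact this.eventually_gt_atTop 2
      filter_upwards [hev] with n hn
      rw [hpd, (hψ2 _ hn).1, (hψ2 _ hn).2,
        pd_mul (ha.differentiable (by simp) x) (hv.differentiable (by simp) x)]
      have : (n : ℝ) + 1 ≠ 0 := by positivity
      field_simp
  simp only [hzero] at hlim
  exact (tendsto_nhds_unique hlim tendsto_const_nhds)

/-! ### Vector calculus -/

theorem inner_E3 (x y : E3) : inner ℝ x y = x 0 * y 0 + x 1 * y 1 + x 2 * y 2 := by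
  simp only [PiLp.inner_apply, Fin.sum_univ_three, RCLike.inner_apply, conj_trivial]
  ring

@[simp] theorem cross_zero (a b : E3) : cross a b 0 = a 1 * b 2 - a 2 * b 1 := rfl
@[simp] theorem cross_one (a b : E3) : cross a b 1 = a 2 * b 0 - a 0 * b 2 := rfl
@[simp] theorem cross_two (a b : E3) : cross a b 2 = a 0 * b 1 - a 1 * b 0 := rfl
@[simp] theorem grad_zero (f : E3 → ℝ) (x : E3) : grad f x 0 = pd 0 f x := rfl
@[simp] theorem grad_one (f : E3 → ℝ) (x : E3) : grad f x 1 = pd 1 f x := rfl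
@[simp] theorem grad_two (f : E3 → ℝ) (x : E3) : grad f x 2 = pd 2 f x := rfl
@[simp] theorem curl_zero (V : E3 → E3) (x : E3) :
    curl V x 0 = pd 1 (fun y => V y 2) x - pd 2 (fun y => V y 1) x := rfl
@[simp] theorem curl_one (V : E3 → E3) (x : E3) :
    curl V x 1 = pd 2 (fun y => V y 0) x - pd 0 (fun y => V y 2) x := rfl
@[simp] theorem curl_two (V : E3 → E3) (x : E3) :
    curl V x 2 = pd 0 (fun y => V y 1) x - pd 1 (fun y => V y 0) x := rfl

theorem ext_E3 {x y : E3} (h0 : x 0 = y 0) (h1 : x 1 = y 1) (h2 : x 2 = y 2) : x = y := by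
  ext i
  fin_cases i
  exacts [h0, h1, h2]

theorem grad_apply (f : E3 → ℝ) (x : E3) (i : Fin 3) : grad f x i = pd i f x := by
  fin_cases i <;> rfl

/-! ### Joint smoothness of vector operations in a parameter and the point. -/

section Smoothness

variable {Z : Type*} [NormedAddCommGroup Z] [NormedSpace ℝ Z]

theorem contDiff_E3 {u : Z → E3} (h : ∀ i, ContDiff ℝ ∞ (fun z => u z i)) : ContDiff ℝ ∞ u :=
  contDiff_euclidean.2 h

theorem ContDiff.coord {u : Z → E3} (h : ContDiff ℝ ∞ u) (i : Fin 3) :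
    ContDiff ℝ ∞ (fun z => u z i) :=
  contDiff_euclidean.1 h i

theorem contDiff_cross {u v : Z → E3} (hu : ContDiff ℝ ∞ u) (hv : ContDiff ℝ ∞ v) :
    ContDiff ℝ ∞ (fun z => cross (u z) (v z)) := by
  have h := ContDiff.coord hu
  have h' := ContDiff.coord hv
  refine contDiff_E3 fun i => ?_
  fin_cases i
  exacts [((h 1).mul (h' 2)).sub ((h 2).mul (h' 1)), ((h 2).mul (h' 0)).sub ((h 0).mul (h' 2)),
    ((h 0).mul (h' 1)).sub ((h 1).mul (h' 0))]

theorem contDiff_grad {f : Z → E3 → ℝ} {g : Z → E3} (hf : ContDiff ℝ ∞ (Function.uncurry f))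
    (hg : ContDiff ℝ ∞ g) : ContDiff ℝ ∞ (fun z => grad (f z) (g z)) := by
  refine contDiff_E3 fun i => ?_
  simp only [grad_apply]
  exact contDiff_pd hf hg i

theorem contDiff_divergence {V : Z → E3 → E3} {g : Z → E3}
    (hV : ContDiff ℝ ∞ (Function.uncurry V)) (hg : ContDiff ℝ ∞ g) :
    ContDiff ℝ ∞ (fun z => divergence (V z) (g z)) :=
  ContDiff.sum fun i _ => contDiff_pd (f := fun z y => V z y i) (ContDiff.coord hV i) hg i

theorem contDiff_curl {V : Z → E3 → E3} {g : Z → E3}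
    (hV : ContDiff ℝ ∞ (Function.uncurry V)) (hg : ContDiff ℝ ∞ g) :
    ContDiff ℝ ∞ (fun z => curl (V z) (g z)) := by
  have h : ∀ i j, ContDiff ℝ ∞ (fun z => pd i (fun y => V z y j) (g z)) := fun i j =>
    contDiff_pd (f := fun z y => V z y j) (ContDiff.coord hV j) hg i
  refine contDiff_E3 fun i => ?_
  fin_cases i
  exacts [(h 1 2).sub (h 2 1), (h 2 0).sub (h 0 2), (h 0 1).sub (h 1 0)]

/-- A smooth map of two variables stays smooth when the first is reparametrized. -/
theorem contDiff_uncurry_comp {Y V : Type*} [NormedAddCommGroup Y] [NormedSpace ℝ Y]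
    [NormedAddCommGroup V] [NormedSpace ℝ V] {f : Z → E3 → V}
    (hf : ContDiff ℝ ∞ (Function.uncurry f)) {φ : Y → Z} (hφ : ContDiff ℝ ∞ φ) :
    ContDiff ℝ ∞ (Function.uncurry fun y => f (φ y)) :=
  hf.comp ((hφ.comp contDiff_fst).prodMk contDiff_snd)

theorem contDiff_uncurry_const {V : Type*} [NormedAddCommGroup V] [NormedSpace ℝ V] {f : E3 → V}
    (hf : ContDiff ℝ ∞ f) : ContDiff ℝ ∞ (Function.uncurry fun _ : Z => f) :=
  hf.comp contDiff_snd

theorem ContDiff.slice {V : Type*} [NormedAddCommGroup V] [NormedSpace ℝ V] {f : Z → E3 → V}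
    (hf : ContDiff ℝ ∞ (Function.uncurry f)) (z : Z) : ContDiff ℝ ∞ (f z) :=
  hf.comp (contDiff_const.prodMk contDiff_id)

theorem ContDiff.slice_left {V : Type*} [NormedAddCommGroup V] [NormedSpace ℝ V] {f : Z → E3 → V}
    (hf : ContDiff ℝ ∞ (Function.uncurry f)) (x : E3) : ContDiff ℝ ∞ (fun z => f z x) :=
  hf.comp (contDiff_id.prodMk contDiff_const)

end Smoothness

/-! ### Locality of the differential operators on an open set. -/

section EqOn

variable {Ω : Set E3} (hΩ : IsOpen Ω) {x : E3}
include hΩ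

theorem grad_eq_of_eqOn {f g : E3 → ℝ} (h : EqOn f g Ω) (hx : x ∈ Ω) : grad f x = grad g x := by
  simp only [grad, pd_eq_of_eqOn hΩ h hx]

theorem divergence_eq_of_eqOn {V W : E3 → E3} (h : EqOn V W Ω) (hx : x ∈ Ω) :
    divergence V x = divergence W x :=
  Finset.sum_congr rfl fun i _ => pd_eq_of_eqOn hΩ (fun y hy => by simp only [h hy]) hx i

theorem curl_eq_of_eqOn {V W : E3 → E3} (h : EqOn V W Ω) (hx : x ∈ Ω) : curl V x = curl W x := by
  have : ∀ i j, pd i (fun y => V y j) x = pd i (fun y => W y j) x := fun i j =>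
    pd_eq_of_eqOn hΩ (fun y hy => by simp only [h hy]) hx i
  simp only [curl, this]

end EqOn

theorem ContDiff.diffAt {V : Type*} [NormedAddCommGroup V] [NormedSpace ℝ V] {Z : Type*}
    [NormedAddCommGroup Z] [NormedSpace ℝ Z] {f : Z → V} (h : ContDiff ℝ ∞ f) (x : Z) :
    DifferentiableAt ℝ f x :=
  h.differentiable (by simp) x

theorem pd_add_const_mul {f g : E3 → ℝ} {x : E3} (hf : DifferentiableAt ℝ f x)
    (hg : DifferentiableAt ℝ g x) (c : ℝ) (i : Fin 3) :
    pd i (fun y => f y + c * g y) x = pd i f x + c * pd i g x := by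
  simp only [pd, fderiv_fun_add hf (hg.const_mul c), fderiv_const_mul hg, add_apply,
    smul_apply, smul_eq_mul]

theorem grad_add_const_mul {f g : E3 → ℝ} {x : E3} (hf : DifferentiableAt ℝ f x)
    (hg : DifferentiableAt ℝ g x) (c : ℝ) :
    grad (fun y => f y + c * g y) x = grad f x + c • grad g x := by
  ext i
  simp [grad_apply, pd_add_const_mul hf hg]

theorem divergence_smul {f : E3 → ℝ} {V : E3 → E3} (hf : ContDiff ℝ ∞ f) (hV : ContDiff ℝ ∞ V)
    (x : E3) : divergence (fun y => f y • V y) x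
      = f x * divergence V x + inner ℝ (grad f x) (V x) := by
  have h : ∀ i, pd i (fun y => (f y • V y) i) x = pd i f x * V x i
      + f x * pd i (fun y => V y i) x := fun i =>
    pd_mul (ContDiff.diffAt hf x) (ContDiff.diffAt (ContDiff.coord hV i) x) i
  simp only [divergence, Fin.sum_univ_three, h, inner_E3, grad_zero, grad_one, grad_two]
  ring

theorem pd_comm {f : E3 → ℝ} (hf : ContDiff ℝ ∞ f) (i j : Fin 3) (x : E3) :
    pd i (pd j f) x = pd j (pd i f) x := by
  have h : ∀ i j, pd i (pd j f) x =
      fderiv ℝ (fderiv ℝ f) x (EuclideanSpace.single i 1) (EuclideanSpace.single j 1) := by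
    intro i j
    have hd : DifferentiableAt ℝ (fderiv ℝ f) x :=
      ContDiff.diffAt (hf.fderiv_right (m := ∞) (by simp)) x
    have : pd j f = fun y => fderiv ℝ f y (EuclideanSpace.single j 1) := rfl
    rw [this, pd, fderiv_clm_apply hd (differentiableAt_const _)]
    simp
  rw [h, h]
  exact (hf.contDiffAt.isSymmSndFDerivAt (by
    simpa using WithTop.coe_le_coe.2 (le_top : (2 : ℕ∞) ≤ ⊤))) _ _

/-! ### Regular settings

Every field that enters the equation is replaced by one that is smooth on the whole space. -/

theorem exists_contDiff_eqOn {V : Type*} [NormedAddCommGroup V] [NormedSpace ℝ V] {Ω : Set E3}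
    (hb : Bornology.IsBounded Ω) {f : E3 → V} (hf : SmoothUpTo Ω f) :
    ∃ g : E3 → V, ContDiff ℝ ∞ g ∧ EqOn f g (closure Ω) := by
  obtain ⟨U, hU, hΩU, hfU⟩ := hf
  obtain ⟨ρ, hρ, -, hρU, hρ1, -⟩ := exists_contDiff_cutoff hb.isCompact_closure hU hΩU
  exact ⟨_, contDiff_smul_of_tsupport_subset hU hρ hfU hρU,
    fun x hx => by simp only [hρ1 x hx, one_smul]⟩

theorem mem_smoothBar_iff {Ω : Set E3} (hb : Bornology.IsBounded Ω) {u : E3 → ℝ} :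
    u ∈ SmoothBar Ω ↔ (∀ x ∉ Ω, u x = 0) ∧ ∃ f : E3 → ℝ, ContDiff ℝ ∞ f ∧ EqOn u f Ω := by
  refine and_congr Iff.rfl ⟨?_, ?_⟩
  · rintro ⟨f, hf, hfu⟩
    obtain ⟨g, hg, hgf⟩ := exists_contDiff_eqOn hb hf
    exact ⟨g, hg, hfu.trans (hgf.mono subset_closure)⟩
  · rintro ⟨f, hf, hfu⟩
    exact ⟨f, ⟨univ, isOpen_univ, subset_univ _, hf.contDiffOn⟩, hfu⟩

theorem smoothFamilyOn_univ_iff {P : Type*} [NormedAddCommGroup P] [NormedSpace ℝ P] {Ω : Set E3}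
    (hb : Bornology.IsBounded Ω) {p : P → E3 → ℝ} :
    SmoothFamilyOn Ω univ p ↔ (∀ s, ∀ x ∉ Ω, p s x = 0) ∧
      ∃ f : P → E3 → ℝ, ContDiff ℝ ∞ (Function.uncurry f) ∧ ∀ s, EqOn (p s) (f s) Ω := by
  refine and_congr (by simp) ⟨?_, ?_⟩
  · rintro ⟨U, f, hU, hΩU, hf, hpf⟩
    obtain ⟨ρ, hρ, -, hρU, hρ1, -⟩ := exists_contDiff_cutoff hb.isCompact_closure hU hΩU
    refine ⟨fun s x => ρ x • f (s, x), ?_, fun s x hx => ?_⟩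
    · exact contDiff_smul_of_tsupport_subset (ρ := fun z : P × E3 => ρ z.2) (isOpen_univ.prod hU)
        (hρ.comp contDiff_snd) hf fun z hz =>
          ⟨mem_univ _, hρU (tsupport_comp_subset_preimage ρ continuous_snd hz)⟩
    · simp only [hρ1 x (subset_closure hx), one_smul, hpf s (mem_univ s) x hx]
  · rintro ⟨f, hf, hpf⟩
    exact ⟨univ, Function.uncurry f, isOpen_univ, subset_univ _, hf.contDiffOn,
      fun s _ x hx => hpf s hx⟩

/-- The standing hypotheses on a setting, together with functions `a` and `β`, smooth on the whole
space, that represent `A_e` and `B / B²` in `Ω`. -/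
structure Setting.IsRegular (S : Setting) (a : E3 → ℝ) (β : E3 → E3) : Prop where
  isOpen : IsOpen S.Ω
  bounded : Bornology.IsBounded S.Ω
  lam_pos : 0 < S.lam
  sig_pos : 0 < S.sig
  contDiff_a : ContDiff ℝ ∞ a
  contDiff_β : ContDiff ℝ ∞ β
  A_eq : ∀ x ∈ S.Ω, S.A x = a x
  b_eq : ∀ x ∈ S.Ω, S.b x = β x
  B_ne : ∀ x ∈ S.Ω, S.B x ≠ 0
  a_pos : ∀ x ∈ S.Ω, 0 < a x
  a_frontier : ∀ x ∈ frontier S.Ω, a x = 0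
  X_subset : (S.X : Set (E3 → ℝ)) ⊆ SmoothBar S.Ω
  test_subset : TestFunctions S.Ω ⊆ (S.X : Set (E3 → ℝ))

theorem Setting.exists_isRegular (S : Setting) (hΩ : IsOpen S.Ω) (hΩb : Bornology.IsBounded S.Ω)
    (hlam : 0 < S.lam) (hsig : 0 < S.sig) (hA : SmoothUpTo S.Ω S.A)
    (hApos : ∀ x ∈ S.Ω, 0 < S.A x) (hA0 : ∀ x ∈ frontier S.Ω, S.A x = 0)
    (hB : SmoothUpTo S.Ω S.B) (hB0 : ∀ x ∈ closure S.Ω, S.B x ≠ 0)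
    (hX : (S.X : Set (E3 → ℝ)) ⊆ SmoothBar S.Ω)
    (hXtest : TestFunctions S.Ω ⊆ (S.X : Set (E3 → ℝ))) : ∃ a β, S.IsRegular a β := by
  obtain ⟨a, ha, hAa⟩ := exists_contDiff_eqOn hΩb hA
  have hb : SmoothUpTo S.Ω S.b := by
    obtain ⟨U, hU, hΩU, hBU⟩ := hB
    -- The neighbourhood is shrunk to where `B ≠ 0`; it still contains the closure of `Ω`, and
    -- division by `B²` is smooth there.
    refine ⟨U ∩ S.B ⁻¹' {0}ᶜ, hBU.continuousOn.isOpen_inter_preimage hU isOpen_compl_singleton,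
      fun x hx => ⟨hΩU hx, hB0 x hx⟩, ?_⟩
    have hB' := hBU.mono (inter_subset_left (s := U) (t := S.B ⁻¹' {0}ᶜ))
    exact ((hB'.norm_sq ℝ).inv fun x hx => by simpa using hx.2).smul hB'
  obtain ⟨β, hβ, hbβ⟩ := exists_contDiff_eqOn hΩb hb
  refine ⟨a, β, hΩ, hΩb, hlam, hsig, ha, hβ, fun x hx => hAa (subset_closure hx),
    fun x hx => hbβ (subset_closure hx), fun x hx => hB0 x (subset_closure hx),
    fun x hx => ?_, fun x hx => ?_, hX, hXtest⟩
  · rw [← hAa (subset_closure hx)]; exact hApos x hx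
  · rw [← hAa (frontier_subset_closure hx)]; exact hA0 x hx

/-- The drift velocity `β × ∇f`. -/
def drift (β : E3 → E3) (f : E3 → ℝ) (x : E3) : E3 := cross (β x) (grad f x)

/-- The bracket `∇f · (β × ∇g)` of two scalar fields. -/
def fieldBracket (β : E3 → E3) (f g : E3 → ℝ) (x : E3) : ℝ := inner ℝ (grad f x) (drift β g x)

/-- The operator `𝒟` with coefficients that are smooth on the whole space. -/
def elliptic (a : E3 → ℝ) (β : E3 → E3) (lam sig : ℝ) (f : E3 → ℝ) (x : E3) : ℝ :=
  lam * a x * f x + sig * divergence (fun y => a y • cross (β y) (drift β f y)) x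

/-! ### Algebra of the cross product and the field bracket. -/

theorem cross_smul_left (c : ℝ) (u v : E3) : cross (c • u) v = c • cross u v := by
  apply ext_E3 <;> simp <;> ring

theorem cross_smul_right (c : ℝ) (u v : E3) : cross u (c • v) = c • cross u v := by
  apply ext_E3 <;> simp <;> ring

theorem cross_add_right (u v w : E3) : cross u (v + w) = cross u v + cross u w := by
  apply ext_E3 <;> simp <;> ring

theorem inner_cross_right (u v w : E3) : inner ℝ u (cross v w) = - inner ℝ (cross v u) w := by
  simp only [inner_E3, cross_zero, cross_one, cross_two]
  ring

theorem fieldBracket_antisymm (β : E3 → E3) (f g : E3 → ℝ) (x : E3) :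
    fieldBracket β f g x = - fieldBracket β g f x := by
  rw [fieldBracket, fieldBracket, drift, drift, inner_cross_right, real_inner_comm]

section Smoothness

variable {Z : Type*} [NormedAddCommGroup Z] [NormedSpace ℝ Z] {a : E3 → ℝ} {β : E3 → E3}
  {f g : Z → E3 → ℝ}

theorem contDiff_drift (hβ : ContDiff ℝ ∞ β) (hf : ContDiff ℝ ∞ (Function.uncurry f)) :
    ContDiff ℝ ∞ (Function.uncurry fun z => drift β (f z)) :=
  contDiff_cross (hβ.comp contDiff_snd)
    (contDiff_grad (contDiff_uncurry_comp hf contDiff_fst) contDiff_snd)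

theorem contDiff_fieldBracket (hβ : ContDiff ℝ ∞ β) (hf : ContDiff ℝ ∞ (Function.uncurry f))
    (hg : ContDiff ℝ ∞ (Function.uncurry g)) :
    ContDiff ℝ ∞ (Function.uncurry fun z => fieldBracket β (f z) (g z)) :=
  (contDiff_grad (contDiff_uncurry_comp hf contDiff_fst) contDiff_snd).inner ℝ
    (contDiff_drift hβ hg)

theorem contDiff_elliptic (ha : ContDiff ℝ ∞ a) (hβ : ContDiff ℝ ∞ β) (lam sig : ℝ)
    (hf : ContDiff ℝ ∞ (Function.uncurry f)) :
    ContDiff ℝ ∞ (Function.uncurry fun z => elliptic a β lam sig (f z)) := by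
  have h : ContDiff ℝ ∞ (Function.uncurry fun z y => a y • cross (β y) (drift β (f z) y)) :=
    (ha.comp contDiff_snd).smul (contDiff_cross (hβ.comp contDiff_snd) (contDiff_drift hβ hf))
  exact ((contDiff_const.mul (ha.comp contDiff_snd)).mul hf).add (contDiff_const.mul
    (contDiff_divergence (contDiff_uncurry_comp h contDiff_fst) contDiff_snd))

end Smoothness

theorem elliptic_add_const_mul {a : E3 → ℝ} {β : E3 → E3} (ha : ContDiff ℝ ∞ a)
    (hβ : ContDiff ℝ ∞ β) (lam sig : ℝ) {f g : E3 → ℝ} (hf : ContDiff ℝ ∞ f)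
    (hg : ContDiff ℝ ∞ g) (c : ℝ) (x : E3) :
    elliptic a β lam sig (fun y => f y + c * g y) x
      = elliptic a β lam sig f x + c * elliptic a β lam sig g x := by
  have hV : ∀ {f : E3 → ℝ}, ContDiff ℝ ∞ f →
      ContDiff ℝ ∞ (fun y => a y • cross (β y) (drift β f y)) := fun hf =>
    ha.smul (contDiff_cross hβ (ContDiff.slice
      (contDiff_drift (Z := ℝ) hβ (contDiff_uncurry_const hf)) 0))
  have e : ∀ y (i : Fin 3), (a y • cross (β y) (drift β (fun y => f y + c * g y) y)) i
      = (a y • cross (β y) (drift β f y)) i + c * (a y • cross (β y) (drift β g y)) i := by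
    intro y i
    rw [drift, grad_add_const_mul (ContDiff.diffAt hf y) (ContDiff.diffAt hg y), cross_add_right,
      cross_smul_right, cross_add_right, cross_smul_right, smul_add, smul_comm]
    rfl
  have h : ∀ i, pd i (fun y => (a y • cross (β y) (drift β (fun y => f y + c * g y) y)) i) x
      = pd i (fun y => (a y • cross (β y) (drift β f y)) i) x
        + c * pd i (fun y => (a y • cross (β y) (drift β g y)) i) x := by
    intro i
    simp only [e]
    exact pd_add_const_mul (ContDiff.diffAt (ContDiff.coord (hV hf) i) x)
      (ContDiff.diffAt (ContDiff.coord (hV hg) i) x) c i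
  simp only [elliptic, divergence, h, Finset.sum_add_distrib, ← Finset.mul_sum]
  ring

namespace Setting.IsRegular

variable {S : Setting} {a : E3 → ℝ} {β : E3 → E3} (R : S.IsRegular a β)
include R

/-! ### The operators of the setting in terms of globally smooth representatives. -/

theorem exists_rep {u : E3 → ℝ} (hu : u ∈ SmoothBar S.Ω) :
    ∃ f : E3 → ℝ, ContDiff ℝ ∞ f ∧ EqOn u f S.Ω :=
  ((mem_smoothBar_iff R.bounded).1 hu).2

theorem vE_eq {χ f : E3 → ℝ} (h : EqOn χ f S.Ω) {x : E3} (hx : x ∈ S.Ω) :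
    S.vE χ x = drift β f x := by
  rw [Setting.vE, drift, ← R.b_eq x hx, Setting.b, cross_smul_left, grad_eq_of_eqOn R.isOpen h hx]

theorem inner_curl_vE {χ f : E3 → ℝ} (h : EqOn χ f S.Ω) {x : E3} (hx : x ∈ S.Ω) :
    inner ℝ (S.B x) (curl (S.vE χ) x) / ‖S.B x‖ ^ 2 = inner ℝ (β x) (curl (drift β f) x) := by
  rw [curl_eq_of_eqOn R.isOpen (fun y hy => R.vE_eq h hy) hx, ← R.b_eq x hx, Setting.b,
    real_inner_smul_left, div_eq_inv_mul]

theorem zeta_eq {χ f : E3 → ℝ} (h : EqOn χ f S.Ω) {x : E3} (hx : x ∈ S.Ω) :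
    S.zeta χ x = 1 - S.sig * inner ℝ (β x) (curl (drift β f) x) := by
  rw [Setting.zeta, R.inner_curl_vE h hx]

theorem rhs_eq {χ f : E3 → ℝ} (h : EqOn χ f S.Ω) {x : E3} (hx : x ∈ S.Ω) :
    S.rhs χ x = divergence (fun y =>
      (a y * (S.sig * inner ℝ (β y) (curl (drift β f) y) - 1)) • drift β f y) x := by
  refine divergence_eq_of_eqOn R.isOpen (fun y hy => ?_) hx
  simp only [R.inner_curl_vE h hy, R.vE_eq h hy, R.A_eq y hy]

/-- One factor `B⁻²` comes from `∇_⊥` and one from the definition of `ω`; each is absorbed into one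
`β`. The minus sign of `∇_⊥` is why `-σω` enters `elliptic` with a plus sign. -/
theorem omega_eq {χ f : E3 → ℝ} (h : EqOn χ f S.Ω) {x : E3} (hx : x ∈ S.Ω) :
    S.omega χ x = - divergence (fun y => a y • cross (β y) (drift β f y)) x := by
  have e : S.omega χ x = divergence (fun y => (-1 : ℝ) • (a y • cross (β y) (drift β f y))) x := by
    refine divergence_eq_of_eqOn R.isOpen (fun y hy => ?_) hx
    simp only [Setting.gradPerp, drift]
    rw [← R.b_eq y hy, ← R.A_eq y hy, Setting.b, cross_smul_left, cross_smul_left,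
      cross_smul_right, grad_eq_of_eqOn R.isOpen h hy, smul_neg, neg_one_smul, div_eq_mul_inv,
      mul_smul]
  rw [e]
  simp [divergence, pd]

theorem D_eq {χ f : E3 → ℝ} (h : EqOn χ f S.Ω) {x : E3} (hx : x ∈ S.Ω) :
    S.D χ x = elliptic a β S.lam S.sig f x := by
  rw [Setting.D, indicator_of_mem hx, R.omega_eq h hx, R.A_eq x hx, h hx, elliptic]
  ring

theorem D_add_smul {χ ξ : E3 → ℝ} (hχ : χ ∈ SmoothBar S.Ω) (hξ : ξ ∈ SmoothBar S.Ω) (c : ℝ) :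
    S.D (χ + c • ξ) = S.D χ + c • S.D ξ := by
  obtain ⟨f, hf, hχf⟩ := R.exists_rep hχ
  obtain ⟨g, hg, hξg⟩ := R.exists_rep hξ
  ext x
  by_cases hx : x ∈ S.Ω
  · rw [R.D_eq (f := fun y => f y + c * g y) (fun y hy => by simp [hχf hy, hξg hy]) hx,
      elliptic_add_const_mul R.contDiff_a R.contDiff_β _ _ hf hg]
    simp [R.D_eq hχf hx, R.D_eq hξg hx]
  · simp [Setting.D, hx]

/-! ### Integration by parts with weight `a`; symmetry and positivity of `𝒟`. -/

theorem integrableOn {h : E3 → ℝ} (hh : ContDiff ℝ ∞ h) : IntegrableOn h S.Ω :=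
  integrableOn_of_continuous hh.continuous R.bounded

/-- The divergence theorem; the boundary term vanishes together with `a`. -/
theorem setIntegral_divergence {V : E3 → E3} (hV : ContDiff ℝ ∞ V) :
    ∫ x in S.Ω, divergence (fun y => a y • V y) x = 0 := by
  have h : ∀ i, IntegrableOn (fun x => pd i (fun y => (a y • V y) i) x) S.Ω := fun i =>
    R.integrableOn (contDiff_pd_const (R.contDiff_a.mul (ContDiff.coord hV i)) i)
  simp only [divergence]
  rw [integral_finsetSum _ fun i _ => h i]
  exact Finset.sum_eq_zero fun i _ => setIntegral_pd_mul_eq_zero R.isOpen R.bounded R.contDiff_a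
    (ContDiff.coord hV i) R.a_pos R.a_frontier i

/-- The divergence theorem applied to `f V`. The weight `a` alone kills the boundary term, so
neither `f` nor `V` needs a boundary condition. -/
theorem setIntegral_mul_divergence {f : E3 → ℝ} {V : E3 → E3} (hf : ContDiff ℝ ∞ f)
    (hV : ContDiff ℝ ∞ V) : ∫ x in S.Ω, f x * divergence (fun y => a y • V y) x
      = - ∫ x in S.Ω, a x * inner ℝ (grad f x) (V x) := by
  have haV : ContDiff ℝ ∞ (fun y => a y • V y) := R.contDiff_a.smul hV
  have hdiv : ContDiff ℝ ∞ (fun x => divergence (fun y => a y • V y) x) :=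
    contDiff_divergence (contDiff_uncurry_const haV) contDiff_id
  have hgr : ContDiff ℝ ∞ (grad f) := contDiff_grad (contDiff_uncurry_const hf) contDiff_id
  have h : ∫ x in S.Ω, divergence (fun y => a y • f y • V y) x = 0 :=
    R.setIntegral_divergence (hf.smul hV)
  have e : ∀ x, divergence (fun y => a y • f y • V y) x
      = f x * divergence (fun y => a y • V y) x + a x * inner ℝ (grad f x) (V x) := by
    intro x
    simp only [smul_comm (a _) (f _)]
    rw [divergence_smul hf haV, real_inner_smul_right]
  simp only [e] at h
  rw [integral_add (R.integrableOn (hf.mul hdiv))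
    (R.integrableOn (R.contDiff_a.mul (hgr.inner ℝ hV)))] at h
  linarith

/-- The map `β × ·` is skew, so moving one copy of it onto `∇f` cancels the sign from integration by
parts. The result is a symmetric form, nonnegative on the diagonal. -/
theorem setIntegral_mul_elliptic {f g : E3 → ℝ} (hf : ContDiff ℝ ∞ f) (hg : ContDiff ℝ ∞ g) :
    ∫ x in S.Ω, f x * elliptic a β S.lam S.sig g x
      = ∫ x in S.Ω, a x * (S.lam * (f x * g x)
          + S.sig * inner ℝ (drift β f x) (drift β g x)) := by
  have hd : ∀ {f : E3 → ℝ}, ContDiff ℝ ∞ f → ContDiff ℝ ∞ (drift β f) := fun hf =>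
    ContDiff.slice (contDiff_drift (Z := ℝ) R.contDiff_β (contDiff_uncurry_const hf)) 0
  have hV : ContDiff ℝ ∞ (fun y => cross (β y) (drift β g y)) :=
    contDiff_cross R.contDiff_β (hd hg)
  have hdiv : ContDiff ℝ ∞ (fun x => divergence (fun y => a y • cross (β y) (drift β g y)) x) :=
    contDiff_divergence (contDiff_uncurry_const (R.contDiff_a.smul hV)) contDiff_id
  have h := R.setIntegral_mul_divergence hf hV
  have i1 : IntegrableOn (fun x => a x * (S.lam * (f x * g x))) S.Ω :=
    R.integrableOn (R.contDiff_a.mul (contDiff_const.mul (hf.mul hg)))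
  have i2 : IntegrableOn (fun x => S.sig * (a x * inner ℝ (drift β f x) (drift β g x))) S.Ω :=
    R.integrableOn (contDiff_const.mul (R.contDiff_a.mul ((hd hf).inner ℝ (hd hg))))
  have i3 : IntegrableOn (fun x => S.sig * (f x *
      divergence (fun y => a y • cross (β y) (drift β g y)) x)) S.Ω :=
    R.integrableOn (contDiff_const.mul (hf.mul hdiv))
  have e : ∀ x, a x * inner ℝ (grad f x) (cross (β x) (drift β g x))
      = - (a x * inner ℝ (drift β f x) (drift β g x)) := by
    intro x
    rw [inner_cross_right, ← drift]
    ring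
  simp only [e, integral_neg, neg_neg] at h
  have l : ∀ x, f x * elliptic a β S.lam S.sig g x = a x * (S.lam * (f x * g x))
      + S.sig * (f x * divergence (fun y => a y • cross (β y) (drift β g y)) x) := by
    intro x; rw [elliptic]; ring
  have r : ∀ x, a x * (S.lam * (f x * g x) + S.sig * inner ℝ (drift β f x) (drift β g x))
      = a x * (S.lam * (f x * g x)) + S.sig * (a x * inner ℝ (drift β f x) (drift β g x)) := by
    intro x; ring
  simp only [l, r]
  rw [integral_add i1 i2, integral_add i1 i3, integral_const_mul, integral_const_mul, h]

/-- `𝒟` is symmetric. -/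
theorem setIntegral_mul_D_comm {χ ξ : E3 → ℝ} (hχ : χ ∈ SmoothBar S.Ω) (hξ : ξ ∈ SmoothBar S.Ω) :
    ∫ x in S.Ω, χ x * S.D ξ x = ∫ x in S.Ω, ξ x * S.D χ x := by
  obtain ⟨f, hf, hχf⟩ := R.exists_rep hχ
  obtain ⟨g, hg, hξg⟩ := R.exists_rep hξ
  have h1 : ∫ x in S.Ω, χ x * S.D ξ x = ∫ x in S.Ω, f x * elliptic a β S.lam S.sig g x :=
    setIntegral_congr_fun R.isOpen.measurableSet fun x hx => by
      simp only [hχf hx, R.D_eq hξg hx]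
  have h2 : ∫ x in S.Ω, ξ x * S.D χ x = ∫ x in S.Ω, g x * elliptic a β S.lam S.sig f x :=
    setIntegral_congr_fun R.isOpen.measurableSet fun x hx => by
      simp only [hξg hx, R.D_eq hχf hx]
  rw [h1, h2, R.setIntegral_mul_elliptic hf hg, R.setIntegral_mul_elliptic hg hf]
  simp only [real_inner_comm, mul_comm]

/-- The fundamental lemma of the calculus of variations: `h` vanishes almost everywhere in `Ω`,
hence everywhere by continuity. -/
theorem eq_zero_of_setIntegral_eq_zero {h : E3 → ℝ} (hh : ContDiff ℝ ∞ h)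
    (h0 : ∀ φ ∈ TestFunctions S.Ω, ∫ x in S.Ω, φ x * h x = 0) {x : E3} (hx : x ∈ S.Ω) :
    h x = 0 := by
  have hae := R.isOpen.ae_eq_zero_of_integral_contDiff_smul_eq_zero (μ := volume)
    (hh.continuous.locallyIntegrable.locallyIntegrableOn S.Ω) (fun φ h1 h2 h3 => by
      rw [← h0 φ ⟨h1, h2, h3⟩, ← integral_indicator R.isOpen.measurableSet]
      congr 1 with y
      by_cases hy : y ∈ S.Ω
      · simp [hy]
      · have : φ y = 0 := image_eq_zero_of_notMem_tsupport fun h' => hy (h3 h')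
        simp [hy, this])
  exact Measure.eqOn_open_of_ae_eq (μ := volume) (g := fun _ => (0 : ℝ))
    ((ae_restrict_iff' R.isOpen.measurableSet).2 hae) R.isOpen hh.continuous.continuousOn
    continuousOn_const hx

/-- The integrand of the quadratic form is continuous and nonnegative, so it vanishes pointwise. The
`λ` term then gives `χ = 0` in `Ω`, since `a` and `λ` are positive; outside `Ω` it is zero by
convention. -/
theorem eq_zero_of_setIntegral_mul_D {χ : E3 → ℝ} (hχ : χ ∈ SmoothBar S.Ω)
    (h0 : ∫ x in S.Ω, χ x * S.D χ x = 0) : χ = 0 := by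
  obtain ⟨f, hf, hχf⟩ := R.exists_rep hχ
  have hd : ContDiff ℝ ∞ (drift β f) :=
    ContDiff.slice (contDiff_drift (Z := ℝ) R.contDiff_β (contDiff_uncurry_const hf)) 0
  have h1 : ∫ x in S.Ω, χ x * S.D χ x = ∫ x in S.Ω, f x * elliptic a β S.lam S.sig f x :=
    setIntegral_congr_fun R.isOpen.measurableSet fun x hx => by
      simp only [hχf hx, R.D_eq hχf hx]
  rw [h1, R.setIntegral_mul_elliptic hf hf] at h0
  have hsm : ContDiff ℝ ∞ (fun x => a x * (S.lam * (f x * f x)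
          + S.sig * inner ℝ (drift β f x) (drift β f x))) :=
    R.contDiff_a.mul ((contDiff_const.mul (hf.mul hf)).add (contDiff_const.mul (hd.inner ℝ hd)))
  have hnn : ∀ x ∈ S.Ω, 0 ≤ a x * (S.lam * (f x * f x)
          + S.sig * inner ℝ (drift β f x) (drift β f x)) := fun x hx =>
    mul_nonneg (R.a_pos x hx).le (add_nonneg (mul_nonneg R.lam_pos.le (mul_self_nonneg _))
      (mul_nonneg R.sig_pos.le real_inner_self_nonneg))
  have hae := (setIntegral_eq_zero_iff_of_nonneg_ae
    ((ae_restrict_iff' R.isOpen.measurableSet).2 (Eventually.of_forall hnn))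
    (R.integrableOn hsm)).1 h0
  ext x
  by_cases hx : x ∈ S.Ω
  · have := Measure.eqOn_open_of_ae_eq (μ := volume) hae R.isOpen hsm.continuous.continuousOn
      continuousOn_const hx
    simp only [Pi.zero_apply, mul_eq_zero, (R.a_pos x hx).ne', false_or] at this
    have h2 : 0 ≤ S.sig * inner ℝ (drift β f x) (drift β f x) :=
      mul_nonneg R.sig_pos.le real_inner_self_nonneg
    have h3 : S.lam * (f x * f x) = 0 :=
      le_antisymm (by linarith) (mul_nonneg R.lam_pos.le (mul_self_nonneg _))
    have h4 : f x = 0 := by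
      simpa [R.lam_pos.ne'] using h3
    simp [hχf hx, h4]
  · exact hχ.1 x hx

end Setting.IsRegular

theorem Setting.mem_observables (S : Setting) {F : Functional} (g : (E3 → ℝ) → (E3 → ℝ))
    (hg : ∀ χ ∈ S.X, S.HasFunDeriv F (S.D χ) (g (S.D χ)))
    (hfam : ∀ (k : ℕ) (p : (Fin k → ℝ) → E3 → ℝ), SmoothFamilyOn S.Ω univ p → (∀ s, p s ∈ S.X) →
      SmoothFamilyOn S.Ω univ (fun s => g (S.D (p s)))) : F ∈ S.Observables :=
  ⟨g, by rintro _ ⟨χ, hχ, rfl⟩; exact hg χ hχ, hfam⟩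

namespace Setting.IsRegular

variable {S : Setting} {a : E3 → ℝ} {β : E3 → E3} (R : S.IsRegular a β)
include R

/-! ### The operator `𝒟` and functional derivatives -/

theorem integrableOn_of_eqOn {k h : E3 → ℝ} (hh : ContDiff ℝ ∞ h) (e : EqOn k h S.Ω) :
    IntegrableOn k S.Ω :=
  (R.integrableOn hh).congr_fun e.symm R.isOpen.measurableSet

theorem smoothBar_add_smul {u v : E3 → ℝ} (hu : u ∈ SmoothBar S.Ω) (hv : v ∈ SmoothBar S.Ω)
    (c d : ℝ) : c • u + d • v ∈ SmoothBar S.Ω := by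
  obtain ⟨hu0, f, hf, huf⟩ := (mem_smoothBar_iff R.bounded).1 hu
  obtain ⟨hv0, g, hg, hvg⟩ := (mem_smoothBar_iff R.bounded).1 hv
  exact (mem_smoothBar_iff R.bounded).2 ⟨fun x hx => by simp [hu0 x hx, hv0 x hx],
    fun x => c * f x + d * g x, by fun_prop, fun x hx => by simp [huf hx, hvg hx]⟩

theorem testFunctions_subset : TestFunctions S.Ω ⊆ SmoothBar S.Ω := fun _ hφ =>
  R.X_subset (R.test_subset hφ)

theorem contDiff_elliptic_const {f : E3 → ℝ} (hf : ContDiff ℝ ∞ f) :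
    ContDiff ℝ ∞ (elliptic a β S.lam S.sig f) :=
  ContDiff.slice (contDiff_elliptic (Z := ℝ) R.contDiff_a R.contDiff_β _ _
    (contDiff_uncurry_const hf)) 0

theorem integrableOn_mul_D {u v : E3 → ℝ} (hu : u ∈ SmoothBar S.Ω) (hv : v ∈ SmoothBar S.Ω) :
    IntegrableOn (fun x => u x * S.D v x) S.Ω := by
  obtain ⟨f, hf, huf⟩ := R.exists_rep hu
  obtain ⟨g, hg, hvg⟩ := R.exists_rep hv
  exact R.integrableOn_of_eqOn (hf.mul (R.contDiff_elliptic_const hg)) fun x hx => by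
    simp only [huf hx, R.D_eq hvg hx]

/-- Variations `𝒟φ` with `φ` a test function already separate points of `C^∞(Ω̄)`: symmetry moves
`𝒟` onto `u`, so `𝒟u = 0`, and positivity gives `u = 0`. No solvability of `𝒟χ = η` is needed. -/
theorem eq_zero_of_forall_test {u : E3 → ℝ} (hu : u ∈ SmoothBar S.Ω)
    (h : ∀ φ ∈ TestFunctions S.Ω, ∫ x in S.Ω, u x * S.D φ x = 0) : u = 0 := by
  obtain ⟨f, hf, huf⟩ := R.exists_rep hu
  have hD : ∀ x ∈ S.Ω, S.D u x = 0 := fun x hx => by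
    rw [R.D_eq huf hx]
    refine R.eq_zero_of_setIntegral_eq_zero (R.contDiff_elliptic_const hf) (fun φ hφ => ?_) hx
    rw [← h φ hφ, R.setIntegral_mul_D_comm hu (R.testFunctions_subset hφ)]
    exact setIntegral_congr_fun R.isOpen.measurableSet fun y hy => by
      simp only [R.D_eq huf hy]
  refine R.eq_zero_of_setIntegral_mul_D hu ?_
  exact setIntegral_eq_zero_of_forall_eq_zero fun x hx => by rw [hD x hx, mul_zero]

theorem injOn_D : InjOn S.D (S.X : Set (E3 → ℝ)) := by
  intro χ hχ ξ hξ h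
  have hχ' := R.X_subset hχ
  have hξ' := R.X_subset hξ
  have hmem : χ + (-1 : ℝ) • ξ ∈ SmoothBar S.Ω := by
    simpa using R.smoothBar_add_smul hχ' hξ' 1 (-1)
  have : χ + (-1 : ℝ) • ξ = 0 := by
    refine R.eq_zero_of_setIntegral_mul_D hmem ?_
    rw [R.D_add_smul hχ' hξ', h]
    simp
  have h2 : χ - ξ = 0 := by rw [← this]; simp [sub_eq_add_neg]
  exact sub_eq_zero.1 h2

theorem Dinv_D {χ : E3 → ℝ} (hχ : χ ∈ S.X) : S.Dinv (S.D χ) = χ :=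
  R.injOn_D.leftInvOn_invFunOn hχ

theorem hasFunDeriv_unique {F : Functional} {η g₁ g₂ : E3 → ℝ} (h₁ : S.HasFunDeriv F η g₁)
    (h₂ : S.HasFunDeriv F η g₂) : g₁ = g₂ := by
  have hmem : g₁ + (-1 : ℝ) • g₂ ∈ SmoothBar S.Ω := by
    simpa using R.smoothBar_add_smul h₁.1 h₂.1 1 (-1)
  have : g₁ + (-1 : ℝ) • g₂ = 0 := by
    refine R.eq_zero_of_forall_test hmem fun φ hφ => ?_
    have hφX := R.test_subset hφ
    have h := (h₁.2 _ (mem_image_of_mem _ hφX)).unique (h₂.2 _ (mem_image_of_mem _ hφX))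
    have e : ∀ x, (g₁ + (-1 : ℝ) • g₂) x * S.D φ x = g₁ x * S.D φ x - g₂ x * S.D φ x := by
      intro x
      simp only [Pi.add_apply, Pi.smul_apply, smul_eq_mul]
      ring
    simp only [e]
    rw [integral_sub (R.integrableOn_mul_D h₁.1 (R.X_subset hφX))
      (R.integrableOn_mul_D h₂.1 (R.X_subset hφX)), h, sub_self]
  have h2 : g₁ - g₂ = 0 := by rw [← this]; simp [sub_eq_add_neg]
  exact sub_eq_zero.1 h2

theorem funDeriv_eq {F : Functional} {η g : E3 → ℝ} (h : S.HasFunDeriv F η g) :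
    S.funDeriv F η = g := by
  have hex : ∃ g, S.HasFunDeriv F η g := ⟨g, h⟩
  rw [Setting.funDeriv, dif_pos hex]
  exact R.hasFunDeriv_unique hex.choose_spec h

theorem hasFunDeriv_funDeriv {F : Functional} (hF : F ∈ S.Observables) {χ : E3 → ℝ}
    (hχ : χ ∈ S.X) : S.HasFunDeriv F (S.D χ) (S.funDeriv F (S.D χ)) := by
  obtain ⟨g, hg, -⟩ := hF
  have := hg _ (mem_image_of_mem _ hχ)
  rwa [R.funDeriv_eq this]

theorem exists_rep_funDeriv {F : Functional} (hF : F ∈ S.Observables) {χ : E3 → ℝ}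
    (hχ : χ ∈ S.X) : ∃ f : E3 → ℝ, ContDiff ℝ ∞ f ∧ EqOn (S.funDeriv F (S.D χ)) f S.Ω :=
  R.exists_rep (R.hasFunDeriv_funDeriv hF hχ).1

/-- Functional derivatives take smooth families to smooth families, whatever the
finite-dimensional parameter space. -/
theorem smoothFamily_funDeriv {P : Type*} [NormedAddCommGroup P] [NormedSpace ℝ P]
    [FiniteDimensional ℝ P] {F : Functional} (hF : F ∈ S.Observables) {p : P → E3 → ℝ}
    (hp : SmoothFamilyOn S.Ω univ p) (hpX : ∀ s, p s ∈ S.X) :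
    SmoothFamilyOn S.Ω univ (fun s => S.funDeriv F (S.D (p s))) := by
  have e : P ≃L[ℝ] (Fin (Module.finrank ℝ P) → ℝ) :=
    ContinuousLinearEquiv.ofFinrankEq (by simp)
  obtain ⟨hp0, f, hf, hpf⟩ := (smoothFamilyOn_univ_iff R.bounded).1 hp
  have hq : SmoothFamilyOn S.Ω univ (fun s => p (e.symm s)) :=
    (smoothFamilyOn_univ_iff R.bounded).2 ⟨fun s => hp0 _, fun s => f (e.symm s),
      contDiff_uncurry_comp hf e.symm.contDiff, fun s => hpf _⟩
  obtain ⟨g, hg, hfam⟩ := hF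
  obtain ⟨h0, φ, hφ, hgφ⟩ := (smoothFamilyOn_univ_iff R.bounded).1 (hfam _ _ hq fun s => hpX _)
  have hgF : ∀ s, S.funDeriv F (S.D (p s)) = g (S.D (p (e.symm (e s)))) := fun s => by
    rw [e.symm_apply_apply]
    exact R.funDeriv_eq (hg _ (mem_image_of_mem _ (hpX s)))
  refine (smoothFamilyOn_univ_iff R.bounded).2 ⟨fun s x hx => ?_, fun s => φ (e s),
    contDiff_uncurry_comp hφ e.contDiff, fun s => ?_⟩
  · rw [hgF]; exact h0 (e s) x hx
  · rw [hgF]; exact hgφ (e s)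

/-! ### The chain rule for functionals along smooth families -/

/-- The definition differentiates at parameter `0` only; since `𝒟` is linear, recentring at `χ + r
ξ` gives the derivative at every `r`. -/
theorem hasDerivAt_line {F : Functional} (hF : F ∈ S.Observables) {χ ξ : E3 → ℝ} (hχ : χ ∈ S.X)
    (hξ : ξ ∈ S.X) (r : ℝ) :
    HasDerivAt (fun r : ℝ => F (S.D (χ + r • ξ)))
      (∫ x in S.Ω, S.funDeriv F (S.D (χ + r • ξ)) x * S.D ξ x) r := by
  have hmem : χ + r • ξ ∈ S.X := S.X.add_mem hχ (S.X.smul_mem r hξ)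
  have h := (R.hasFunDeriv_funDeriv hF hmem).2 _ (mem_image_of_mem _ hξ)
  have e : ∀ s : ℝ, S.D (χ + r • ξ) + s • S.D ξ = S.D (χ + (r + s) • ξ) := fun s => by
    rw [← R.D_add_smul (R.X_subset hmem) (R.X_subset hξ), add_smul, add_assoc]
  simp only [e] at h
  have h' : HasDerivAt (fun s : ℝ => F (S.D (χ + (r + s) • ξ)))
      (∫ x in S.Ω, S.funDeriv F (S.D (χ + r • ξ)) x * S.D ξ x) (r - r) := by rwa [sub_self]
  have h2 := h'.comp_sub_const r r
  simpa using h2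

/-- The fundamental theorem of calculus on the segment from `p s₀` to `p s`. Treating `(s, r)` as a
single parameter makes `F_η` on all these segments one smooth family `φ`, so regularity of `F` in
`s` can be read off the integral. For `s = s₀` the segment is a point, so `φ (s₀, r)` does not
depend on `r` in `Ω`. -/
theorem exists_integral_formula {P : Type*} [NormedAddCommGroup P] [NormedSpace ℝ P]
    [FiniteDimensional ℝ P] {F : Functional} (hF : F ∈ S.Observables) {p f : P → E3 → ℝ}
    (hp0 : ∀ s, ∀ x ∉ S.Ω, p s x = 0) (hf : ContDiff ℝ ∞ (Function.uncurry f))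
    (hpf : ∀ s, EqOn (p s) (f s) S.Ω) (hpX : ∀ s, p s ∈ S.X) (s₀ : P) :
    ∃ φ : P × ℝ → E3 → ℝ, ContDiff ℝ ∞ (Function.uncurry φ) ∧
      (∀ r, EqOn (S.funDeriv F (S.D (p s₀))) (φ (s₀, r)) S.Ω) ∧
      ∀ s, F (S.D (p s)) = F (S.D (p s₀)) + ∫ r in Ioc (0 : ℝ) 1, ∫ x in S.Ω,
        φ (s, r) x * (elliptic a β S.lam S.sig (f s) x - elliptic a β S.lam S.sig (f s₀) x) := by
  have hq : SmoothFamilyOn S.Ω univ (fun z : P × ℝ => p s₀ + z.2 • (p z.1 - p s₀)) := by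
    refine (smoothFamilyOn_univ_iff R.bounded).2 ⟨fun z x hx => by simp [hp0 _ x hx],
      fun z x => f s₀ x + z.2 * (f z.1 x - f s₀ x), ?_, fun z x hx => by simp [hpf _ hx]⟩
    have h1 : ContDiff ℝ ∞ (fun z : (P × ℝ) × E3 => f z.1.1 z.2) :=
      contDiff_uncurry_comp hf contDiff_fst
    have h2 : ContDiff ℝ ∞ (fun z : (P × ℝ) × E3 => f s₀ z.2) :=
      (ContDiff.slice hf s₀).comp contDiff_snd
    exact h2.add (contDiff_fst.snd.mul (h1.sub h2))
  have hqX : ∀ z : P × ℝ, p s₀ + z.2 • (p z.1 - p s₀) ∈ S.X := fun z =>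
    S.X.add_mem (hpX _) (S.X.smul_mem _ (S.X.sub_mem (hpX _) (hpX _)))
  obtain ⟨-, φ, hφ, hgφ⟩ := (smoothFamilyOn_univ_iff R.bounded).1
    (R.smoothFamily_funDeriv hF hq hqX)
  refine ⟨φ, hφ, fun r => ?_, fun s => ?_⟩
  · have := hgφ (s₀, r)
    simpa using this
  have hξ : p s - p s₀ ∈ S.X := S.X.sub_mem (hpX _) (hpX _)
  have hD : S.D (p s - p s₀) = S.D (p s) + (-1 : ℝ) • S.D (p s₀) := by
    rw [← R.D_add_smul (R.X_subset (hpX _)) (R.X_subset (hpX _))]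
    simp [sub_eq_add_neg]
  have hE : ∀ r : ℝ, ∫ x in S.Ω, S.funDeriv F (S.D (p s₀ + r • (p s - p s₀))) x
        * S.D (p s - p s₀) x
      = ∫ x in S.Ω, φ (s, r) x *
        (elliptic a β S.lam S.sig (f s) x - elliptic a β S.lam S.sig (f s₀) x) := fun r =>
    setIntegral_congr_fun R.isOpen.measurableSet fun x hx => by
      have := hgφ (s, r) hx
      simp only at this
      simp only [this, hD, Pi.add_apply, Pi.smul_apply, smul_eq_mul, R.D_eq (hpf _) hx]
      ring
  have hd := fun r => R.hasDerivAt_line hF (hpX s₀) hξ r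
  simp only [hE] at hd
  have hc : ContDiff ℝ ∞ (fun r : ℝ => ∫ x in S.Ω, φ (s, r) x *
        (elliptic a β S.lam S.sig (f s) x - elliptic a β S.lam S.sig (f s₀) x)) := by
    refine contDiff_setIntegral (h := fun z : ℝ × E3 => φ (s, z.1) z.2 *
        (elliptic a β S.lam S.sig (f s) z.2 - elliptic a β S.lam S.sig (f s₀) z.2)) ?_
      R.isOpen.measurableSet R.bounded
    have h1 := (R.contDiff_elliptic_const (ContDiff.slice hf s)).comp
      (contDiff_snd (E := ℝ) (F := E3))
    have h2 := (R.contDiff_elliptic_const (ContDiff.slice hf s₀)).comp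
      (contDiff_snd (E := ℝ) (F := E3))
    have h3 := contDiff_uncurry_comp hφ (φ := fun r : ℝ => (s, r))
      (contDiff_const.prodMk contDiff_id)
    exact h3.mul (h1.sub h2)
  have ftc := intervalIntegral.integral_eq_sub_of_hasDerivAt (a := 0) (b := 1)
    (fun r _ => hd r) (hc.continuous.intervalIntegrable _ _)
  rw [intervalIntegral.integral_of_le zero_le_one] at ftc
  rw [ftc]
  simp

theorem contDiff_comp_D {P : Type*} [NormedAddCommGroup P] [NormedSpace ℝ P]
    [FiniteDimensional ℝ P] {F : Functional} (hF : F ∈ S.Observables) {p : P → E3 → ℝ}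
    (hp : SmoothFamilyOn S.Ω univ p) (hpX : ∀ s, p s ∈ S.X) :
    ContDiff ℝ ∞ (fun s => F (S.D (p s))) := by
  obtain ⟨hp0, f, hf, hpf⟩ := (smoothFamilyOn_univ_iff R.bounded).1 hp
  obtain ⟨φ, hφ, -, h⟩ := R.exists_integral_formula hF hp0 hf hpf hpX 0
  rw [funext h]
  refine contDiff_const.add ?_
  refine contDiff_setIntegral (h := fun z : P × ℝ => ∫ x in S.Ω, φ z x *
    (elliptic a β S.lam S.sig (f z.1) x - elliptic a β S.lam S.sig (f 0) x)) ?_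
    measurableSet_Ioc (Metric.isBounded_Ioc 0 1)
  refine contDiff_setIntegral (h := fun z : (P × ℝ) × E3 => φ z.1 z.2 *
    (elliptic a β S.lam S.sig (f z.1.1) z.2 - elliptic a β S.lam S.sig (f 0) z.2)) ?_
    R.isOpen.measurableSet R.bounded
  have h1 := contDiff_uncurry_comp (contDiff_elliptic R.contDiff_a R.contDiff_β S.lam S.sig hf)
    (contDiff_fst (E := P) (F := ℝ))
  have h2 := (R.contDiff_elliptic_const (ContDiff.slice hf 0)).comp
    (contDiff_snd (E := P × ℝ) (F := E3))
  exact hφ.mul (h1.sub h2)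

/-- The integral formula is based at `t` itself, so the difference of the two states vanishes at `s
= t`. Only its derivative survives in the product rule, multiplied by `F_η` at `p t` for every `r`.
-/
theorem hasDerivAt_comp_D {F : Functional} (hF : F ∈ S.Observables) {p : ℝ → E3 → ℝ}
    (hp : SmoothFamilyOn S.Ω univ p) (hpX : ∀ s, p s ∈ S.X) (t : ℝ) :
    HasDerivAt (fun s => F (S.D (p s)))
      (∫ x in S.Ω, S.funDeriv F (S.D (p t)) x * deriv (fun s => S.D (p s) x) t) t := by
  obtain ⟨hp0, f, hf, hpf⟩ := (smoothFamilyOn_univ_iff R.bounded).1 hp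
  obtain ⟨φ, hφ, hφt, h⟩ := R.exists_integral_formula hF hp0 hf hpf hpX t
  have hE := contDiff_elliptic R.contDiff_a R.contDiff_β S.lam S.sig hf
  have hs : ContDiff ℝ ∞ (fun z : (ℝ × ℝ) × E3 => φ z.1 z.2 *
    (elliptic a β S.lam S.sig (f z.1.1) z.2 - elliptic a β S.lam S.sig (f t) z.2)) := by
    have h1 := contDiff_uncurry_comp hE (contDiff_fst (E := ℝ) (F := ℝ))
    have h2 := (R.contDiff_elliptic_const (ContDiff.slice hf t)).comp
      (contDiff_snd (E := ℝ × ℝ) (F := E3))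
    exact hφ.mul (h1.sub h2)
  have hΨ := contDiff_setIntegral (μ := volume) hs R.isOpen.measurableSet R.bounded
  have hin : ∀ r : ℝ, deriv (fun s => ∫ x in S.Ω, φ (s, r) x *
      (elliptic a β S.lam S.sig (f s) x - elliptic a β S.lam S.sig (f t) x)) t
      = ∫ x in S.Ω, S.funDeriv F (S.D (p t)) x * deriv (fun s => S.D (p s) x) t := by
    intro r
    have hs' : ContDiff ℝ ∞ (fun z : ℝ × E3 => φ (z.1, r) z.2 *
        (elliptic a β S.lam S.sig (f z.1) z.2 - elliptic a β S.lam S.sig (f t) z.2)) :=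
      hs.comp (f := fun z : ℝ × E3 => ((z.1, r), z.2)) (by fun_prop)
    rw [(hasDerivAt_setIntegral hs' R.bounded t).deriv]
    refine setIntegral_congr_fun R.isOpen.measurableSet fun x hx => ?_
    have d1 : DifferentiableAt ℝ (fun s => φ (s, r) x) t :=
      ContDiff.diffAt (hφ.comp (f := fun s : ℝ => ((s, r), x)) (by fun_prop)) t
    have d2 : DifferentiableAt ℝ (fun s => elliptic a β S.lam S.sig (f s) x) t :=
      ContDiff.diffAt (ContDiff.slice_left hE x) t
    simp only [deriv_fun_mul d1 (d2.sub_const _), sub_self, mul_zero, zero_add, deriv_sub_const,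
      hφt r hx, R.D_eq (hpf _) hx]
  have hout := hasDerivAt_setIntegral (μ := volume) hΨ (Metric.isBounded_Ioc (0 : ℝ) 1) t
  simp only [hin] at hout
  rw [funext h]
  simpa using hout.const_add (F (S.D (p t)))

/-! ### Antisymmetric brackets -/

end Setting.IsRegular

/-- The bracket `∫ K ∇F_η · (B/B²) × ∇G_η dx`, with a weight `K` that depends on the state. -/
def Setting.weightedBracket (S : Setting) (K : (E3 → ℝ) → E3 → ℝ) (F G : Functional) :
    Functional := fun η =>
  ∫ x in S.Ω, K η x *
    inner ℝ (grad (S.funDeriv F η) x) (cross (S.b x) (grad (S.funDeriv G η) x))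

theorem Setting.weightedBracket_antisymm (S : Setting) (K : (E3 → ℝ) → E3 → ℝ) (F G : Functional) (η : E3 → ℝ) :
    S.weightedBracket K F G η = - S.weightedBracket K G F η := by
  simp only [Setting.weightedBracket]
  rw [← integral_neg]
  congr 1 with x
  rw [inner_cross_right, real_inner_comm]
  ring

theorem fieldBracket_linear (β : E3 → E3) {f g : E3 → ℝ} (hf : ContDiff ℝ ∞ f)
    (hg : ContDiff ℝ ∞ g) (h : E3 → ℝ) (c d : ℝ) (x : E3) :
    fieldBracket β (fun y => c * f y + d * g y) h x
      = c * fieldBracket β f h x + d * fieldBracket β g h x := by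
  have h1 := grad_add_const_mul (ContDiff.diffAt (contDiff_const.mul hf : ContDiff ℝ ∞
    fun y => c * f y) x) (ContDiff.diffAt hg x) d
  have h2 : grad (fun y => c * f y) x = c • grad f x := by
    have := grad_add_const_mul (f := fun _ => (0 : ℝ)) (differentiableAt_const _)
      (ContDiff.diffAt hf x) c
    simp only [zero_add] at this
    rw [this]
    ext i
    simp [grad_apply, pd]
  rw [fieldBracket, h1, h2, inner_add_left, real_inner_smul_left, real_inner_smul_left]
  rfl

namespace Setting.IsRegular

variable {S : Setting} {a : E3 → ℝ} {β : E3 → E3} (R : S.IsRegular a β)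
include R

theorem inner_grad_eq {u v f g : E3 → ℝ} (hu : EqOn u f S.Ω) (hv : EqOn v g S.Ω) {x : E3}
    (hx : x ∈ S.Ω) : inner ℝ (grad u x) (cross (S.b x) (grad v x)) = fieldBracket β f g x := by
  rw [fieldBracket, drift, R.b_eq x hx, grad_eq_of_eqOn R.isOpen hu hx,
    grad_eq_of_eqOn R.isOpen hv hx]

theorem weightedBracket_eq {K : (E3 → ℝ) → E3 → ℝ} {F G : Functional} {η k f g : E3 → ℝ}
    (hk : EqOn (K η) k S.Ω) (hf : EqOn (S.funDeriv F η) f S.Ω)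
    (hg : EqOn (S.funDeriv G η) g S.Ω) :
    S.weightedBracket K F G η = ∫ x in S.Ω, k x * fieldBracket β f g x :=
  setIntegral_congr_fun R.isOpen.measurableSet fun x hx => by
    simp only [R.inner_grad_eq hf hg hx, hk hx]

theorem contDiff_fieldBracket_const {f g : E3 → ℝ} (hf : ContDiff ℝ ∞ f) (hg : ContDiff ℝ ∞ g) :
    ContDiff ℝ ∞ (fieldBracket β f g) :=
  ContDiff.slice (contDiff_fieldBracket (Z := ℝ) R.contDiff_β (contDiff_uncurry_const hf)
    (contDiff_uncurry_const hg)) 0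

theorem hasFunDeriv_linear {F G : Functional} {η f g : E3 → ℝ} (hF : S.HasFunDeriv F η f)
    (hG : S.HasFunDeriv G η g) (c d : ℝ) :
    S.HasFunDeriv (c • F + d • G) η (c • f + d • g) := by
  refine ⟨R.smoothBar_add_smul hF.1 hG.1 c d, ?_⟩
  rintro _ ⟨ξ, hξ, rfl⟩
  have h := ((hF.2 _ (mem_image_of_mem _ hξ)).const_mul c).add
    ((hG.2 _ (mem_image_of_mem _ hξ)).const_mul d)
  rw [← integral_const_mul, ← integral_const_mul, ← integral_add
    ((R.integrableOn_mul_D hF.1 (R.X_subset hξ)).const_mul c)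
    ((R.integrableOn_mul_D hG.1 (R.X_subset hξ)).const_mul d)] at h
  refine h.congr_deriv ?_
  congr 1 with x
  simp only [Pi.add_apply, Pi.smul_apply, smul_eq_mul]
  ring

theorem hasFunDeriv_mul {F G : Functional} {η f g : E3 → ℝ} (hF : S.HasFunDeriv F η f)
    (hG : S.HasFunDeriv G η g) : S.HasFunDeriv (F * G) η (G η • f + F η • g) := by
  refine ⟨R.smoothBar_add_smul hF.1 hG.1 _ _, ?_⟩
  rintro _ ⟨ξ, hξ, rfl⟩
  have h := (hF.2 _ (mem_image_of_mem _ hξ)).mul (hG.2 _ (mem_image_of_mem _ hξ))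
  simp only [zero_smul, add_zero] at h
  rw [← integral_const_mul, ← integral_mul_const, ← integral_add
    ((R.integrableOn_mul_D hF.1 (R.X_subset hξ)).mul_const _)
    ((R.integrableOn_mul_D hG.1 (R.X_subset hξ)).const_mul _)] at h
  refine h.congr_deriv ?_
  congr 1 with x
  simp only [Pi.add_apply, Pi.smul_apply, smul_eq_mul]
  ring

theorem smoothFamily_linear {P : Type*} [NormedAddCommGroup P] [NormedSpace ℝ P]
    {p q : P → E3 → ℝ} {c d : P → ℝ} (hp : SmoothFamilyOn S.Ω univ p)
    (hq : SmoothFamilyOn S.Ω univ q) (hc : ContDiff ℝ ∞ c) (hd : ContDiff ℝ ∞ d) :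
    SmoothFamilyOn S.Ω univ (fun s => c s • p s + d s • q s) := by
  obtain ⟨hp0, f, hf, hpf⟩ := (smoothFamilyOn_univ_iff R.bounded).1 hp
  obtain ⟨hq0, g, hg, hqg⟩ := (smoothFamilyOn_univ_iff R.bounded).1 hq
  exact (smoothFamilyOn_univ_iff R.bounded).2 ⟨fun s x hx => by simp [hp0 s x hx, hq0 s x hx],
    fun s x => c s * f s x + d s * g s x,
    ((hc.comp contDiff_fst).mul hf).add ((hd.comp contDiff_fst).mul hg),
    fun s x hx => by simp [hpf s hx, hqg s hx]⟩

theorem linear_mem_observables {F G : Functional} (hF : F ∈ S.Observables)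
    (hG : G ∈ S.Observables) (c d : ℝ) : c • F + d • G ∈ S.Observables :=
  S.mem_observables (fun η => c • S.funDeriv F η + d • S.funDeriv G η)
    (fun _ hχ => R.hasFunDeriv_linear (R.hasFunDeriv_funDeriv hF hχ)
      (R.hasFunDeriv_funDeriv hG hχ) c d)
    fun _ _ hp hpX => R.smoothFamily_linear (R.smoothFamily_funDeriv hF hp hpX)
      (R.smoothFamily_funDeriv hG hp hpX) contDiff_const contDiff_const

theorem mul_mem_observables {F G : Functional} (hF : F ∈ S.Observables)
    (hG : G ∈ S.Observables) : F * G ∈ S.Observables :=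
  S.mem_observables (fun η => G η • S.funDeriv F η + F η • S.funDeriv G η)
    (fun _ hχ => R.hasFunDeriv_mul (R.hasFunDeriv_funDeriv hF hχ) (R.hasFunDeriv_funDeriv hG hχ))
    fun _ _ hp hpX => R.smoothFamily_linear (R.smoothFamily_funDeriv hF hp hpX)
      (R.smoothFamily_funDeriv hG hp hpX) (R.contDiff_comp_D hG hp hpX)
      (R.contDiff_comp_D hF hp hpX)

/-- The numbers `c` and `d` may depend on the state, because only the derivative of `E` at this one
state enters. Constants give linearity; `c = G η`, `d = F η` gives the Leibniz rule for `E = F * G`.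
-/
theorem weightedBracket_linear {K : (E3 → ℝ) → E3 → ℝ}
    (hK : ∀ χ ∈ S.X, ∃ k : E3 → ℝ, ContDiff ℝ ∞ k ∧ EqOn (K (S.D χ)) k S.Ω)
    {F G H E : Functional} (hF : F ∈ S.Observables) (hG : G ∈ S.Observables)
    (hH : H ∈ S.Observables) {χ : E3 → ℝ} (hχ : χ ∈ S.X) {c d : ℝ}
    (hE : S.HasFunDeriv E (S.D χ) (c • S.funDeriv F (S.D χ) + d • S.funDeriv G (S.D χ))) :
    S.weightedBracket K E H (S.D χ)
      = c * S.weightedBracket K F H (S.D χ) + d * S.weightedBracket K G H (S.D χ) := by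
  obtain ⟨k, hk, hKk⟩ := hK χ hχ
  obtain ⟨f, hf, hFf⟩ := R.exists_rep_funDeriv hF hχ
  obtain ⟨g, hg, hGg⟩ := R.exists_rep_funDeriv hG hχ
  obtain ⟨h, hh, hHh⟩ := R.exists_rep_funDeriv hH hχ
  have hEe : EqOn (S.funDeriv E (S.D χ)) (fun y => c * f y + d * g y) S.Ω := fun x hx => by
    rw [R.funDeriv_eq hE]
    simp [hFf hx, hGg hx]
  rw [R.weightedBracket_eq hKk hEe hHh, R.weightedBracket_eq hKk hFf hHh,
    R.weightedBracket_eq hKk hGg hHh, ← integral_const_mul, ← integral_const_mul,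
    ← integral_add (R.integrableOn (contDiff_const.mul
      (hk.mul (R.contDiff_fieldBracket_const hf hh))))
      (R.integrableOn (contDiff_const.mul (hk.mul (R.contDiff_fieldBracket_const hg hh))))]
  congr 1 with x
  rw [fieldBracket_linear β hf hg]
  ring

theorem isAntisymmetricBracket {K : (E3 → ℝ) → E3 → ℝ}
    (hK : ∀ χ ∈ S.X, ∃ k : E3 → ℝ, ContDiff ℝ ∞ k ∧ EqOn (K (S.D χ)) k S.Ω) :
    IsAntisymmetricBracket S.Phase S.Observables (S.weightedBracket K) where
  linear_mem F hF G hG c d := R.linear_mem_observables hF hG c d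
  mul_mem F hF G hG := R.mul_mem_observables hF hG
  linear_left := by
    rintro F hF G hG H hH c d _ ⟨χ, hχ, rfl⟩
    exact R.weightedBracket_linear hK hF hG hH hχ (R.hasFunDeriv_linear
      (R.hasFunDeriv_funDeriv hF hχ) (R.hasFunDeriv_funDeriv hG hχ) c d)
  linear_right := by
    rintro F hF G hG H hH c d _ ⟨χ, hχ, rfl⟩
    rw [S.weightedBracket_antisymm K H, S.weightedBracket_antisymm K H F,
      S.weightedBracket_antisymm K H G, R.weightedBracket_linear hK hF hG hH hχ
      (R.hasFunDeriv_linear (R.hasFunDeriv_funDeriv hF hχ) (R.hasFunDeriv_funDeriv hG hχ) c d)]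
    ring
  alternating := by
    intro F _ η _
    have := S.weightedBracket_antisymm K F F η
    linarith
  antisymm F _ G _ η _ := S.weightedBracket_antisymm K F G η
  leibniz := by
    rintro F hF G hG H hH _ ⟨χ, hχ, rfl⟩
    rw [R.weightedBracket_linear hK hF hG hH hχ (R.hasFunDeriv_mul
      (R.hasFunDeriv_funDeriv hF hχ) (R.hasFunDeriv_funDeriv hG hχ))]
    ring

theorem isAntisymmetricBracket_bracket :
    IsAntisymmetricBracket S.Phase S.Observables S.bracket := by
  refine R.isAntisymmetricBracket (K := fun η x => S.A x * S.zeta (S.Dinv η) x) fun χ hχ => ?_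
  obtain ⟨f, hf, hχf⟩ := R.exists_rep (R.X_subset hχ)
  have hd : ContDiff ℝ ∞ (drift β f) :=
    ContDiff.slice (contDiff_drift (Z := ℝ) R.contDiff_β (contDiff_uncurry_const hf)) 0
  refine ⟨fun x => a x * (1 - S.sig * inner ℝ (β x) (curl (drift β f) x)),
    R.contDiff_a.mul (contDiff_const.sub (contDiff_const.mul (R.contDiff_β.inner ℝ
      (contDiff_curl (contDiff_uncurry_const hd) contDiff_id)))), fun x hx => ?_⟩
  simp only [R.Dinv_D hχ, R.zeta_eq hχf hx, R.A_eq x hx]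

theorem isAntisymmetricBracket_bracket' :
    IsAntisymmetricBracket S.Phase S.Observables S.bracket' := by
  refine R.isAntisymmetricBracket (K := fun η x => η x) fun χ hχ => ?_
  obtain ⟨f, hf, hχf⟩ := R.exists_rep (R.X_subset hχ)
  exact ⟨_, R.contDiff_elliptic_const hf, fun x hx => R.D_eq hχf hx⟩

/-! ### Mass and energy -/

theorem smoothBar_const (c : ℝ) : S.Ω.indicator (fun _ => c) ∈ SmoothBar S.Ω :=
  (mem_smoothBar_iff R.bounded).2 ⟨fun _ hx => indicator_of_notMem hx _, fun _ => c,
    contDiff_const, fun _ hx => indicator_of_mem hx _⟩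

/-- Testing `𝒟χ` against the constant `1`, whose drift is zero, leaves `∫ 𝒟χ = λ ∫ a χ`; so the mass
is affine in `η`. -/
theorem mass_D (c : ℝ) {χ : E3 → ℝ} (hχ : χ ∈ S.X) :
    S.mass c (S.D χ) = c * ((∫ x in S.Ω, a x) + ∫ x in S.Ω, S.D χ x) := by
  obtain ⟨f, hf, hχf⟩ := R.exists_rep (R.X_subset hχ)
  have hd0 : ∀ x, drift β (fun _ => (1 : ℝ)) x = 0 := fun x => by
    apply ext_E3 <;> simp [drift, pd]
  have h := R.setIntegral_mul_elliptic (f := fun _ => 1) contDiff_const hf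
  simp only [one_mul, hd0, inner_zero_left, mul_zero, add_zero] at h
  have h1 : ∫ x in S.Ω, S.D χ x = ∫ x in S.Ω, a x * (S.lam * f x) := by
    rw [← h]
    exact setIntegral_congr_fun R.isOpen.measurableSet fun x hx => R.D_eq hχf hx
  rw [Setting.mass, R.Dinv_D hχ, h1, ← integral_add (R.integrableOn R.contDiff_a)
    (R.integrableOn (R.contDiff_a.mul (contDiff_const.mul hf)))]
  congr 1
  refine setIntegral_congr_fun R.isOpen.measurableSet fun x hx => ?_
  simp only [R.A_eq x hx, hχf hx]
  ring

theorem hasFunDeriv_mass (c : ℝ) {χ : E3 → ℝ} (hχ : χ ∈ S.X) :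
    S.HasFunDeriv (S.mass c) (S.D χ) (S.Ω.indicator fun _ => c) := by
  refine ⟨R.smoothBar_const c, ?_⟩
  rintro _ ⟨ξ, hξ, rfl⟩
  have hint : ∀ {χ}, χ ∈ S.X → IntegrableOn (S.D χ) S.Ω := fun {χ} hχ => by
    have := R.integrableOn_mul_D (R.smoothBar_const 1) (R.X_subset hχ)
    refine this.congr_fun (fun x hx => ?_) R.isOpen.measurableSet
    simp [hx]
  have e : ∀ s : ℝ, S.mass c (S.D χ + s • S.D ξ)
      = c * ((∫ x in S.Ω, a x) + ((∫ x in S.Ω, S.D χ x) + s * ∫ x in S.Ω, S.D ξ x)) := fun s => by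
    rw [← R.D_add_smul (R.X_subset hχ) (R.X_subset hξ),
      R.mass_D c (S.X.add_mem hχ (S.X.smul_mem s hξ)),
      R.D_add_smul (R.X_subset hχ) (R.X_subset hξ), ← integral_const_mul,
      ← integral_add (hint hχ) ((hint hξ).const_mul s)]
    rfl
  have e2 : ∫ x in S.Ω, S.Ω.indicator (fun _ => c) x * S.D ξ x = c * ∫ x in S.Ω, S.D ξ x := by
    rw [← integral_const_mul]
    exact setIntegral_congr_fun R.isOpen.measurableSet fun x hx => by simp [hx]
  simp only [e, e2]
  simpa using ((((hasDerivAt_id (0 : ℝ)).mul_const (∫ x in S.Ω, S.D ξ x)).const_add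
    (∫ x in S.Ω, S.D χ x)).const_add (∫ x in S.Ω, a x)).const_mul c

theorem mass_mem_observables (c : ℝ) : S.mass c ∈ S.Observables :=
  S.mem_observables (fun _ => S.Ω.indicator fun _ => c) (fun _ hχ => R.hasFunDeriv_mass c hχ)
    fun _ _ _ _ => (smoothFamilyOn_univ_iff R.bounded).2 ⟨fun _ _ hx => indicator_of_notMem hx _,
      fun _ _ => c, contDiff_const, fun _ _ hx => indicator_of_mem hx _⟩

/-- The functional derivative is constant in `Ω`, so its gradient vanishes. The weight plays no
role, and one argument serves both brackets. -/
theorem isCasimir_mass (K : (E3 → ℝ) → E3 → ℝ) (c : ℝ) :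
    IsCasimir S.Phase S.Observables (S.weightedBracket K) (S.mass c) := by
  refine ⟨R.mass_mem_observables c, ?_⟩
  rintro G - _ ⟨χ, hχ, rfl⟩
  refine setIntegral_eq_zero_of_forall_eq_zero fun x hx => ?_
  have : grad (S.funDeriv (S.mass c) (S.D χ)) x = 0 := by
    rw [R.funDeriv_eq (R.hasFunDeriv_mass c hχ),
      grad_eq_of_eqOn R.isOpen (g := fun _ => c) (fun y hy => indicator_of_mem hy _) hx]
    apply ext_E3 <;> simp [pd]
  simp [this]

/-- The vectors `B` and `B × ∇χ` are orthogonal, so `|B × (B × ∇χ)| = |B| |B × ∇χ|`. -/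
theorem gradPerp_sq {χ f : E3 → ℝ} (h : EqOn χ f S.Ω) {x : E3} (hx : x ∈ S.Ω) :
    ‖S.gradPerp χ x‖ ^ 2 / ‖S.B x‖ ^ 2 = inner ℝ (drift β f x) (drift β f x) := by
  have hB : ‖S.B x‖ ^ 2 ≠ 0 := pow_ne_zero 2 (norm_ne_zero_iff.2 (R.B_ne x hx))
  have key : ∀ u v : E3, ‖cross u (cross u v)‖ ^ 2 = ‖u‖ ^ 2 * ‖cross u v‖ ^ 2 := by
    intro u v
    simp only [← real_inner_self_eq_norm_sq, inner_E3, cross_zero, cross_one, cross_two]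
    ring
  rw [← R.vE_eq h hx, Setting.vE, Setting.gradPerp, norm_neg, norm_smul, mul_pow, key,
    real_inner_self_eq_norm_sq, norm_smul, mul_pow, norm_inv, norm_pow, norm_norm]
  field_simp

theorem energy_D {χ : E3 → ℝ} (hχ : χ ∈ S.X) :
    S.energy (S.D χ) = 1 / 2 * ∫ x in S.Ω, χ x * S.D χ x := by
  obtain ⟨f, hf, hχf⟩ := R.exists_rep (R.X_subset hχ)
  have h1 : ∫ x in S.Ω, χ x * S.D χ x = ∫ x in S.Ω, f x * elliptic a β S.lam S.sig f x :=
    setIntegral_congr_fun R.isOpen.measurableSet fun x hx => by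
      simp only [hχf hx, R.D_eq hχf hx]
  rw [h1, R.setIntegral_mul_elliptic hf hf, Setting.energy, R.Dinv_D hχ]
  congr 1
  refine setIntegral_congr_fun R.isOpen.measurableSet fun x hx => ?_
  simp only [R.gradPerp_sq hχf hx, R.A_eq x hx, hχf hx]
  ring

/-- The energy is `½ ∫ χ 𝒟χ`; by symmetry of `𝒟` the two cross terms in the variation `𝒟ξ` agree and
add up to `∫ χ 𝒟ξ`. -/
theorem hasFunDeriv_energy {χ : E3 → ℝ} (hχ : χ ∈ S.X) : S.HasFunDeriv S.energy (S.D χ) χ := by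
  have hχ' := R.X_subset hχ
  refine ⟨hχ', ?_⟩
  rintro _ ⟨ξ, hξ, rfl⟩
  have hξ' := R.X_subset hξ
  have e : ∀ s : ℝ, S.energy (S.D χ + s • S.D ξ) = 1 / 2 * ((∫ x in S.Ω, χ x * S.D χ x)
      + s * (2 * ∫ x in S.Ω, χ x * S.D ξ x) + s ^ 2 * ∫ x in S.Ω, ξ x * S.D ξ x) := fun s => by
    rw [← R.D_add_smul hχ' hξ', R.energy_D (S.X.add_mem hχ (S.X.smul_mem s hξ)),
      R.D_add_smul hχ' hξ']
    have i1 := R.integrableOn_mul_D hχ' hχ'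
    have i2 := (R.integrableOn_mul_D hχ' hξ').const_mul s
    have i3 := (R.integrableOn_mul_D hξ' hχ').const_mul s
    have i4 := (R.integrableOn_mul_D hξ' hξ').const_mul (s ^ 2)
    have e1 : ∀ x, (χ + s • ξ) x * (S.D χ + s • S.D ξ) x = χ x * S.D χ x + s * (χ x * S.D ξ x)
        + (s * (ξ x * S.D χ x) + s ^ 2 * (ξ x * S.D ξ x)) := fun x => by
      simp only [Pi.add_apply, Pi.smul_apply, smul_eq_mul]
      ring
    simp only [e1]
    rw [integral_add (by exact i1.add i2) (by exact i3.add i4), integral_add i1 i2,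
      integral_add i3 i4, integral_const_mul, integral_const_mul, integral_const_mul,
      R.setIntegral_mul_D_comm hξ' hχ']
    ring
  simp only [e]
  have h := ((((hasDerivAt_id (0 : ℝ)).mul_const (2 * ∫ x in S.Ω, χ x * S.D ξ x)).const_add
    (∫ x in S.Ω, χ x * S.D χ x)).add (((hasDerivAt_id (0 : ℝ)).pow 2).mul_const
    (∫ x in S.Ω, ξ x * S.D ξ x))).const_mul (1 / 2)
  simpa using h

theorem energy_mem_observables : S.energy ∈ S.Observables := by
  refine S.mem_observables S.Dinv (fun χ hχ => ?_) fun k p hp hpX => ?_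
  · rw [R.Dinv_D hχ]; exact R.hasFunDeriv_energy hχ
  · simpa only [R.Dinv_D (hpX _)] using hp

end Setting.IsRegular

/-! ### Consequences of the integrability condition -/

theorem pd_sub {f g : E3 → ℝ} {x : E3} (hf : DifferentiableAt ℝ f x)
    (hg : DifferentiableAt ℝ g x) (i : Fin 3) :
    pd i (fun y => f y - g y) x = pd i f x - pd i g x := by
  simp only [pd, fderiv_fun_sub hf hg, sub_apply]

theorem pd_mul_sub_mul {u v w z : E3 → ℝ} (hu : ContDiff ℝ ∞ u) (hv : ContDiff ℝ ∞ v)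
    (hw : ContDiff ℝ ∞ w) (hz : ContDiff ℝ ∞ z) (i : Fin 3) (x : E3) :
    pd i (fun y => u y * v y - w y * z y) x
      = pd i u x * v x + u x * pd i v x - (pd i w x * z x + w x * pd i z x) := by
  rw [pd_sub (ContDiff.diffAt (hu.mul hv) x) (ContDiff.diffAt (hw.mul hz) x),
    pd_mul (ContDiff.diffAt hu x) (ContDiff.diffAt hv x),
    pd_mul (ContDiff.diffAt hw x) (ContDiff.diffAt hz x)]

theorem divergence_cross {U V : E3 → E3} (hU : ContDiff ℝ ∞ U) (hV : ContDiff ℝ ∞ V) (x : E3) :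
    divergence (fun y => cross (U y) (V y)) x
      = inner ℝ (curl U x) (V x) - inner ℝ (U x) (curl V x) := by
  have h := fun i => ContDiff.coord hU i
  have h' := fun i => ContDiff.coord hV i
  simp only [divergence, Fin.sum_univ_three, cross_zero, cross_one, cross_two, inner_E3,
    curl_zero, curl_one, curl_two]
  rw [pd_mul_sub_mul (h 1) (h' 2) (h 2) (h' 1), pd_mul_sub_mul (h 2) (h' 0) (h 0) (h' 2),
    pd_mul_sub_mul (h 0) (h' 1) (h 1) (h' 0)]
  ring

theorem curl_grad {f : E3 → ℝ} (hf : ContDiff ℝ ∞ f) (x : E3) : curl (grad f) x = 0 := by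
  apply ext_E3
  · simpa [sub_eq_zero] using pd_comm hf 1 2 x
  · simpa [sub_eq_zero] using pd_comm hf 2 0 x
  · simpa [sub_eq_zero] using pd_comm hf 0 1 x

theorem curl_smul {f : E3 → ℝ} {V : E3 → E3} (hf : ContDiff ℝ ∞ f) (hV : ContDiff ℝ ∞ V)
    (x : E3) : curl (fun y => f y • V y) x = f x • curl V x + cross (grad f x) (V x) := by
  have h : ∀ i j, pd i (fun y => (f y • V y) j) x = pd i f x * V x j
      + f x * pd i (fun y => V y j) x := fun i j =>
    pd_mul (ContDiff.diffAt hf x) (ContDiff.diffAt (ContDiff.coord hV j) x) i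
  apply ext_E3 <;> simp only [curl_zero, curl_one, curl_two, h] <;> simp only [curl_zero, curl_one,
    curl_two, PiLp.add_apply, PiLp.smul_apply, smul_eq_mul, cross_zero, cross_one, cross_two,
    grad_zero, grad_one, grad_two] <;> ring

/-- The normalized vorticity `λ f - σ β · ∇ × (β × ∇f)`. -/
def vorticity (β : E3 → E3) (lam sig : ℝ) (f : E3 → ℝ) (x : E3) : ℝ :=
  lam * f x - sig * inner ℝ (β x) (curl (drift β f) x)

theorem contDiff_vorticity {Z : Type*} [NormedAddCommGroup Z] [NormedSpace ℝ Z] {β : E3 → E3}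
    {f : Z → E3 → ℝ} (hβ : ContDiff ℝ ∞ β) (lam sig : ℝ)
    (hf : ContDiff ℝ ∞ (Function.uncurry f)) :
    ContDiff ℝ ∞ (Function.uncurry fun z => vorticity β lam sig (f z)) :=
  (contDiff_const.mul hf).sub (contDiff_const.mul ((hβ.comp contDiff_snd).inner ℝ
    (contDiff_curl (contDiff_uncurry_comp (contDiff_drift hβ hf) contDiff_fst) contDiff_snd)))

theorem fieldBracket_comp (β : E3 → E3) {m : ℝ → ℝ} {f : E3 → ℝ} (hm : ContDiff ℝ ∞ m)
    (hf : ContDiff ℝ ∞ f) (g : E3 → ℝ) (x : E3) :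
    fieldBracket β (fun y => m (f y)) g x = deriv m (f x) * fieldBracket β f g x := by
  have : grad (fun y => m (f y)) x = deriv m (f x) • grad f x := by
    ext i
    simp [grad_apply, pd_comp (ContDiff.diffAt hm _) (ContDiff.diffAt hf x)]
  rw [fieldBracket, this, real_inner_smul_left, fieldBracket]

theorem fieldBracket_const (β : E3 → E3) (c : ℝ) (g : E3 → ℝ) (x : E3) :
    fieldBracket β (fun _ => c) g x = 0 := by
  have : grad (fun _ => c) x = 0 := by apply ext_E3 <;> simp [pd]
  rw [fieldBracket, this, inner_zero_left]

theorem fieldBracket_self (β : E3 → E3) (g : E3 → ℝ) (x : E3) : fieldBracket β g g x = 0 := by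
  have := fieldBracket_antisymm β g g x
  linarith

/-- A smooth map of the real line into a neighbourhood of `t` that is the identity near `t`. -/
theorem exists_contDiff_retraction {I : Set ℝ} (hI : IsOpen I) {t : ℝ} (ht : t ∈ I) :
    ∃ ψ : ℝ → ℝ, ContDiff ℝ ∞ ψ ∧ (∀ s, ψ s ∈ I) ∧ ∀ᶠ s in 𝓝 t, ψ s = s := by
  obtain ⟨ε, hε, hεI⟩ := Metric.isOpen_iff.1 hI t ht
  obtain ⟨ρ, hρ, -, hρs, hρ1, hρm⟩ := exists_contDiff_cutoff
    (isCompact_closedBall t (ε / 2)) Metric.isOpen_ball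
    (Metric.closedBall_subset_ball (half_lt_self hε))
  refine ⟨fun s => t + ρ s * (s - t), by fun_prop, fun s => ?_, ?_⟩
  · by_cases hs : s ∈ tsupport ρ
    · have h1 := hρs hs
      apply hεI
      rw [Metric.mem_ball, Real.dist_eq] at h1 ⊢
      rw [add_sub_cancel_left, abs_mul, abs_of_nonneg (hρm s).1]
      exact (mul_le_of_le_one_left (abs_nonneg _) (hρm s).2).trans_lt h1
    · simpa [image_eq_zero_of_notMem_tsupport hs] using ht
  · filter_upwards [Metric.closedBall_mem_nhds t (half_pos hε)] with s hs
    rw [hρ1 s hs]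
    ring

namespace Setting.IsRegular

variable {S : Setting} {a : E3 → ℝ} {β : E3 → E3} (R : S.IsRegular a β)
include R

theorem contDiff_drift_const {f : E3 → ℝ} (hf : ContDiff ℝ ∞ f) : ContDiff ℝ ∞ (drift β f) :=
  ContDiff.slice (contDiff_drift (Z := ℝ) R.contDiff_β (contDiff_uncurry_const hf)) 0

theorem contDiff_vorticity_const {f : E3 → ℝ} (hf : ContDiff ℝ ∞ f) :
    ContDiff ℝ ∞ (vorticity β S.lam S.sig f) :=
  ContDiff.slice (contDiff_vorticity (Z := ℝ) R.contDiff_β _ _ (contDiff_uncurry_const hf)) 0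

theorem curl_eq_zero (hI : S.Integrability) {x : E3} (hx : x ∈ S.Ω) :
    curl (fun y => a y • β y) x = 0 := by
  rw [← hI x hx]
  exact curl_eq_of_eqOn R.isOpen (fun y hy => by simp only [R.A_eq y hy, R.b_eq y hy]) hx

/-- Since `∇a × β` is orthogonal to `β`, pairing `∇ × (a β) = 0` with `β` leaves `a β · ∇ × β = 0`.
This Frobenius condition is what the pointwise Jacobi identity requires. -/
theorem inner_curl_eq_zero (hI : S.Integrability) {x : E3} (hx : x ∈ S.Ω) :
    inner ℝ (β x) (curl β x) = 0 := by
  have h := R.curl_eq_zero hI hx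
  rw [curl_smul R.contDiff_a R.contDiff_β] at h
  have h2 : inner ℝ (β x) (a x • curl β x + cross (grad a x) (β x)) = 0 := by
    rw [h, inner_zero_right]
  have h3 : inner ℝ (β x) (cross (grad a x) (β x)) = 0 := by
    simp only [inner_E3, cross_zero, cross_one, cross_two]; ring
  rw [inner_add_right, h3, add_zero, real_inner_smul_right] at h2
  exact (mul_eq_zero.1 h2).resolve_left (R.a_pos x hx).ne'

/-- In `div(U × V) = V · ∇ × U - U · ∇ × V` with `U = a β`, the integrability condition removes the
first term. With `V = β × ∇f` this makes `𝒟` a multiple of `a`; with `V = ∇g` it makes the weighted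
drift divergence-free. -/
theorem divergence_smul_cross (hI : S.Integrability) {V : E3 → E3} (hV : ContDiff ℝ ∞ V) {x : E3}
    (hx : x ∈ S.Ω) : divergence (fun y => a y • cross (β y) (V y)) x
      = - (a x * inner ℝ (β x) (curl V x)) := by
  simp only [← cross_smul_left]
  rw [divergence_cross (U := fun y => a y • β y) (R.contDiff_a.smul R.contDiff_β) hV, R.curl_eq_zero hI hx,
    inner_zero_left, real_inner_smul_left, zero_sub]

theorem elliptic_eq (hI : S.Integrability) {f : E3 → ℝ} (hf : ContDiff ℝ ∞ f) {x : E3}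
    (hx : x ∈ S.Ω) : elliptic a β S.lam S.sig f x = a x * vorticity β S.lam S.sig f x := by
  rw [elliptic, R.divergence_smul_cross hI (R.contDiff_drift_const hf) hx, vorticity]
  ring

theorem D_eq_vorticity (hI : S.Integrability) {χ f : E3 → ℝ} (hf : ContDiff ℝ ∞ f)
    (h : EqOn χ f S.Ω) {x : E3} (hx : x ∈ S.Ω) :
    S.D χ x = a x * vorticity β S.lam S.sig f x := by
  rw [R.D_eq h hx, R.elliptic_eq hI hf hx]

/-- The flux `a m (β × ∇g)` has divergence `a ∇m · (β × ∇g)`. -/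
theorem divergence_flux (hI : S.Integrability) {m g : E3 → ℝ} (hm : ContDiff ℝ ∞ m)
    (hg : ContDiff ℝ ∞ g) {x : E3} (hx : x ∈ S.Ω) :
    divergence (fun y => (a y * m y) • drift β g y) x = a x * fieldBracket β m g x := by
  have hgr : ContDiff ℝ ∞ (grad g) := contDiff_grad (contDiff_uncurry_const hg) contDiff_id
  have h0 : divergence (fun y => a y • drift β g y) x = 0 := by
    have := R.divergence_smul_cross hI hgr hx
    rwa [curl_grad hg, inner_zero_right, mul_zero, neg_zero] at this
  have := divergence_smul (V := fun y => a y • drift β g y) hm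
    (R.contDiff_a.smul (R.contDiff_drift_const hg)) x
  simp only [smul_smul, mul_comm (m _) (a _)] at this
  rw [this, h0, mul_zero, zero_add, real_inner_smul_right, fieldBracket]

/-- The multiplier in the flux differs from `-vorticity` by `λ f - 1`, and `[f,f]` and `[1,f]`
vanish. -/
theorem rhs_eq_neg_fieldBracket (hI : S.Integrability) {χ f : E3 → ℝ} (hf : ContDiff ℝ ∞ f)
    (h : EqOn χ f S.Ω) {x : E3} (hx : x ∈ S.Ω) :
    S.rhs χ x = - (a x * fieldBracket β (vorticity β S.lam S.sig f) f x) := by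
  have hc : ContDiff ℝ ∞ (fun y => inner ℝ (β y) (curl (drift β f) y)) := R.contDiff_β.inner ℝ
    (contDiff_curl (contDiff_uncurry_const (R.contDiff_drift_const hf)) contDiff_id)
  have e1 : vorticity β S.lam S.sig f
      = fun y => S.lam * f y + (-S.sig) * inner ℝ (β y) (curl (drift β f) y) := by
    ext y; rw [vorticity]; ring
  have e2 : (fun y => S.sig * inner ℝ (β y) (curl (drift β f) y) - 1)
      = fun y => S.sig * inner ℝ (β y) (curl (drift β f) y) + (-1) * (fun _ => (1 : ℝ)) y := by
    ext y; ring
  rw [R.rhs_eq h hx, R.divergence_flux hI (m := fun y => S.sig * inner ℝ (β y)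
    (curl (drift β f) y) - 1) ((contDiff_const.mul hc).sub contDiff_const) hf hx, e1, e2,
    fieldBracket_linear β hc contDiff_const, fieldBracket_linear β hf hc, fieldBracket_const,
    fieldBracket_self]
  ring

/-- Integration by parts against the flux `a m (β × ∇g)`, whose divergence is `a [m,g]`. It is the
common source of the Casimirs, the weak form of the equation, and the Hamiltonian vector fields. -/
theorem setIntegral_fieldBracket_by_parts (hI : S.Integrability) {m f g : E3 → ℝ}
    (hm : ContDiff ℝ ∞ m) (hf : ContDiff ℝ ∞ f) (hg : ContDiff ℝ ∞ g) :
    ∫ x in S.Ω, a x * m x * fieldBracket β f g x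
      = - ∫ x in S.Ω, f x * (a x * fieldBracket β m g x) := by
  have h := R.setIntegral_mul_divergence (V := fun y => m y • drift β g y) hf
    (hm.smul (R.contDiff_drift_const hg))
  have e : ∫ x in S.Ω, f x * divergence (fun y => a y • m y • drift β g y) x
      = ∫ x in S.Ω, f x * (a x * fieldBracket β m g x) :=
    setIntegral_congr_fun R.isOpen.measurableSet fun x hx => by
      simp only [smul_smul, R.divergence_flux hI hm hg hx]
  rw [← e, h, neg_neg]
  congr 1 with x
  rw [real_inner_smul_right, fieldBracket]
  ring

theorem bracket'_eq (hI : S.Integrability) {F G : Functional} {χ k f g : E3 → ℝ}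
    (hk : ContDiff ℝ ∞ k) (hχ : EqOn χ k S.Ω) (hf : EqOn (S.funDeriv F (S.D χ)) f S.Ω)
    (hg : EqOn (S.funDeriv G (S.D χ)) g S.Ω) :
    S.bracket' F G (S.D χ)
      = ∫ x in S.Ω, a x * vorticity β S.lam S.sig k x * fieldBracket β f g x :=
  R.weightedBracket_eq (K := fun η => η) (fun _ hx => R.D_eq_vorticity hI hk hχ hx) hf hg

/-! ### The generalized enstrophy -/

theorem vorticity_eq_div (hI : S.Integrability) {χ f : E3 → ℝ} (hf : ContDiff ℝ ∞ f)
    (h : EqOn χ f S.Ω) {x : E3} (hx : x ∈ S.Ω) :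
    S.D χ x / S.A x = vorticity β S.lam S.sig f x := by
  rw [R.D_eq_vorticity hI hf h hx, R.A_eq x hx, mul_div_cancel_left₀ _ (R.a_pos x hx).ne']

theorem enstrophy_D (hI : S.Integrability) (w : ℝ → ℝ) {χ f : E3 → ℝ} (hχ : χ ∈ S.X)
    (hf : ContDiff ℝ ∞ f) (h : EqOn χ f S.Ω) :
    S.enstrophy w (S.D χ) = ∫ x in S.Ω, a x * w (vorticity β S.lam S.sig f x) := by
  rw [Setting.enstrophy, R.Dinv_D hχ]
  refine setIntegral_congr_fun R.isOpen.measurableSet fun x hx => ?_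
  have hA : S.A x ≠ 0 := by rw [R.A_eq x hx]; exact (R.a_pos x hx).ne'
  simp only [← R.vorticity_eq_div hI hf h hx, Setting.D, indicator_of_mem hx, ← R.A_eq x hx]
  congr 2
  field_simp

/-- In `Ω` the quotient `𝒟χ / A_e` is the vorticity, so it extends smoothly although `A_e` vanishes
at the boundary. The variation of `a w(q)` is `w'(q)` times `a` times the vorticity of `ξ`, which is
`w'(q) 𝒟ξ`. -/
theorem hasFunDeriv_enstrophy (hI : S.Integrability) {w : ℝ → ℝ} (hw : ContDiff ℝ ∞ w)
    {χ : E3 → ℝ} (hχ : χ ∈ S.X) : S.HasFunDeriv (S.enstrophy w) (S.D χ)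
      (S.Ω.indicator fun x => deriv w (S.D χ x / S.A x)) := by
  have hw' : ContDiff ℝ ∞ (deriv w) := (contDiff_infty_iff_deriv.1 hw).2
  obtain ⟨f, hf, hχf⟩ := R.exists_rep (R.X_subset hχ)
  have hv := R.contDiff_vorticity_const hf
  refine ⟨(mem_smoothBar_iff R.bounded).2 ⟨fun x hx => indicator_of_notMem hx _, _, hw'.comp hv,
    fun x hx => by
      simp only [indicator_of_mem hx, R.vorticity_eq_div hI hf hχf hx, Function.comp]⟩, ?_⟩
  rintro _ ⟨ξ, hξ, rfl⟩
  obtain ⟨g, hg, hξg⟩ := R.exists_rep (R.X_subset hξ)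
  have hv' := R.contDiff_vorticity_const hg
  have e : ∀ s : ℝ, S.enstrophy w (S.D χ + s • S.D ξ) = ∫ x in S.Ω,
      a x * w (vorticity β S.lam S.sig f x + s * vorticity β S.lam S.sig g x) := fun s => by
    rw [← R.D_add_smul (R.X_subset hχ) (R.X_subset hξ),
      R.enstrophy_D hI w (S.X.add_mem hχ (S.X.smul_mem s hξ)) (f := fun y => f y + s * g y)
        (hf.add (contDiff_const.mul hg)) (fun y hy => by simp [hχf hy, hξg hy])]
    refine setIntegral_congr_fun R.isOpen.measurableSet fun x hx => ?_
    -- Linearity of the vorticity is inherited from that of `elliptic` after division by `a > 0`.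
    have h1 := elliptic_add_const_mul R.contDiff_a R.contDiff_β S.lam S.sig hf hg s x
    rw [R.elliptic_eq hI hf hx, R.elliptic_eq hI hg hx,
      R.elliptic_eq hI (hf.add (contDiff_const.mul hg)) hx] at h1
    have h2 : vorticity β S.lam S.sig (fun y => f y + s * g y) x
        = vorticity β S.lam S.sig f x + s * vorticity β S.lam S.sig g x :=
      mul_left_cancel₀ (R.a_pos x hx).ne' (by rw [h1]; ring)
    simp only [h2]
  simp only [e]
  have hs : ContDiff ℝ ∞ (fun z : ℝ × E3 => a z.2 *
      w (vorticity β S.lam S.sig f z.2 + z.1 * vorticity β S.lam S.sig g z.2)) :=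
    (R.contDiff_a.comp contDiff_snd).mul (hw.comp ((hv.comp contDiff_snd).add
      (contDiff_fst.mul (hv'.comp contDiff_snd))))
  refine (hasDerivAt_setIntegral hs R.bounded 0).congr_deriv ?_
  refine setIntegral_congr_fun R.isOpen.measurableSet fun x hx => ?_
  have h1 : HasDerivAt (fun s : ℝ => vorticity β S.lam S.sig f x
      + s * vorticity β S.lam S.sig g x) (vorticity β S.lam S.sig g x) 0 := by
    simpa using ((hasDerivAt_id (0 : ℝ)).mul_const (vorticity β S.lam S.sig g x)).const_add
      (vorticity β S.lam S.sig f x)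
  have h2 := (((ContDiff.diffAt hw _).hasDerivAt.comp 0 h1).const_mul (a x)).deriv
  simp only [Function.comp_def, zero_mul, add_zero] at h2
  simp only [h2, indicator_of_mem hx, R.vorticity_eq_div hI hf hχf hx,
    R.D_eq_vorticity hI hg hξg hx]
  ring

theorem enstrophy_mem_observables (hI : S.Integrability) {w : ℝ → ℝ} (hw : ContDiff ℝ ∞ w) :
    S.enstrophy w ∈ S.Observables := by
  have hw' : ContDiff ℝ ∞ (deriv w) := (contDiff_infty_iff_deriv.1 hw).2
  refine S.mem_observables (fun η => S.Ω.indicator fun x => deriv w (η x / S.A x))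
    (fun χ hχ => R.hasFunDeriv_enstrophy hI hw hχ) fun k p hp hpX => ?_
  obtain ⟨-, f, hf, hpf⟩ := (smoothFamilyOn_univ_iff R.bounded).1 hp
  exact (smoothFamilyOn_univ_iff R.bounded).2 ⟨fun s x hx => indicator_of_notMem hx _,
    fun s x => deriv w (vorticity β S.lam S.sig (f s) x),
    hw'.comp (contDiff_vorticity R.contDiff_β _ _ hf), fun s x hx => by
      simp only [indicator_of_mem hx, R.vorticity_eq_div hI (ContDiff.slice hf s) (hpf s) hx]⟩

/-- By the chain rule `q [w'(q),g] = q w''(q) [q,g]`, and `k w''(k)` is the derivative of `k w'(k) -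
w(k)`. The integrand is thus `a` times the bracket of a function of `q` with `g`, a pure divergence.
-/
theorem isCasimir_enstrophy (hI : S.Integrability) {w : ℝ → ℝ} (hw : ContDiff ℝ ∞ w) :
    IsCasimir S.Phase S.Observables S.bracket' (S.enstrophy w) := by
  refine ⟨R.enstrophy_mem_observables hI hw, ?_⟩
  rintro G hG _ ⟨χ, hχ, rfl⟩
  have hw' : ContDiff ℝ ∞ (deriv w) := (contDiff_infty_iff_deriv.1 hw).2
  obtain ⟨f, hf, hχf⟩ := R.exists_rep (R.X_subset hχ)
  obtain ⟨g, hg, hGg⟩ := R.exists_rep_funDeriv hG hχ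
  have hv := R.contDiff_vorticity_const hf
  have hW : EqOn (S.funDeriv (S.enstrophy w) (S.D χ))
      (fun x => deriv w (vorticity β S.lam S.sig f x)) S.Ω := fun x hx => by
    simp only [R.funDeriv_eq (R.hasFunDeriv_enstrophy hI hw hχ), indicator_of_mem hx,
      R.vorticity_eq_div hI hf hχf hx]
  have hm : ContDiff ℝ ∞ (fun k : ℝ => k * deriv w k - w k) := (contDiff_id.mul hw').sub hw
  have hm' : ∀ k, deriv (fun k : ℝ => k * deriv w k - w k) k = k * deriv (deriv w) k := fun k => by
    have h1 := (((hasDerivAt_id k).mul (ContDiff.diffAt hw' k).hasDerivAt).sub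
      (ContDiff.diffAt hw k).hasDerivAt).deriv
    simp only [id, one_mul] at h1
    refine Eq.trans ?_ (h1.trans (by ring))
    rfl
  -- Taking the constant `1` as the tested function turns integration by parts into the vanishing of
  -- `∫ a [m(q),g]`.
  have key := R.setIntegral_fieldBracket_by_parts hI (hm.comp hv) (contDiff_const (c := (1 : ℝ))) hg
  simp only [fieldBracket_const, mul_zero, integral_zero, one_mul] at key
  rw [R.bracket'_eq hI hf hχf hW hGg]
  refine Eq.trans ?_ (neg_eq_zero.1 key.symm)
  congr 1 with x
  rw [fieldBracket_comp β hw' hv]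
  have := fieldBracket_comp β hm hv g x
  simp only [hm'] at this
  rw [Function.comp_def, this]
  ring

/-! ### The equation of motion -/

theorem hasFunDeriv_smeared {φ : E3 → ℝ} (hφ : φ ∈ TestFunctions S.Ω) {χ : E3 → ℝ}
    (hχ : χ ∈ S.X) : S.HasFunDeriv (S.smeared φ) (S.D χ) φ := by
  have hφ' := R.testFunctions_subset hφ
  refine ⟨hφ', ?_⟩
  rintro _ ⟨ξ, hξ, rfl⟩
  have e : ∀ s : ℝ, S.smeared φ (S.D χ + s • S.D ξ)
      = (∫ x in S.Ω, φ x * S.D χ x) + s * ∫ x in S.Ω, φ x * S.D ξ x := fun s => by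
    rw [Setting.smeared, ← integral_const_mul, ← integral_add
      (R.integrableOn_mul_D hφ' (R.X_subset hχ))
      ((R.integrableOn_mul_D hφ' (R.X_subset hξ)).const_mul s)]
    congr 1 with x
    simp only [Pi.add_apply, Pi.smul_apply, smul_eq_mul]
    ring
  simp only [e]
  simpa using ((hasDerivAt_id (0 : ℝ)).mul_const (∫ x in S.Ω, φ x * S.D ξ x)).const_add
    (∫ x in S.Ω, φ x * S.D χ x)

theorem smeared_mem_observables {φ : E3 → ℝ} (hφ : φ ∈ TestFunctions S.Ω) :
    S.smeared φ ∈ S.Observables :=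
  S.mem_observables (fun _ => φ) (fun _ hχ => R.hasFunDeriv_smeared hφ hχ) fun _ _ _ _ =>
    (smoothFamilyOn_univ_iff R.bounded).2 ⟨fun _ => (R.testFunctions_subset hφ).1, fun _ => φ,
      contDiff_uncurry_const hφ.1, fun _ _ _ => rfl⟩

/-- Because `H_η = χ`, integrating by parts in `∫ a q [F_η,χ]` gives `F_η` against `-a [q,χ]`, which
is the right-hand side of the equation. -/
theorem bracket'_energy (hI : S.Integrability) {F : Functional} (hF : F ∈ S.Observables)
    {χ : E3 → ℝ} (hχ : χ ∈ S.X) :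
    S.bracket' F S.energy (S.D χ) = ∫ x in S.Ω, S.funDeriv F (S.D χ) x * S.rhs χ x := by
  obtain ⟨f, hf, hχf⟩ := R.exists_rep (R.X_subset hχ)
  obtain ⟨φ, hφ, hFφ⟩ := R.exists_rep_funDeriv hF hχ
  have hE : EqOn (S.funDeriv S.energy (S.D χ)) f S.Ω := by
    rwa [R.funDeriv_eq (R.hasFunDeriv_energy hχ)]
  rw [R.bracket'_eq hI hf hχf hFφ hE,
    R.setIntegral_fieldBracket_by_parts hI (R.contDiff_vorticity_const hf) hφ hf, ← integral_neg]
  refine setIntegral_congr_fun R.isOpen.measurableSet fun x hx => ?_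
  simp only [R.rhs_eq_neg_fieldBracket hI hf hχf hx, hFφ hx, mul_neg]

/-- The implications form a cycle: the pointwise equation gives the one for all observables by the
chain rule, smeared fields are observables, and test functions recover the pointwise equation. -/
theorem equation_iff_of_univ (hI : S.Integrability) {χ : ℝ → E3 → ℝ}
    (hχ : SmoothFamilyOn S.Ω univ χ) (hχX : ∀ t, χ t ∈ S.X) (t : ℝ) :
    (S.SolvesAt χ t ↔ ∀ φ ∈ TestFunctions S.Ω, HasDerivAt (fun s => S.smeared φ (S.D (χ s)))
      (S.bracket' (S.smeared φ) S.energy (S.D (χ t))) t) ∧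
    (S.SolvesAt χ t ↔ ∀ F ∈ S.Observables, HasDerivAt (fun s => F (S.D (χ s)))
      (S.bracket' F S.energy (S.D (χ t))) t) := by
  obtain ⟨-, f, hf, hχf⟩ := (smoothFamilyOn_univ_iff R.bounded).1 hχ
  have hE := contDiff_elliptic R.contDiff_a R.contDiff_β S.lam S.sig hf
  have hft := ContDiff.slice hf t
  have hDd : ∀ x ∈ S.Ω, (fun s => S.D (χ s) x)
      = fun s => elliptic a β S.lam S.sig (f s) x := fun x hx =>
    funext fun s => R.D_eq (hχf s) hx
  have h1 : S.SolvesAt χ t → ∀ F ∈ S.Observables, HasDerivAt (fun s => F (S.D (χ s)))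
      (S.bracket' F S.energy (S.D (χ t))) t := fun h F hF => by
    refine (R.hasDerivAt_comp_D hF hχ hχX t).congr_deriv ?_
    rw [R.bracket'_energy hI hF (hχX t)]
    exact setIntegral_congr_fun R.isOpen.measurableSet fun x hx => by
      simp only [(h x hx).deriv]
  have h2 : (∀ φ ∈ TestFunctions S.Ω, HasDerivAt (fun s => S.smeared φ (S.D (χ s)))
      (S.bracket' (S.smeared φ) S.energy (S.D (χ t))) t) → S.SolvesAt χ t := fun h x hx => by
    -- The defect `∂_t η - rhs`, expressed through smooth representatives; its integral against
    -- every test function is shown to vanish.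
    have hsm : ContDiff ℝ ∞ (fun y => deriv (fun s => elliptic a β S.lam S.sig (f s) y) t
        + a y * fieldBracket β (vorticity β S.lam S.sig (f t)) (f t) y) := by
      refine ContDiff.add ?_ (R.contDiff_a.mul (R.contDiff_fieldBracket_const
        (R.contDiff_vorticity_const hft) hft))
      have := ContDiff.fderiv (m := ∞) (n := ∞)
        (f := fun (y : E3) (s : ℝ) => elliptic a β S.lam S.sig (f s) y)
        (g := fun _ => t) (hE.comp (f := fun z : E3 × ℝ => (z.2, z.1)) (by fun_prop))
        contDiff_const (by simp)
      exact this.clm_apply contDiff_const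
    have h0 := R.eq_zero_of_setIntegral_eq_zero hsm (fun φ hφ => ?_) hx
    · have hd : DifferentiableAt ℝ (fun s => elliptic a β S.lam S.sig (f s) x) t :=
        ContDiff.diffAt (ContDiff.slice_left hE x) t
      rw [hDd x hx, R.rhs_eq_neg_fieldBracket hI hft (hχf t) hx, ← eq_neg_of_add_eq_zero_left h0]
      exact hd.hasDerivAt
    · have hF := R.smeared_mem_observables hφ
      have hu := (R.hasDerivAt_comp_D hF hχ hχX t).unique (h φ hφ)
      have hφd := R.funDeriv_eq (R.hasFunDeriv_smeared hφ (hχX t))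
      rw [R.bracket'_energy hI hF (hχX t), hφd, ← sub_eq_zero, ← integral_sub] at hu
      · rw [← hu]
        refine setIntegral_congr_fun R.isOpen.measurableSet fun y hy => ?_
        simp only [hDd y hy, R.rhs_eq_neg_fieldBracket hI hft (hχf t) hy]
        ring
      · refine R.integrableOn_of_eqOn (hφ.1.mul (hsm.sub (R.contDiff_a.mul
          (R.contDiff_fieldBracket_const (R.contDiff_vorticity_const hft) hft)))) fun y hy => ?_
        simp only [hDd y hy]
        ring
      · refine R.integrableOn_of_eqOn (hφ.1.mul (R.contDiff_a.mul
          (R.contDiff_fieldBracket_const (R.contDiff_vorticity_const hft) hft)).neg) fun y hy => ?_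
        simp only [R.rhs_eq_neg_fieldBracket hI hft (hχf t) hy]
  exact ⟨⟨fun h φ hφ => h1 h _ (R.smeared_mem_observables hφ), h2⟩,
    h1, fun h => h2 fun φ hφ => h _ (R.smeared_mem_observables hφ)⟩

/-- The chain rule is available for families over the whole real line, so time is reparametrized by
a smooth map into `I` that is the identity near `t`; derivatives at `t` are unchanged. -/
theorem equation_iff (hI : S.Integrability) {I : Set ℝ} {χ : ℝ → E3 → ℝ} (hIo : IsOpen I)
    (hχ : SmoothFamilyOn S.Ω I χ) (hχX : ∀ t ∈ I, χ t ∈ S.X) {t : ℝ} (ht : t ∈ I) :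
    (S.SolvesAt χ t ↔ ∀ φ ∈ TestFunctions S.Ω, HasDerivAt (fun s => S.smeared φ (S.D (χ s)))
      (S.bracket' (S.smeared φ) S.energy (S.D (χ t))) t) ∧
    (S.SolvesAt χ t ↔ ∀ F ∈ S.Observables, HasDerivAt (fun s => F (S.D (χ s)))
      (S.bracket' F S.energy (S.D (χ t))) t) := by
  obtain ⟨ψ, hψ, hψI, hψt⟩ := exists_contDiff_retraction hIo ht
  have hp : SmoothFamilyOn S.Ω univ (fun s => χ (ψ s)) := by
    obtain ⟨h0, U, f, hU, hΩU, hf, hχf⟩ := hχ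
    exact ⟨fun s _ x hx => h0 _ (hψI s) x hx, U, fun z => f (ψ z.1, z.2), hU, hΩU,
      hf.comp ((hψ.comp contDiff_fst).prodMk contDiff_snd).contDiffOn fun z hz => ⟨hψI _, hz.2⟩,
      fun s _ x hx => hχf _ (hψI s) x hx⟩
  have key := R.equation_iff_of_univ hI hp (fun s => hχX _ (hψI s)) t
  have hev : ∀ L : (E3 → ℝ) → ℝ, (fun s => L (χ (ψ s))) =ᶠ[𝓝 t] fun s => L (χ s) := fun L => by
    filter_upwards [hψt] with s hs
    rw [hs]
  have e1 : S.SolvesAt (fun s => χ (ψ s)) t ↔ S.SolvesAt χ t := by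
    simp only [Setting.SolvesAt, hψt.self_of_nhds]
    exact forall₂_congr fun x _ => (hev fun c => S.D c x).hasDerivAt_iff
  have e2 : ∀ (F : Functional) (d : ℝ), HasDerivAt (fun s => F (S.D (χ (ψ s)))) d t
      ↔ HasDerivAt (fun s => F (S.D (χ s))) d t := fun F d =>
    (hev fun c => F (S.D c)).hasDerivAt_iff
  simpa only [e1, e2, hψt.self_of_nhds] using key

end Setting.IsRegular

/-! ### The Jacobi identity for scalar fields -/

theorem fieldBracket_expand (β : E3 → E3) (f g : E3 → ℝ) (x : E3) :
    fieldBracket β f g x = pd 0 f x * (β x 1 * pd 2 g x - β x 2 * pd 1 g x)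
      + pd 1 f x * (β x 2 * pd 0 g x - β x 0 * pd 2 g x)
      + pd 2 f x * (β x 0 * pd 1 g x - β x 1 * pd 0 g x) := by
  simp only [fieldBracket, drift, inner_E3, cross_zero, cross_one, cross_two, grad_zero, grad_one,
    grad_two]

/-- The product rule, with the derivative of `β` isolated: the last group is the same bracket with
`∂ᵢβ` in place of `β`. -/
theorem pd_fieldBracket {β : E3 → E3} (hβ : ContDiff ℝ ∞ β) {f g : E3 → ℝ} (hf : ContDiff ℝ ∞ f)
    (hg : ContDiff ℝ ∞ g) (i : Fin 3) (x : E3) :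
    pd i (fieldBracket β f g) x = fieldBracket β (pd i f) g x + fieldBracket β f (pd i g) x
      + (pd 0 f x * (pd i (fun y => β y 1) x * pd 2 g x - pd i (fun y => β y 2) x * pd 1 g x)
        + pd 1 f x * (pd i (fun y => β y 2) x * pd 0 g x - pd i (fun y => β y 0) x * pd 2 g x)
        + pd 2 f x * (pd i (fun y => β y 0) x * pd 1 g x - pd i (fun y => β y 1) x * pd 0 g x)) := by
  have hb := fun j => ContDiff.coord hβ j
  have hf' := fun j => contDiff_pd_const hf j
  have hg' := fun j => contDiff_pd_const hg j
  have h1 : ∀ j k l : Fin 3, ContDiff ℝ ∞ fun y => pd j f y * (β y k * pd l g y - β y l * pd k g y) :=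
    fun j k l => (hf' j).mul (((hb k).mul (hg' l)).sub ((hb l).mul (hg' k)))
  have h2 : ∀ j k l : Fin 3, pd i (fun y => pd j f y * (β y k * pd l g y - β y l * pd k g y)) x
      = pd j (pd i f) x * (β x k * pd l g x - β x l * pd k g x)
        + pd j f x * (pd i (fun y => β y k) x * pd l g x + β x k * pd l (pd i g) x
          - (pd i (fun y => β y l) x * pd k g x + β x l * pd k (pd i g) x)) := fun j k l => by
    rw [pd_mul (ContDiff.diffAt (hf' j) x) (ContDiff.diffAt
      (((hb k).mul (hg' l)).sub ((hb l).mul (hg' k))) x), pd_mul_sub_mul (hb k) (hg' l) (hb l)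
      (hg' k), pd_comm hf i j, pd_comm hg i l, pd_comm hg i k]
  have h3 : ∀ u v w : E3 → ℝ, ContDiff ℝ ∞ u → ContDiff ℝ ∞ v → ContDiff ℝ ∞ w →
      pd i (fun y => u y + v y + w y) x = pd i u x + pd i v x + pd i w x := fun u v w hu hv hw => by
    simp only [pd]
    rw [fderiv_fun_add (ContDiff.diffAt (hu.add hv) x) (ContDiff.diffAt hw x),
      fderiv_fun_add (ContDiff.diffAt hu x) (ContDiff.diffAt hv x)]
    simp only [add_apply]
  rw [show fieldBracket β f g = _ from funext (fieldBracket_expand β f g),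
    h3 _ _ _ (h1 0 1 2) (h1 1 2 0) (h1 2 0 1), h2, h2, h2]
  simp only [fieldBracket_expand]
  ring

/-- Second derivatives of `f`, `g`, `h` cancel in the cyclic sum. What is left is `β · ∇ × β` times
the determinant of the three gradients, which is the coefficient in the final `linear_combination`.
-/
theorem fieldBracket_jacobi {β : E3 → E3} (hβ : ContDiff ℝ ∞ β) {f g h : E3 → ℝ}
    (hf : ContDiff ℝ ∞ f) (hg : ContDiff ℝ ∞ g) (hh : ContDiff ℝ ∞ h) {x : E3}
    (hx : inner ℝ (β x) (curl β x) = 0) :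
    fieldBracket β (fieldBracket β f g) h x + fieldBracket β (fieldBracket β g h) f x
      + fieldBracket β (fieldBracket β h f) g x = 0 := by
  rw [fieldBracket_expand, fieldBracket_expand β (fieldBracket β g h),
    fieldBracket_expand β (fieldBracket β h f)]
  simp only [pd_fieldBracket hβ hf hg, pd_fieldBracket hβ hg hh, pd_fieldBracket hβ hh hf]
  simp only [fieldBracket_expand]
  simp only [pd_comm hf 1 0, pd_comm hf 2 0, pd_comm hf 2 1, pd_comm hg 1 0, pd_comm hg 2 0,
    pd_comm hg 2 1, pd_comm hh 1 0, pd_comm hh 2 0, pd_comm hh 2 1]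
  simp only [inner_E3, curl_zero, curl_one, curl_two] at hx
  linear_combination (pd 0 f x * (pd 1 g x * pd 2 h x - pd 2 g x * pd 1 h x)
    + pd 1 f x * (pd 2 g x * pd 0 h x - pd 0 g x * pd 2 h x)
    + pd 2 f x * (pd 0 g x * pd 1 h x - pd 1 g x * pd 0 h x)) * hx

/-! ### Mixed partial derivatives -/

/-- Both sides are the second derivative of the uncurried map, evaluated on `(v, 0)` and `(0, w)` in
the two orders. -/
theorem fderiv_fderiv_comm {E G : Type*} [NormedAddCommGroup E] [NormedSpace ℝ E]
    [NormedAddCommGroup G] [NormedSpace ℝ G] {Φ : E → G → ℝ}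
    (hΦ : ContDiff ℝ ∞ (Function.uncurry Φ)) (s v : E) (y w : G) :
    fderiv ℝ (fun s => fderiv ℝ (fun y => Φ s y) y w) s v
      = fderiv ℝ (fun y => fderiv ℝ (fun s => Φ s y) s v) y w := by
  have hd : ∀ z, HasFDerivAt (Function.uncurry Φ) (fderiv ℝ (Function.uncurry Φ) z) z := fun z =>
    (ContDiff.diffAt hΦ z).hasFDerivAt
  have hl : ∀ s y, HasFDerivAt (fun s : E => (s, y)) (ContinuousLinearMap.inl ℝ E G) s :=
    fun s y => hasFDerivAt_prodMk_left s y
  have hr : ∀ s y, HasFDerivAt (fun y : G => (s, y)) (ContinuousLinearMap.inr ℝ E G) y :=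
    fun s y => hasFDerivAt_prodMk_right s y
  have h1 : ∀ s y, fderiv ℝ (fun s => Φ s y) s v = fderiv ℝ (Function.uncurry Φ) (s, y) (v, 0) :=
    fun s y => by
      have := ((hd (s, y)).comp s (hl s y)).fderiv
      exact (DFunLike.congr_fun this v).trans (by simp)
  have h2 : ∀ s y, fderiv ℝ (fun y => Φ s y) y w = fderiv ℝ (Function.uncurry Φ) (s, y) (0, w) :=
    fun s y => by
      have := ((hd (s, y)).comp y (hr s y)).fderiv
      exact (DFunLike.congr_fun this w).trans (by simp)
  have hdd : HasFDerivAt (fderiv ℝ (Function.uncurry Φ))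
      (fderiv ℝ (fderiv ℝ (Function.uncurry Φ)) (s, y)) (s, y) :=
    (ContDiff.diffAt (hΦ.fderiv_right (m := ∞) (by simp)) _).hasFDerivAt
  have h3 : fderiv ℝ (fun s => fderiv ℝ (Function.uncurry Φ) (s, y) (0, w)) s v
      = fderiv ℝ (fderiv ℝ (Function.uncurry Φ)) (s, y) (v, 0) (0, w) := by
    have := ((hdd.comp s (hl s y)).clm_apply (hasFDerivAt_const ((0 : E), w) s)).fderiv
    exact (DFunLike.congr_fun this v).trans (by simp)
  have h4 : fderiv ℝ (fun y => fderiv ℝ (Function.uncurry Φ) (s, y) (v, 0)) y w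
      = fderiv ℝ (fderiv ℝ (Function.uncurry Φ)) (s, y) (0, w) (v, 0) := by
    have := ((hdd.comp y (hr s y)).clm_apply (hasFDerivAt_const (v, (0 : G)) y)).fderiv
    exact (DFunLike.congr_fun this w).trans (by simp)
  simp only [h1, h2]
  rw [h3, h4]
  exact (hΦ.contDiffAt.isSymmSndFDerivAt (by
    simpa using WithTop.coe_le_coe.2 (le_top : (2 : ℕ∞) ≤ ⊤))) _ _

theorem contDiff_deriv_param {Z : Type*} [NormedAddCommGroup Z] [NormedSpace ℝ Z]
    {h : Z → ℝ → ℝ} (hh : ContDiff ℝ ∞ (Function.uncurry h)) (t : ℝ) :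
    ContDiff ℝ ∞ (fun z => deriv (h z) t) :=
  (ContDiff.fderiv hh (contDiff_const (c := t)) (by simp : (∞ : WithTop ℕ∞) + 1 ≤ ∞)).clm_apply
    (contDiff_const (c := (1 : ℝ)))

theorem contDiff_deriv_field {f : ℝ → E3 → ℝ} (hf : ContDiff ℝ ∞ (Function.uncurry f)) (t : ℝ) :
    ContDiff ℝ ∞ (fun y => deriv (fun s => f s y) t) :=
  contDiff_deriv_param (h := fun y s => f s y)
    (hf.comp (f := fun z : E3 × ℝ => (z.2, z.1)) (by fun_prop)) t

theorem hasDerivAt_pd {f : ℝ → E3 → ℝ} (hf : ContDiff ℝ ∞ (Function.uncurry f)) (t : ℝ)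
    (i : Fin 3) (x : E3) :
    HasDerivAt (fun s => pd i (f s) x) (pd i (fun y => deriv (fun s => f s y) t) x) t := by
  have h1 : ContDiff ℝ ∞ (fun s => pd i (f s) x) := contDiff_pd hf contDiff_const i
  have h2 := fderiv_fderiv_comm hf t 1 x (EuclideanSpace.single i 1)
  refine (ContDiff.diffAt h1 t).hasDerivAt.congr_deriv ?_
  exact h2

theorem hasDerivAt_fieldBracket (β : E3 → E3) {f g : ℝ → E3 → ℝ}
    (hf : ContDiff ℝ ∞ (Function.uncurry f)) (hg : ContDiff ℝ ∞ (Function.uncurry g)) (t : ℝ)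
    (x : E3) : HasDerivAt (fun s => fieldBracket β (f s) (g s) x)
      (fieldBracket β (fun y => deriv (fun s => f s y) t) (g t) x
        + fieldBracket β (f t) (fun y => deriv (fun s => g s y) t) x) t := by
  have h := fun i => hasDerivAt_pd hf t i x
  have h' := fun i => hasDerivAt_pd hg t i x
  simp only [fieldBracket_expand]
  refine ((((h 0).mul (((h' 2).const_mul (β x 1)).sub ((h' 1).const_mul (β x 2)))).add
    ((h 1).mul (((h' 0).const_mul (β x 2)).sub ((h' 2).const_mul (β x 0))))).add
    ((h 2).mul (((h' 1).const_mul (β x 0)).sub ((h' 0).const_mul (β x 1))))).congr_deriv ?_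
  simp only [Pi.sub_apply]
  ring

/-- The derivative of the functional derivative `F_η` at `η = 𝒟χ` in the direction `𝒟ξ`. -/
def Setting.sndVar (S : Setting) (F : Functional) (χ ξ : E3 → ℝ) (x : E3) : ℝ :=
  deriv (fun t : ℝ => S.funDeriv F (S.D (χ + t • ξ)) x) 0

/-- The Hamiltonian vector field `∇ · (η (B/B²) × ∇F_η)` of `F`, pulled back by `𝒟`. -/
def Setting.hamField (S : Setting) (F : Functional) (η : E3 → ℝ) : E3 → ℝ :=
  S.Dinv (S.Ω.indicator fun x =>
    divergence (fun y => η y • cross (S.b y) (grad (S.funDeriv F η) y)) x)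

/-- The functional derivative of the modified bracket of `F` and `G`. -/
def Setting.bracketDeriv (S : Setting) (F G : Functional) (η : E3 → ℝ) : E3 → ℝ :=
  S.Ω.indicator (fun x =>
      inner ℝ (grad (S.funDeriv F η) x) (cross (S.b x) (grad (S.funDeriv G η) x)))
    + (S.sndVar G (S.Dinv η) (S.hamField F η) - S.sndVar F (S.Dinv η) (S.hamField G η))

namespace Setting.IsRegular

variable {S : Setting} {a : E3 → ℝ} {β : E3 → E3} (R : S.IsRegular a β)
include R

/-! ### Second variations -/

theorem smoothFamily_comp {P Q : Type*} [NormedAddCommGroup P] [NormedSpace ℝ P]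
    [NormedAddCommGroup Q] [NormedSpace ℝ Q] {p : P → E3 → ℝ} (hp : SmoothFamilyOn S.Ω univ p)
    {ψ : Q → P} (hψ : ContDiff ℝ ∞ ψ) : SmoothFamilyOn S.Ω univ (fun s => p (ψ s)) := by
  obtain ⟨h0, f, hf, hpf⟩ := (smoothFamilyOn_univ_iff R.bounded).1 hp
  exact (smoothFamilyOn_univ_iff R.bounded).2 ⟨fun s => h0 _, fun s => f (ψ s),
    contDiff_uncurry_comp hf hψ, fun s => hpf _⟩

theorem smoothFamily_const (P : Type*) [NormedAddCommGroup P] [NormedSpace ℝ P] {χ : E3 → ℝ}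
    (hχ : χ ∈ SmoothBar S.Ω) : SmoothFamilyOn S.Ω univ (fun _ : P => χ) := by
  obtain ⟨h0, f, hf, hχf⟩ := (mem_smoothBar_iff R.bounded).1 hχ
  exact (smoothFamilyOn_univ_iff R.bounded).2 ⟨fun _ => h0, fun _ => f,
    contDiff_uncurry_const hf, fun _ => hχf⟩

theorem smoothBar_of_smoothFamily {P : Type*} [NormedAddCommGroup P] [NormedSpace ℝ P]
    {p : P → E3 → ℝ} (hp : SmoothFamilyOn S.Ω univ p) (s : P) : p s ∈ SmoothBar S.Ω := by
  obtain ⟨h0, f, hf, hpf⟩ := (smoothFamilyOn_univ_iff R.bounded).1 hp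
  exact (mem_smoothBar_iff R.bounded).2 ⟨h0 s, f s, ContDiff.slice hf s, hpf s⟩

theorem smoothFamily_add_smul {P : Type*} [NormedAddCommGroup P] [NormedSpace ℝ P]
    {p r : P → E3 → ℝ} (hp : SmoothFamilyOn S.Ω univ p) (hr : SmoothFamilyOn S.Ω univ r) :
    SmoothFamilyOn S.Ω univ (fun z : P × ℝ => p z.1 + z.2 • r z.1) := by
  have := R.smoothFamily_linear (c := fun _ : P × ℝ => 1) (d := fun z => z.2)
    (R.smoothFamily_comp hp contDiff_fst) (R.smoothFamily_comp hr contDiff_fst)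
    contDiff_const contDiff_snd
  simpa only [one_smul] using this

/-- The direction is adjoined as one more real parameter `t`; a `t`-derivative of the resulting
smooth family is again smooth. -/
theorem smoothFamily_sndVar {P : Type*} [NormedAddCommGroup P] [NormedSpace ℝ P]
    [FiniteDimensional ℝ P] {F : Functional} (hF : F ∈ S.Observables) {p r : P → E3 → ℝ}
    (hp : SmoothFamilyOn S.Ω univ p) (hpX : ∀ s, p s ∈ S.X) (hr : SmoothFamilyOn S.Ω univ r)
    (hrX : ∀ s, r s ∈ S.X) : SmoothFamilyOn S.Ω univ (fun s => S.sndVar F (p s) (r s)) := by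
  obtain ⟨h0, φ, hφ, hFφ⟩ := (smoothFamilyOn_univ_iff R.bounded).1
    (R.smoothFamily_funDeriv hF (R.smoothFamily_add_smul hp hr)
      fun z => S.X.add_mem (hpX _) (S.X.smul_mem _ (hrX _)))
  refine (smoothFamilyOn_univ_iff R.bounded).2 ⟨fun s x hx => ?_,
    fun s x => deriv (fun t => φ (s, t) x) 0, ?_, fun s x hx => ?_⟩
  · have : ∀ t : ℝ, S.funDeriv F (S.D (p s + t • r s)) x = 0 := fun t => h0 (s, t) x hx
    simp only [Setting.sndVar, this, deriv_const]
  · exact contDiff_deriv_param (h := fun (z : P × E3) t => φ (z.1, t) z.2)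
      (hφ.comp (f := fun z : (P × E3) × ℝ => ((z.1.1, z.2), z.1.2)) (by fun_prop)) 0
  · have : ∀ t : ℝ, S.funDeriv F (S.D (p s + t • r s)) x = φ (s, t) x := fun t => hFφ (s, t) hx
    simp only [Setting.sndVar, this]

theorem sndVar_mem_smoothBar {F : Functional} (hF : F ∈ S.Observables) {χ ξ : E3 → ℝ}
    (hχ : χ ∈ S.X) (hξ : ξ ∈ S.X) : S.sndVar F χ ξ ∈ SmoothBar S.Ω :=
  R.smoothBar_of_smoothFamily (R.smoothFamily_sndVar hF
    (R.smoothFamily_const ℝ (R.X_subset hχ)) (fun _ => hχ)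
    (R.smoothFamily_const ℝ (R.X_subset hξ)) fun _ => hξ) 0

theorem smoothFamily_line {χ ξ : E3 → ℝ} (hχ : χ ∈ S.X) (hξ : ξ ∈ S.X) :
    SmoothFamilyOn S.Ω univ (fun s : ℝ => χ + s • ξ) :=
  R.smoothFamily_comp (R.smoothFamily_add_smul (R.smoothFamily_const ℝ (R.X_subset hχ))
    (R.smoothFamily_const ℝ (R.X_subset hξ))) (contDiff_id.prodMk contDiff_id)

/-- Identifies the pairing of a second variation with a mixed derivative of a function of two real
variables, for which symmetry is classical. -/
theorem deriv_deriv_eq_sndVar {F : Functional} (hF : F ∈ S.Observables) {χ ξ ζ : E3 → ℝ}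
    (hχ : χ ∈ S.X) (hξ : ξ ∈ S.X) (hζ : ζ ∈ S.X) :
    deriv (fun s : ℝ => deriv (fun t : ℝ => F (S.D (χ + s • ξ + t • ζ))) 0) 0
      = ∫ x in S.Ω, S.sndVar F χ ξ x * S.D ζ x := by
  have hX : ∀ s : ℝ, χ + s • ξ ∈ S.X := fun s => S.X.add_mem hχ (S.X.smul_mem s hξ)
  obtain ⟨-, φ, hφ, hFφ⟩ := (smoothFamilyOn_univ_iff R.bounded).1
    (R.smoothFamily_funDeriv hF (R.smoothFamily_line hχ hξ) hX)
  obtain ⟨g, hg, hζg⟩ := R.exists_rep (R.X_subset hζ)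
  have h1 : ∀ s : ℝ, deriv (fun t : ℝ => F (S.D (χ + s • ξ + t • ζ))) 0
      = ∫ x in S.Ω, φ s x * elliptic a β S.lam S.sig g x := fun s => by
    rw [(R.hasDerivAt_line hF (hX s) hζ 0).deriv]
    refine setIntegral_congr_fun R.isOpen.measurableSet fun x hx => ?_
    simp only [zero_smul, add_zero, hFφ s hx, R.D_eq hζg hx]
  simp only [h1]
  have hs : ContDiff ℝ ∞ (fun z : ℝ × E3 => φ z.1 z.2 * elliptic a β S.lam S.sig g z.2) :=
    hφ.mul ((R.contDiff_elliptic_const hg).comp contDiff_snd)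
  rw [(hasDerivAt_setIntegral hs R.bounded 0).deriv]
  refine setIntegral_congr_fun R.isOpen.measurableSet fun x hx => ?_
  have h2 : ∀ t : ℝ, S.funDeriv F (S.D (χ + t • ξ)) x = φ t x := fun t => hFφ t hx
  simp only [Setting.sndVar, h2, R.D_eq hζg hx,
    deriv_mul_const (ContDiff.diffAt (ContDiff.slice_left hφ x) 0)]

/-- Second variations are symmetric. -/
theorem setIntegral_sndVar_comm {F : Functional} (hF : F ∈ S.Observables) {χ ξ ζ : E3 → ℝ}
    (hχ : χ ∈ S.X) (hξ : ξ ∈ S.X) (hζ : ζ ∈ S.X) :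
    ∫ x in S.Ω, S.sndVar F χ ξ x * S.D ζ x = ∫ x in S.Ω, S.sndVar F χ ζ x * S.D ξ x := by
  have hfam : SmoothFamilyOn S.Ω univ (fun z : ℝ × ℝ => χ + z.1 • ξ + z.2 • ζ) :=
    R.smoothFamily_add_smul (R.smoothFamily_line hχ hξ)
      (R.smoothFamily_const ℝ (R.X_subset hζ))
  have hΦ := R.contDiff_comp_D hF hfam fun z =>
    S.X.add_mem (S.X.add_mem hχ (S.X.smul_mem _ hξ)) (S.X.smul_mem _ hζ)
  have h := fderiv_fderiv_comm (Φ := fun s t : ℝ => F (S.D (χ + s • ξ + t • ζ))) hΦ 0 1 0 1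
  simp only [fderiv_apply_one_eq_deriv] at h
  rw [← R.deriv_deriv_eq_sndVar hF hχ hξ hζ, ← R.deriv_deriv_eq_sndVar hF hχ hζ hξ, h]
  simp only [add_right_comm]

/-! ### Hamiltonian vector fields -/

/-- `hamField` is defined through a pointwise choice of preimage; injectivity of `𝒟` forces it to
coincide with the smooth family supplied by `InverseDefined`. The indicator in its definition
matches the zero extension built into `𝒟`. -/
theorem exists_smoothFamily_hamField {P : Type*} [NormedAddCommGroup P] [NormedSpace ℝ P]
    [FiniteDimensional ℝ P] (hInv : S.InverseDefined) {G : Functional} (hG : G ∈ S.Observables)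
    {p : P → E3 → ℝ} (hp : SmoothFamilyOn S.Ω univ p) (hpX : ∀ s, p s ∈ S.X) :
    SmoothFamilyOn S.Ω univ (fun s => S.hamField G (S.D (p s))) ∧
      (∀ s, S.hamField G (S.D (p s)) ∈ S.X) ∧ ∀ s, ∀ x ∈ S.Ω, S.D (S.hamField G (S.D (p s))) x =
        divergence (fun y => S.D (p s) y • cross (S.b y) (grad (S.funDeriv G (S.D (p s))) y)) x := by
  have e : P ≃L[ℝ] (Fin (Module.finrank ℝ P) → ℝ) :=
    ContinuousLinearEquiv.ofFinrankEq (by simp)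
  obtain ⟨r, hr, hrX, hDr⟩ := hInv _ (fun s => p (e.symm s))
    (fun s => S.funDeriv G (S.D (p (e.symm s)))) (R.smoothFamily_comp hp e.symm.contDiff)
    (fun s => hpX _)
    (R.smoothFamily_comp (R.smoothFamily_funDeriv hG hp hpX) e.symm.contDiff)
  have hham : ∀ s, S.hamField G (S.D (p s)) = r (e s) := fun s => by
    rw [← R.Dinv_D (hrX (e s)), Setting.hamField]
    congr 1
    ext x
    by_cases hx : x ∈ S.Ω
    · rw [indicator_of_mem hx, hDr _ x hx, e.symm_apply_apply]
    · rw [indicator_of_notMem hx, Setting.D, indicator_of_notMem hx]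
  simp only [hham]
  refine ⟨R.smoothFamily_comp hr e.contDiff, fun s => hrX _, fun s x hx => ?_⟩
  rw [hDr _ x hx, e.symm_apply_apply]

theorem hamField_mem (hInv : S.InverseDefined) {G : Functional} (hG : G ∈ S.Observables)
    {χ : E3 → ℝ} (hχ : χ ∈ S.X) : S.hamField G (S.D χ) ∈ S.X :=
  (R.exists_smoothFamily_hamField (P := ℝ) hInv hG (R.smoothFamily_const ℝ (R.X_subset hχ))
    fun _ => hχ).2.1 0

theorem D_hamField (hI : S.Integrability) (hInv : S.InverseDefined) {G : Functional}
    (hG : G ∈ S.Observables) {χ k g : E3 → ℝ} (hχ : χ ∈ S.X) (hk : ContDiff ℝ ∞ k)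
    (hχk : EqOn χ k S.Ω) (hg : ContDiff ℝ ∞ g) (hGg : EqOn (S.funDeriv G (S.D χ)) g S.Ω) {x : E3}
    (hx : x ∈ S.Ω) : S.D (S.hamField G (S.D χ)) x
      = a x * fieldBracket β (vorticity β S.lam S.sig k) g x := by
  rw [(R.exists_smoothFamily_hamField (P := ℝ) hInv hG (R.smoothFamily_const ℝ (R.X_subset hχ))
    fun _ => hχ).2.2 0 x hx, ← R.divergence_flux hI (R.contDiff_vorticity_const hk) hg hx]
  refine divergence_eq_of_eqOn R.isOpen (fun y hy => ?_) hx
  simp only [R.D_eq_vorticity hI hk hχk hy, R.b_eq y hy, grad_eq_of_eqOn R.isOpen hGg hy, drift]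

/-- The pairing of `u ∈ C^∞(Ω̄)` with the Hamiltonian vector field of `G`. -/
theorem setIntegral_mul_D_hamField (hI : S.Integrability) (hInv : S.InverseDefined)
    {G : Functional} (hG : G ∈ S.Observables) {χ k g u f : E3 → ℝ} (hχ : χ ∈ S.X)
    (hk : ContDiff ℝ ∞ k) (hχk : EqOn χ k S.Ω) (hg : ContDiff ℝ ∞ g)
    (hGg : EqOn (S.funDeriv G (S.D χ)) g S.Ω) (hf : ContDiff ℝ ∞ f) (huf : EqOn u f S.Ω) :
    ∫ x in S.Ω, u x * S.D (S.hamField G (S.D χ)) x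
      = - ∫ x in S.Ω, a x * vorticity β S.lam S.sig k x * fieldBracket β f g x := by
  rw [R.setIntegral_fieldBracket_by_parts hI (R.contDiff_vorticity_const hk) hf hg, neg_neg]
  exact setIntegral_congr_fun R.isOpen.measurableSet fun x hx => by
    simp only [huf hx, R.D_hamField hI hInv hG hχ hk hχk hg hGg hx]

/-! ### The functional derivative of the bracket -/

theorem smoothFamily_bracketDeriv {P : Type*} [NormedAddCommGroup P] [NormedSpace ℝ P]
    [FiniteDimensional ℝ P] (hInv : S.InverseDefined) {F G : Functional}
    (hF : F ∈ S.Observables) (hG : G ∈ S.Observables) {p : P → E3 → ℝ}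
    (hp : SmoothFamilyOn S.Ω univ p) (hpX : ∀ s, p s ∈ S.X) :
    SmoothFamilyOn S.Ω univ (fun s => S.bracketDeriv F G (S.D (p s))) := by
  obtain ⟨hrF, hrFX, -⟩ := R.exists_smoothFamily_hamField hInv hF hp hpX
  obtain ⟨hrG, hrGX, -⟩ := R.exists_smoothFamily_hamField hInv hG hp hpX
  obtain ⟨h1, u, hu, hu'⟩ := (smoothFamilyOn_univ_iff R.bounded).1
    (R.smoothFamily_sndVar hF hp hpX hrG hrGX)
  obtain ⟨h2, v, hv, hv'⟩ := (smoothFamilyOn_univ_iff R.bounded).1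
    (R.smoothFamily_sndVar hG hp hpX hrF hrFX)
  obtain ⟨-, φ, hφ, hFφ⟩ := (smoothFamilyOn_univ_iff R.bounded).1
    (R.smoothFamily_funDeriv hF hp hpX)
  obtain ⟨-, γ, hγ, hGγ⟩ := (smoothFamilyOn_univ_iff R.bounded).1
    (R.smoothFamily_funDeriv hG hp hpX)
  refine (smoothFamilyOn_univ_iff R.bounded).2 ⟨fun s x hx => ?_,
    fun s x => fieldBracket β (φ s) (γ s) x + (v s x - u s x),
    (contDiff_fieldBracket R.contDiff_β hφ hγ).add (hv.sub hu), fun s x hx => ?_⟩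
  · simp only [Setting.bracketDeriv, Pi.add_apply, Pi.sub_apply, indicator_of_notMem hx,
      R.Dinv_D (hpX s), h1 s x hx, h2 s x hx, sub_zero, add_zero]
  · simp only [Setting.bracketDeriv, Pi.add_apply, Pi.sub_apply, indicator_of_mem hx,
      R.Dinv_D (hpX s), hu' s hx, hv' s hx, R.inner_grad_eq (hFφ s) (hGγ s) hx]

theorem setIntegral_bracketDeriv_mul_D (hInv : S.InverseDefined) {F G : Functional}
    (hF : F ∈ S.Observables) (hG : G ∈ S.Observables) {χ ξ f g : E3 → ℝ} (hχ : χ ∈ S.X)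
    (hξ : ξ ∈ S.X) (hf : ContDiff ℝ ∞ f) (hFf : EqOn (S.funDeriv F (S.D χ)) f S.Ω)
    (hg : ContDiff ℝ ∞ g) (hGg : EqOn (S.funDeriv G (S.D χ)) g S.Ω) :
    ∫ x in S.Ω, S.bracketDeriv F G (S.D χ) x * S.D ξ x
      = (∫ x in S.Ω, fieldBracket β f g x * S.D ξ x)
        + ((∫ x in S.Ω, S.sndVar G χ (S.hamField F (S.D χ)) x * S.D ξ x)
          - ∫ x in S.Ω, S.sndVar F χ (S.hamField G (S.D χ)) x * S.D ξ x) := by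
  have hξ' := R.X_subset hξ
  have i1 := R.integrableOn_mul_D (R.sndVar_mem_smoothBar hG hχ (R.hamField_mem hInv hF hχ)) hξ'
  have i2 := R.integrableOn_mul_D (R.sndVar_mem_smoothBar hF hχ (R.hamField_mem hInv hG hχ)) hξ'
  have i3 : IntegrableOn (fun x => fieldBracket β f g x * S.D ξ x) S.Ω := by
    obtain ⟨k, hk, hξk⟩ := R.exists_rep hξ'
    exact R.integrableOn_of_eqOn ((R.contDiff_fieldBracket_const hf hg).mul
      (R.contDiff_elliptic_const hk)) fun x hx => by simp only [R.D_eq hξk hx]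
  rw [← integral_sub i1 i2, ← integral_add i3 (by exact i1.sub i2)]
  refine setIntegral_congr_fun R.isOpen.measurableSet fun x hx => ?_
  simp only [Setting.bracketDeriv, Pi.add_apply, Pi.sub_apply, indicator_of_mem hx,
    R.Dinv_D hχ, R.inner_grad_eq hFf hGg hx]
  ring

/-- The product rule has three terms. Varying `η` gives `[F_η,G_η]` directly; varying `F_η` and
`G_η` gives brackets of second variations in the direction `ξ`, which must be rewritten as pairings
with `𝒟ξ`. -/
theorem hasFunDeriv_bracket' (hI : S.Integrability) (hInv : S.InverseDefined) {F G : Functional}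
    (hF : F ∈ S.Observables) (hG : G ∈ S.Observables) {χ : E3 → ℝ} (hχ : χ ∈ S.X) :
    S.HasFunDeriv (S.bracket' F G) (S.D χ) (S.bracketDeriv F G (S.D χ)) := by
  refine ⟨R.smoothBar_of_smoothFamily (R.smoothFamily_bracketDeriv (P := ℝ) hInv hF hG
    (R.smoothFamily_const ℝ (R.X_subset hχ)) fun _ => hχ) 0, ?_⟩
  rintro _ ⟨ξ, hξ, rfl⟩
  have hX : ∀ s : ℝ, χ + s • ξ ∈ S.X := fun s => S.X.add_mem hχ (S.X.smul_mem s hξ)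
  have hline := R.smoothFamily_line hχ hξ
  obtain ⟨-, φ, hφ, hFφ⟩ := (smoothFamilyOn_univ_iff R.bounded).1
    (R.smoothFamily_funDeriv hF hline hX)
  obtain ⟨-, γ, hγ, hGγ⟩ := (smoothFamilyOn_univ_iff R.bounded).1
    (R.smoothFamily_funDeriv hG hline hX)
  obtain ⟨f, hf, hχf⟩ := R.exists_rep (R.X_subset hχ)
  obtain ⟨g, hg, hξg⟩ := R.exists_rep (R.X_subset hξ)
  have hFφ0 : EqOn (S.funDeriv F (S.D χ)) (φ 0) S.Ω := by simpa using hFφ 0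
  have hGγ0 : EqOn (S.funDeriv G (S.D χ)) (γ 0) S.Ω := by simpa using hGγ 0
  have hφ' := contDiff_deriv_field hφ 0
  have hγ' := contDiff_deriv_field hγ 0
  have hFs : EqOn (S.sndVar F χ ξ) (fun y => deriv (fun s => φ s y) 0) S.Ω := fun x hx => by
    have h2 : ∀ t : ℝ, S.funDeriv F (S.D (χ + t • ξ)) x = φ t x := fun t => hFφ t hx
    simp only [Setting.sndVar, h2]
  have hGs : EqOn (S.sndVar G χ ξ) (fun y => deriv (fun s => γ s y) 0) S.Ω := fun x hx => by
    have h2 : ∀ t : ℝ, S.funDeriv G (S.D (χ + t • ξ)) x = γ t x := fun t => hGγ t hx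
    simp only [Setting.sndVar, h2]
  have e : ∀ s : ℝ, S.bracket' F G (S.D χ + s • S.D ξ) = ∫ x in S.Ω,
      (elliptic a β S.lam S.sig f x + s * elliptic a β S.lam S.sig g x)
        * fieldBracket β (φ s) (γ s) x := fun s => by
    rw [← R.D_add_smul (R.X_subset hχ) (R.X_subset hξ)]
    refine R.weightedBracket_eq (K := fun η => η) (fun x hx => ?_) (hFφ s) (hGγ s)
    rw [R.D_add_smul (R.X_subset hχ) (R.X_subset hξ)]
    simp only [Pi.add_apply, Pi.smul_apply, smul_eq_mul, R.D_eq hχf hx, R.D_eq hξg hx]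
  simp only [e]
  have hef := R.contDiff_elliptic_const hf
  have heg := R.contDiff_elliptic_const hg
  have hs : ContDiff ℝ ∞ (fun z : ℝ × E3 =>
      (elliptic a β S.lam S.sig f z.2 + z.1 * elliptic a β S.lam S.sig g z.2)
        * fieldBracket β (φ z.1) (γ z.1) z.2) :=
    ((hef.comp contDiff_snd).add (contDiff_fst.mul (heg.comp contDiff_snd))).mul
      (contDiff_fieldBracket R.contDiff_β hφ hγ)
  refine (hasDerivAt_setIntegral hs R.bounded 0).congr_deriv ?_
  rw [R.setIntegral_bracketDeriv_mul_D hInv hF hG hχ hξ (ContDiff.slice hφ 0) hFφ0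
      (ContDiff.slice hγ 0) hGγ0,
    -- Symmetry exchanges `ξ` with the Hamiltonian field; pairing with that field then produces a
    -- bracket with the derivative in the direction `ξ`.
    R.setIntegral_sndVar_comm hG hχ (R.hamField_mem hInv hF hχ) hξ,
    R.setIntegral_sndVar_comm hF hχ (R.hamField_mem hInv hG hχ) hξ,
    R.setIntegral_mul_D_hamField hI hInv hF hχ hf hχf (ContDiff.slice hφ 0) hFφ0 hγ' hGs,
    R.setIntegral_mul_D_hamField hI hInv hG hχ hf hχf (ContDiff.slice hγ 0) hGγ0 hφ' hFs,
    sub_neg_eq_add, ← integral_neg]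
  have hv := R.contDiff_vorticity_const hf
  have i1 : IntegrableOn (fun x => fieldBracket β (φ 0) (γ 0) x * S.D ξ x) S.Ω :=
    R.integrableOn_of_eqOn ((R.contDiff_fieldBracket_const (ContDiff.slice hφ 0)
      (ContDiff.slice hγ 0)).mul heg) fun x hx => by simp only [R.D_eq hξg hx]
  have i2 := R.integrableOn ((R.contDiff_a.mul hv).mul
    (R.contDiff_fieldBracket_const hγ' (ContDiff.slice hφ 0))).neg
  have i3 := R.integrableOn ((R.contDiff_a.mul hv).mul
    (R.contDiff_fieldBracket_const hφ' (ContDiff.slice hγ 0)))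
  rw [← integral_add i2 i3, ← integral_add i1 (by exact i2.add i3)]
  refine setIntegral_congr_fun R.isOpen.measurableSet fun x hx => ?_
  have h1 : HasDerivAt (fun s : ℝ => elliptic a β S.lam S.sig f x
      + s * elliptic a β S.lam S.sig g x) (elliptic a β S.lam S.sig g x) 0 := by
    simpa using ((hasDerivAt_id (0 : ℝ)).mul_const (elliptic a β S.lam S.sig g x)).const_add
      (elliptic a β S.lam S.sig f x)
  have h2 := (h1.mul (hasDerivAt_fieldBracket β hφ hγ 0 x)).deriv
  refine Eq.trans (b := _) h2 ?_
  simp only [zero_mul, add_zero, R.D_eq hξg hx, R.elliptic_eq hI hf hx]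
  rw [fieldBracket_antisymm β (φ 0) fun y => deriv (fun s => γ s y) 0]
  ring

theorem bracket'_mem_observables (hI : S.Integrability) (hInv : S.InverseDefined)
    {F G : Functional} (hF : F ∈ S.Observables) (hG : G ∈ S.Observables) :
    S.bracket' F G ∈ S.Observables :=
  S.mem_observables (S.bracketDeriv F G) (fun _ hχ => R.hasFunDeriv_bracket' hI hInv hF hG hχ)
    fun _ _ hp hpX => R.smoothFamily_bracketDeriv hInv hF hG hp hpX

/-- The outer bracket is the derivative of the inner one along the Hamiltonian field of `F`, so the
formula for that derivative can be inserted with `ξ` equal to this field. -/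
theorem bracket'_bracket' (hI : S.Integrability) (hInv : S.InverseDefined) {F G H : Functional}
    (hF : F ∈ S.Observables) (hG : G ∈ S.Observables) (hH : H ∈ S.Observables)
    {χ k f g h : E3 → ℝ} (hχ : χ ∈ S.X) (hk : ContDiff ℝ ∞ k) (hχk : EqOn χ k S.Ω)
    (hf : ContDiff ℝ ∞ f) (hFf : EqOn (S.funDeriv F (S.D χ)) f S.Ω)
    (hg : ContDiff ℝ ∞ g) (hGg : EqOn (S.funDeriv G (S.D χ)) g S.Ω)
    (hh : ContDiff ℝ ∞ h) (hHh : EqOn (S.funDeriv H (S.D χ)) h S.Ω) :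
    S.bracket' F (S.bracket' G H) (S.D χ)
      = - (∫ x in S.Ω, a x * vorticity β S.lam S.sig k x
          * fieldBracket β (fieldBracket β g h) f x)
        + ((∫ x in S.Ω, S.sndVar H χ (S.hamField G (S.D χ)) x * S.D (S.hamField F (S.D χ)) x)
          - ∫ x in S.Ω, S.sndVar G χ (S.hamField H (S.D χ)) x * S.D (S.hamField F (S.D χ)) x) := by
  have hGH := R.bracket'_mem_observables hI hInv hG hH
  have hd := R.hasFunDeriv_bracket' hI hInv hG hH hχ
  obtain ⟨j, hj, hJj⟩ := R.exists_rep_funDeriv hGH hχ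
  have h1 := R.setIntegral_mul_D_hamField hI hInv hF hχ hk hχk hf hFf hj hJj
  have h2 := R.bracket'_eq hI hk hχk hJj hFf
  have h3 := S.weightedBracket_antisymm (fun η => η) F (S.bracket' G H) (S.D χ)
  have h4 : S.bracket' F (S.bracket' G H) (S.D χ) = - S.bracket' (S.bracket' G H) F (S.D χ) := h3
  have hb := R.contDiff_fieldBracket_const hg hh
  rw [h4, h2, ← h1, R.funDeriv_eq hd, R.setIntegral_bracketDeriv_mul_D hInv hG hH hχ
    (R.hamField_mem hInv hF hχ) hg hGg hh hHh,
    R.setIntegral_mul_D_hamField hI hInv hF hχ hk hχk hf hFf hb (fun _ _ => rfl)]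

theorem isPoissonBracket (hI : S.Integrability) (hInv : S.InverseDefined) :
    IsPoissonBracket S.Phase S.Observables S.bracket' where
  toIsAntisymmetricBracket := R.isAntisymmetricBracket_bracket'
  bracket_mem F hF G hG := R.bracket'_mem_observables hI hInv hF hG
  jacobi := by
    rintro F hF G hG H hH _ ⟨χ, hχ, rfl⟩
    obtain ⟨k, hk, hχk⟩ := R.exists_rep (R.X_subset hχ)
    obtain ⟨f, hf, hFf⟩ := R.exists_rep_funDeriv hF hχ
    obtain ⟨g, hg, hGg⟩ := R.exists_rep_funDeriv hG hχ
    obtain ⟨h, hh, hHh⟩ := R.exists_rep_funDeriv hH hχ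
    have hrF := R.hamField_mem hInv hF hχ
    have hrG := R.hamField_mem hInv hG hχ
    have hrH := R.hamField_mem hInv hH hχ
    have hi : ∀ {f g h : E3 → ℝ}, ContDiff ℝ ∞ f → ContDiff ℝ ∞ g → ContDiff ℝ ∞ h →
        IntegrableOn (fun x => a x * vorticity β S.lam S.sig k x
          * fieldBracket β (fieldBracket β f g) h x) S.Ω := fun hf hg hh =>
      R.integrableOn ((R.contDiff_a.mul (R.contDiff_vorticity_const hk)).mul
        (R.contDiff_fieldBracket_const (R.contDiff_fieldBracket_const hf hg) hh))
    have hsum : (∫ x in S.Ω, a x * vorticity β S.lam S.sig k x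
          * fieldBracket β (fieldBracket β f g) h x)
        + (∫ x in S.Ω, a x * vorticity β S.lam S.sig k x
          * fieldBracket β (fieldBracket β g h) f x)
        + (∫ x in S.Ω, a x * vorticity β S.lam S.sig k x
          * fieldBracket β (fieldBracket β h f) g x) = 0 := by
      rw [← integral_add (hi hf hg hh) (hi hg hh hf),
        ← integral_add (by exact (hi hf hg hh).add (hi hg hh hf)) (hi hh hf hg)]
      refine setIntegral_eq_zero_of_forall_eq_zero fun x hx => ?_
      rw [← mul_add, ← mul_add, fieldBracket_jacobi R.contDiff_β hf hg hh
        (R.inner_curl_eq_zero hI hx), mul_zero]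
    rw [R.bracket'_bracket' hI hInv hF hG hH hχ hk hχk hf hFf hg hGg hh hHh,
      R.bracket'_bracket' hI hInv hG hH hF hχ hk hχk hg hGg hh hHh hf hFf,
      R.bracket'_bracket' hI hInv hH hF hG hχ hk hχk hh hHh hf hFf hg hGg,
      -- Each of `F`, `G`, `H` contributes two second-variation terms of opposite sign; one use of
      -- symmetry for each makes them cancel.
      R.setIntegral_sndVar_comm hF hχ hrH hrG, R.setIntegral_sndVar_comm hG hχ hrF hrH,
      R.setIntegral_sndVar_comm hH hχ hrG hrF]
    linarith

end Setting.IsRegular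

end GHM

end

theorem mainTheorem2 (S : GHM.Setting)
    (hΩ : IsOpen S.Ω) (hΩb : Bornology.IsBounded S.Ω)
    (hlam : 0 < S.lam) (hsig : 0 < S.sig)
    (hA : GHM.SmoothUpTo S.Ω S.A) (hApos : ∀ x ∈ S.Ω, 0 < S.A x)
    (hA0 : ∀ x ∈ frontier S.Ω, S.A x = 0)
    (hB : GHM.SmoothUpTo S.Ω S.B) (hB0 : ∀ x ∈ closure S.Ω, S.B x ≠ 0)
    (hX : (S.X : Set (GHM.E3 → ℝ)) ⊆ GHM.SmoothBar S.Ω)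
    (hXtest : GHM.TestFunctions S.Ω ⊆ (S.X : Set (GHM.E3 → ℝ))) :
    -- `𝒟` is injective on `𝔛`, and functional derivatives are unique
    Set.InjOn S.D (S.X : Set (GHM.E3 → ℝ)) ∧
    (∀ F η g₁ g₂, S.HasFunDeriv F η g₁ → S.HasFunDeriv F η g₂ → g₁ = g₂) ∧
    -- the original bracket is antisymmetric and the mass is one of its Casimir invariants
    GHM.IsAntisymmetricBracket S.Phase S.Observables S.bracket ∧
    (∀ c : ℝ, GHM.IsCasimir S.Phase S.Observables S.bracket (S.mass c)) ∧
    -- the energy is a smooth functional, with functional derivative `χ`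
    S.energy ∈ S.Observables ∧
    (∀ χ ∈ S.X, S.HasFunDeriv S.energy (S.D χ) χ) ∧
    (S.Integrability →
      -- the modified bracket is a Poisson bracket
      GHM.IsAntisymmetricBracket S.Phase S.Observables S.bracket' ∧
      (S.InverseDefined → GHM.IsPoissonBracket S.Phase S.Observables S.bracket') ∧
      -- the equation has the form `η_t = {η, H_Ω}'`
      (∀ (I : Set ℝ) (χ : ℝ → GHM.E3 → ℝ), IsOpen I → GHM.SmoothFamilyOn S.Ω I χ →
        (∀ t ∈ I, χ t ∈ S.X) → ∀ t ∈ I,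
        (S.SolvesAt χ t ↔ ∀ φ ∈ GHM.TestFunctions S.Ω,
          HasDerivAt (fun s => S.smeared φ (S.D (χ s)))
            (S.bracket' (S.smeared φ) S.energy (S.D (χ t))) t) ∧
        (S.SolvesAt χ t ↔ ∀ F ∈ S.Observables,
          HasDerivAt (fun s => F (S.D (χ s))) (S.bracket' F S.energy (S.D (χ t))) t)) ∧
      -- the generalized enstrophy and the mass are Casimir invariants
      (∀ w : ℝ → ℝ, ContDiff ℝ ∞ w →
        GHM.IsCasimir S.Phase S.Observables S.bracket' (S.enstrophy w)) ∧
      (∀ c : ℝ, GHM.IsCasimir S.Phase S.Observables S.bracket' (S.mass c))) := by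
  obtain ⟨a, β, R⟩ := S.exists_isRegular hΩ hΩb hlam hsig hA hApos hA0 hB hB0 hX hXtest
  exact ⟨R.injOn_D, fun _ _ _ _ => R.hasFunDeriv_unique, R.isAntisymmetricBracket_bracket,
    R.isCasimir_mass _, R.energy_mem_observables, fun _ => R.hasFunDeriv_energy, fun hI =>
    ⟨R.isAntisymmetricBracket_bracket', R.isPoissonBracket hI,
      fun _ _ hIo hχ hχX _ ht => R.equation_iff hI hIo hχ hχX ht,
      fun _ hw => R.isCasimir_enstrophy hI hw, R.isCasimir_mass fun η => η⟩⟩
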